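/- **Setting.** A C*-category is a $\mathbb C$-linear category whose morphism spaces $\mathrm{Mor}(X,Y)$ are Banach spaces (with submultiplicative composition), with a conjugate-linear involutive contravariant functor $f\mapsto f^*$ fixing objects and satisfying $\|f^*f\|=\|ff^*\|=\|f\|^2$. Let $\mathcal C$ be a rigid C*-tensor category: a C*-category with finite-dimensional morphism spaces, direct sums and subobjects, with a bilinear tensor product compatible with $*$ (strict, or more generally with unitary associators and unitors, which are suppressed below), with simple unit $\mathrm{id}$, with countably many isomorphism classes of simple objects, and such that every object $X$ has a conjugate $\overline X$ with a solution $R\in \mathrm{Mor}(\mathrm{id},\overline X\otimes X)$, $\overline R\in\mathrm{Mor}(\mathrm{id},X\otimes\overline X)$ of the conjugate equations $(1\otimes\overline R^*)(R\otimes 1)=1_{\overline X}$, $(1\otimes R^*)(\overline R\otimes 1)=1_X$. The dimension $d(X)$ is the infimum of $\|R\|\,\|\overline R\|$ over all solutions; a solution is standard if $\|R\|=\|\overline R\|=d(X)^{1/2}$. Choose representatives $X_k$ of the classes $k\in\mathrm{Irr}(\mathcal C)$ of simple objects, with $X_0=\mathrm{id}$, and standard solutions $(R_k,\overline R_k)$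 for $X_k$ with conjugate object $X_{\bar k}$. The fusion algebra $\mathbb C[\mathrm{Irr}(\mathcal C)]$ has basis $[X_k]$, product $[X_i][X_j]=\sum_k \dim\mathrm{Mor}(X_k,X_i\otimes X_j)\,[X_k]$ and involution $[X_k]^*=[X_{\bar k}]$. The tube algebra is $\mathcal A=\bigoplus_{i,j,k}\mathcal A^k_{i,j}$, $\mathcal A_{i,j}^k=\mathrm{Mor}(X_k\otimes X_i,X_j\otimes X_k)$, with $$(x\cdot y)^k_{i,j}=\sum_{s,m,l}\ \sum_{V}(1_j\otimes V^*)(x^m_{s,j}\otimes 1_l)(1_m\otimes y^l_{i,s})(V\otimes 1_i),$$ where $V$ runs over an orthonormal basis of $\mathrm{Mor}(X_k,X_m\otimes X_l)$ (with $\langle\xi,\eta\rangle 1=\eta^*\xi$), and $$(x^\#)^k_{i,j}=(\overline R_k^*\otimes 1_j\otimes 1_k)(1_k\otimes (x^{\bar k}_{j,i})^*\otimes 1_k)(1_k\otimes 1_i\otimes R_k).$$ Put $p_0=1_{\mathrm{id}}\in\mathcal A^0_{0,0}$; the fusion algebra is identified with the corner $p_0\mathcal Ap_0$ through $[X_k]\mapsto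 1_{X_k}\in\mathcal A^k_{0,0}$. A $*$-representation of the fusion algebra on a Hilbert space is *admissible* if it is unitarily equivalent to the restriction to $p_0\mathcal Ap_0$, acting on the range of $p_0$, of a non-degenerate $*$-representation of $\mathcal A$ by bounded operators. $C^*(\mathcal C)$ is the norm closure of the image of the fusion algebra under the universal admissible representation, that is, the completion for the norm $\sup_\pi\|\pi(f)\|$ over all admissible $\pi$. A function $\phi\in\ell^\infty(\mathrm{Irr}(\mathcal C))$ is a *cp-multiplier* if the functional $\sum_k c_k[X_k]\mapsto\sum_k c_k\,d(X_k)\,\phi(k)$ is a vector state in an admissible representation. $\mathcal C$ has *property (T)* if every sequence of cp-multipliers that converges to $1$ pointwise on $\mathrm{Irr}(\mathcal C)$ converges to $1$ uniformly. **Statement.** Suppose that the fusion algebra of $\mathcal C$ is commutative. The universal admissible representation is well defined (for each $f$ in the fusion algebra the operators $\pi(f)$, $\pi$ admissible, are uniformly bounded), and there is a compact Hausdorff space $Z$ with $C^*(\mathcal C)\cong C(Z)$ as C*-algebras. For every compact Hausdorff space $Z$ and every $*$-isomorphism $C^*(\mathcal C)\cong C(Z)$ there is exactly one point $1_{\mathcal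 C}\in Z$ (the trivial representation) at which the function corresponding to $[X_k]$ takes the value $d(X_k)$ for all $k\in\mathrm{Irr}(\mathcal C)$, and $$\mathcal C\ \text{has property (T)}\iff 1_{\mathcal C}\ \text{is an isolated point of } Z .$$ -/

import Mathlib

open CategoryTheory MonoidalCategory
universe v u w
set_option linter.unusedSectionVars false
namespace RigidCStar
noncomputable section

/-- A C*-category: a `ℂ`-linear category with Banach spaces of morphisms and a conjugate-linear
involutive contravariant functor `dag` (written `f ↦ f*`) that fixes the objects and satisfies
`‖f* f‖ = ‖f f*‖ = ‖f‖²`. Composition is diagrammatic: `f* f` is `f ≫ dag f`. -/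
class CStarCategory (C : Type u) [Category.{v} C] [Preadditive C] [Linear ℂ C] where
  dag : ∀ {X Y : C}, (X ⟶ Y) → (Y ⟶ X)
  dag_dag : ∀ {X Y : C} (f : X ⟶ Y), dag (dag f) = f
  dag_id : ∀ X : C, dag (𝟙 X) = 𝟙 X
  dag_comp : ∀ {X Y Z : C} (f : X ⟶ Y) (g : Y ⟶ Z), dag (f ≫ g) = dag g ≫ dag f
  dag_add : ∀ {X Y : C} (f g : X ⟶ Y), dag (f + g) = dag f + dag g
  dag_smul : ∀ {X Y : C} (c : ℂ) (f : X ⟶ Y), dag (c • f) = star c • dag f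
  homNorm : ∀ {X Y : C}, (X ⟶ Y) → ℝ
  homNorm_add_le : ∀ {X Y : C} (f g : X ⟶ Y), homNorm (f + g) ≤ homNorm f + homNorm g
  homNorm_smul : ∀ {X Y : C} (c : ℂ) (f : X ⟶ Y), homNorm (c • f) = ‖c‖ * homNorm f
  eq_zero_of_homNorm : ∀ {X Y : C} (f : X ⟶ Y), homNorm f = 0 → f = 0
  homNorm_comp_le : ∀ {X Y Z : C} (f : X ⟶ Y) (g : Y ⟶ Z),
    homNorm (f ≫ g) ≤ homNorm f * homNorm g
  homNorm_complete : ∀ {X Y : C} (f : ℕ → (X ⟶ Y)),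
    (∀ ε > 0, ∃ N, ∀ m ≥ N, ∀ n ≥ N, homNorm (f m - f n) < ε) →
      ∃ g : X ⟶ Y, ∀ ε > 0, ∃ N, ∀ n ≥ N, homNorm (f n - g) < ε
  homNorm_star_mul : ∀ {X Y : C} (f : X ⟶ Y), homNorm (f ≫ dag f) = homNorm f ^ 2
  homNorm_mul_star : ∀ {X Y : C} (f : X ⟶ Y), homNorm (dag f ≫ f) = homNorm f ^ 2

section
variable {C : Type u} [Category.{v} C] [Preadditive C] [Linear ℂ C] [CStarCategory C]
open CStarCategory

theorem homNorm_zero (X Y : C) : homNorm (0 : X ⟶ Y) = 0 := by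
  simpa using homNorm_smul (0 : ℂ) (0 : X ⟶ Y)

theorem homNorm_nonneg {X Y : C} (f : X ⟶ Y) : 0 ≤ homNorm f := by
  have h := homNorm_add_le f ((-1 : ℂ) • f)
  rw [homNorm_smul] at h
  simp [homNorm_zero] at h
  exact h

/-- The normed ring `Mor(X, X)`. -/
abbrev endNormedRing (X : C) : NormedRing (End X) :=
  letI n : NormedAddCommGroup (End X) := AddGroupNorm.toNormedAddCommGroup
    { toFun := fun f => homNorm (X := X) (Y := X) f
      map_zero' := homNorm_zero X X
      add_le' := homNorm_add_le
      neg' := fun f => by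
        have := homNorm_smul (-1 : ℂ) (show X ⟶ X from f)
        simp at this
        exact this
      eq_zero_of_map_eq_zero' := fun f => eq_zero_of_homNorm (X := X) (Y := X) f }
  { n, (inferInstance : Ring (End X)) with
    norm_mul_le := fun f g => by
      have := homNorm_comp_le (X := X) (Y := X) (Z := X) g f
      rw [mul_comm] at this
      exact this }

/-- The C*-algebra `Mor(X, X)`. -/
abbrev endCStar (X : C) [FiniteDimensional ℂ (X ⟶ X)] : CStarAlgebra (End X) :=
  letI := endNormedRing X
  letI : NormedAlgebra ℂ (End X) :=
    { (inferInstance : Algebra ℂ (End X)) with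
      norm_smul_le := fun c f => (homNorm_smul (X := X) (Y := X) c f).le }
  letI : StarRing (End X) :=
    { star := fun f => dag (X := X) (Y := X) f
      star_involutive := fun f => dag_dag (X := X) (Y := X) f
      star_mul := fun f g => dag_comp (X := X) (Y := X) (Z := X) g f
      star_add := fun f g => dag_add (X := X) (Y := X) f g }
  letI : FiniteDimensional ℂ (End X) := ‹FiniteDimensional ℂ (X ⟶ X)›
  { complete := (FiniteDimensional.complete ℂ (End X)).complete
    star_smul := fun c f => dag_smul (X := X) (Y := X) c f
    norm_mul_self_le := fun f => by
      have := (homNorm_star_mul (X := X) (Y := X) f)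
      rw [sq] at this
      exact this.ge }

/-- If `Mor(X, X)` is not `ℂ`, it contains a nontrivial projection. -/
theorem exists_projection (X : C) [FiniteDimensional ℂ (X ⟶ X)]
    (h : 1 < Module.finrank ℂ (X ⟶ X)) :
    ∃ p : X ⟶ X, p ≫ p = p ∧ dag p = p ∧ p ≠ 0 ∧ p ≠ 𝟙 X := by
  let _ : FiniteDimensional ℂ (End X) := ‹FiniteDimensional ℂ (X ⟶ X)›
  let _ := endCStar X
  have h1 : ∃ a : End X, IsSelfAdjoint a ∧ ∀ c : ℂ, a ≠ algebraMap ℂ (End X) c := by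
    by_contra! hc
    have : ∀ a : End X, ∃ c : ℂ, algebraMap ℂ (End X) c = a := by
      intro a
      obtain ⟨c, hc1⟩ := hc _ (realPart a).2
      obtain ⟨d, hd1⟩ := hc _ (imaginaryPart a).2
      refine ⟨c + Complex.I * d, ?_⟩
      conv_rhs => rw [← realPart_add_I_smul_imaginaryPart a]
      rw [hc1, hd1, map_add, map_mul, Algebra.smul_def]
    have h2 : Module.finrank ℂ (End X) ≤ 1 :=
      finrank_le_one (1 : End X) (fun a => by
        obtain ⟨c, hc⟩ := this a
        exact ⟨c, by rw [← hc, Algebra.algebraMap_eq_smul_one]⟩)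
    exact absurd h (not_lt.2 h2)
  obtain ⟨a, ha, hac⟩ := h1
  have : Nontrivial (End X) := by
    by_contra hn
    rw [not_nontrivial_iff_subsingleton] at hn
    exact hac 0 (Subsingleton.elim _ _)
  have hfin : (spectrum ℂ a).Finite := by
    have h2 : IsIntegral ℂ a := IsIntegral.of_finite ℂ a
    refine ((minpoly ℂ a).roots.toFinset.finite_toSet).subset ?_
    intro z hz
    have h3 := spectrum.subset_polynomial_aeval a (minpoly ℂ a) ⟨z, hz, rfl⟩
    rw [minpoly.aeval, spectrum.zero_eq, Set.mem_singleton_iff] at h3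
    simpa [minpoly.ne_zero h2] using h3
  obtain ⟨c, hc⟩ := spectrum.nonempty a
  have hn := ha.isStarNormal
  let f : ℂ → ℂ := fun z => if z = c then 1 else 0
  have hcont : ContinuousOn f (spectrum ℂ a) := hfin.continuousOn f
  have hne : ∃ z ∈ spectrum ℂ a, z ≠ c := by
    by_contra! hz
    apply hac c
    rw [← cfc_id ℂ a, ← cfc_const c a]
    exact cfc_congr (fun z hz' => by simpa using hz z hz')
  have hspec : spectrum ℂ (cfc f a) = f '' spectrum ℂ a := cfc_map_spectrum f a
  let p : End X := cfc f a
  refine ⟨p, ?_, ?_, ?_, ?_⟩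
  · have : cfc f a * cfc f a = cfc f a := by
      rw [← cfc_mul f f a]
      exact cfc_congr (fun z _ => by simp [f])
    exact this
  · have : star (cfc f a) = cfc f a := by
      rw [← cfc_star f a]
      exact cfc_congr (fun z _ => by by_cases h : z = c <;> simp [f, h])
    exact this
  · intro h0
    have h1 : (1 : ℂ) ∈ spectrum ℂ (cfc f a) := hspec ▸ ⟨c, hc, by simp [f]⟩
    have h2 : cfc f a = (0 : End X) := h0
    rw [h2, spectrum.zero_eq] at h1
    simp at h1
  · intro h0
    obtain ⟨z, hz, hzc⟩ := hne
    have h1 : (0 : ℂ) ∈ spectrum ℂ (cfc f a) := hspec ▸ ⟨z, hz, by simp [f, hzc]⟩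
    have h2 : cfc f a = (1 : End X) := h0
    rw [h2, spectrum.one_eq] at h1
    simp at h1

/-- `Mor(X, X) ≅ ℂ`. -/
def IsSimpleObj (X : C) : Prop := Module.finrank ℂ (X ⟶ X) = 1

/-- `f` is a (unitary) isomorphism: `f* f = 1` and `f f* = 1`. -/
def IsUnitary {X Y : C} (f : X ⟶ Y) : Prop := f ≫ dag f = 𝟙 X ∧ dag f ≫ f = 𝟙 Y

variable (C) in
/-- The simple objects. -/
def SimpleObj : Type u := {X : C // IsSimpleObj X}

variable (C) in
/-- Unitary isomorphism of simple objects. -/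
instance simpleSetoid : Setoid (SimpleObj C) where
  r X Y := ∃ f : X.1 ⟶ Y.1, IsUnitary f
  iseqv :=
    { refl := fun X => ⟨𝟙 X.1, by simp [IsUnitary, dag_id]⟩
      symm := fun ⟨f, hf⟩ => ⟨dag f, by simpa [IsUnitary, dag_dag] using hf.symm⟩
      trans := fun ⟨f, hf⟩ ⟨g, hg⟩ => ⟨f ≫ g, by
        constructor
        · rw [dag_comp, Category.assoc, ← Category.assoc g, hg.1, Category.id_comp, hf.1]
        · rw [dag_comp, Category.assoc, ← Category.assoc (dag f), hf.2, Category.id_comp, hg.2]⟩ }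

variable (C) in
/-- Isomorphism classes of simple objects. -/
def Irr : Type u := Quotient (simpleSetoid C)

/-- The class of a simple object. -/
def Irr.mk (X : C) (h : IsSimpleObj X) : Irr C := Quotient.mk _ ⟨X, h⟩

/-- `(R, Rb)` solves the conjugate equations for `X` with conjugate object `Xb`:
`(1 ⊗ Rb*)(R ⊗ 1) = 1` on `Xb` and `(1 ⊗ R*)(Rb ⊗ 1) = 1` on `X`. -/
structure IsConjugateSolution [MonoidalCategory C] (X Xb : C)
    (R : 𝟙_ C ⟶ Xb ⊗ X) (Rb : 𝟙_ C ⟶ X ⊗ Xb) : Prop where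
  left : (λ_ Xb).inv ≫ R ▷ Xb ≫ (α_ Xb X Xb).hom ≫ Xb ◁ dag Rb ≫ (ρ_ Xb).hom = 𝟙 Xb
  right : (λ_ X).inv ≫ Rb ▷ X ≫ (α_ X Xb X).hom ≫ X ◁ dag R ≫ (ρ_ X).hom = 𝟙 X
end

open CStarCategory

/-- A rigid C*-tensor category: a semi-simple C*-category with a bilinear tensor product compatible
with the involution (with unitary associators and unitors; the strict case is the one where these
are identities), a simple unit, conjugates, and countably many classes of simple objects. -/
class RigidCStarTensorCategory (C : Type u) [Category.{v} C] [Preadditive C] [Linear ℂ C]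
    [MonoidalCategory C] [MonoidalPreadditive C] [MonoidalLinear ℂ C]
    extends CStarCategory C where
  finiteDimensional_hom : ∀ X Y : C, FiniteDimensional ℂ (X ⟶ Y)
  exists_directSum : ∀ X Y : C, ∃ (Z : C) (v : X ⟶ Z) (w : Y ⟶ Z),
    v ≫ dag v = 𝟙 X ∧ w ≫ dag w = 𝟙 Y ∧ dag v ≫ v + dag w ≫ w = 𝟙 Z
  exists_subobject : ∀ (X : C) (p : X ⟶ X), p ≫ p = p → dag p = p →
    ∃ (Y : C) (v : Y ⟶ X), v ≫ dag v = 𝟙 Y ∧ dag v ≫ v = p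
  dag_tensor : ∀ {X Y X' Y' : C} (f : X ⟶ Y) (g : X' ⟶ Y'), dag (f ⊗ₘ g) = dag f ⊗ₘ dag g
  dag_associator : ∀ X Y Z : C, dag (α_ X Y Z).hom = (α_ X Y Z).inv
  dag_leftUnitor : ∀ X : C, dag (λ_ X).hom = (λ_ X).inv
  dag_rightUnitor : ∀ X : C, dag (ρ_ X).hom = (ρ_ X).inv
  simple_unit : IsSimpleObj (𝟙_ C)
  exists_conjugate : ∀ X : C, ∃ (Xb : C) (R : 𝟙_ C ⟶ Xb ⊗ X) (Rb : 𝟙_ C ⟶ X ⊗ Xb),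
    IsConjugateSolution X Xb R Rb
  countable_irr : Countable (Irr C)

section
variable {C : Type u} [Category.{v} C] [Preadditive C] [Linear ℂ C]
    [MonoidalCategory C] [MonoidalPreadditive C] [MonoidalLinear ℂ C]
    [RigidCStarTensorCategory C]
open RigidCStarTensorCategory

instance (X Y : C) : FiniteDimensional ℂ (X ⟶ Y) := finiteDimensional_hom X Y

theorem dag_zero (X Y : C) : dag (0 : X ⟶ Y) = 0 := by
  simpa using dag_smul (0 : ℂ) (0 : X ⟶ Y)

theorem IsSimpleObj.id_ne_zero {X : C} (h : IsSimpleObj X) : 𝟙 X ≠ 0 := by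
  intro h0
  have : Subsingleton (X ⟶ X) :=
    ⟨fun f g => by rw [← Category.comp_id f, ← Category.comp_id g, h0]; simp⟩
  have h1 : Module.finrank ℂ (X ⟶ X) = 0 := Module.finrank_zero_of_subsingleton
  rw [IsSimpleObj] at h
  omega

theorem IsSimpleObj.exists_smul {X : C} (h : IsSimpleObj X) (f : X ⟶ X) :
    ∃ c : ℂ, f = c • 𝟙 X := by
  obtain ⟨c, hc⟩ := (finrank_eq_one_iff_of_nonzero' (𝟙 X) h.id_ne_zero).1 h f
  exact ⟨c, hc.symm⟩

theorem eq_zero_of_comp_dag {X Y : C} (f : X ⟶ Y) (h : f ≫ dag f = 0) : f = 0 := by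
  apply eq_zero_of_homNorm
  have := homNorm_star_mul f
  rw [h, homNorm_zero] at this
  exact pow_eq_zero_iff two_ne_zero |>.1 this.symm

/-- Positivity of `f* f`, by passing to the C*-algebra of endomorphisms of a direct sum. -/
theorem IsSimpleObj.star_mul_pos {X Y : C} (h : IsSimpleObj X) (f : X ⟶ Y) :
    ∃ c : ℂ, f ≫ dag f = (c • 𝟙 X) ≫ dag (c • 𝟙 X) := by
  obtain ⟨d, hd⟩ := h.exists_smul (f ≫ dag f)
  have hreal : star d = d := by
    have h1 := congrArg dag hd
    rw [dag_comp, dag_dag, hd, dag_smul, dag_id] at h1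
    exact smul_left_injective ℂ h.id_ne_zero h1.symm
  obtain ⟨r, rfl⟩ := Complex.conj_eq_iff_real.1 hreal
  rcases le_or_gt 0 r with hr | hr
  · refine ⟨(√r : ℝ), ?_⟩
    rw [hd, dag_smul, dag_id, Linear.smul_comp, Linear.comp_smul, smul_smul, Category.comp_id]
    congr 1
    simp [← Complex.ofReal_mul, Real.mul_self_sqrt hr]
  · refine ⟨0, ?_⟩
    suffices hf : f = 0 by simp [hf]
    obtain ⟨Z, v, w, hv, hw, -⟩ := exists_directSum X Y
    let _ : FiniteDimensional ℂ (Z ⟶ Z) := finiteDimensional_hom Z Z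
    let _ := endCStar Z
    let _ : PartialOrder (End Z) := CStarAlgebra.spectralOrder _
    have _ : StarOrderedRing (End Z) := CStarAlgebra.spectralOrderedRing _
    let B : End Z := dag v ≫ f ≫ w
    let E : End Z := dag v ≫ v
    have hB : star B * B = (r : ℂ) • (star E * E) := by
      change (dag v ≫ f ≫ w) ≫ dag (dag v ≫ f ≫ w) =
        (r : ℂ) • ((dag v ≫ v) ≫ dag (dag v ≫ v))
      simp only [dag_comp, dag_dag, Category.assoc]
      rw [← Category.assoc w, hw, Category.id_comp, ← Category.assoc f, hd,
        ← Category.assoc v, hv, Category.id_comp, Linear.smul_comp, Linear.comp_smul,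
        Category.id_comp]
    have h1 : 0 ≤ star B * B := star_mul_self_nonneg B
    have h2 : 0 ≤ star ((√(-r) : ℝ) • E) * ((√(-r) : ℝ) • E) := star_mul_self_nonneg _
    have h3 : star ((√(-r) : ℝ) • E) * ((√(-r) : ℝ) • E) = -(star B * B) := by
      rw [hB, star_smul, smul_mul_smul_comm, star_trivial, Real.mul_self_sqrt (by linarith),
        neg_smul, Complex.coe_smul]
    rw [h3] at h2
    have h4 : star B * B = 0 := le_antisymm (by simpa using h2) h1
    have h5 : B = 0 := CStarRing.star_mul_self_eq_zero_iff B |>.1 h4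
    have h6 : v ≫ (dag v ≫ f ≫ w) ≫ dag w = f := by
      simp only [Category.assoc, hw, Category.comp_id]
      rw [← Category.assoc, hv, Category.id_comp]
    have h7 : dag v ≫ f ≫ w = 0 := h5
    rw [← h6, h7]
    simp

/-- A nonzero morphism out of a simple object is a positive multiple of an isometry. -/
theorem IsSimpleObj.exists_isometry {X Y : C} (h : IsSimpleObj X) (f : X ⟶ Y) (hf : f ≠ 0) :
    ∃ c : ℂ, c ≠ 0 ∧ (c • f) ≫ dag (c • f) = 𝟙 X := by
  obtain ⟨c, hg⟩ := h.star_mul_pos f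
  have hc : c ≠ 0 := by
    rintro rfl
    apply hf
    apply eq_zero_of_comp_dag
    simp [hg]
  refine ⟨c⁻¹, inv_ne_zero hc, ?_⟩
  rw [dag_smul, Linear.smul_comp, Linear.comp_smul, hg, dag_smul, Linear.smul_comp,
    Linear.comp_smul, dag_id, smul_smul, smul_smul, smul_smul]
  have : star c ≠ 0 := by simpa using hc
  rw [star_inv₀, Category.comp_id]
  have : c⁻¹ * (star c)⁻¹ * c * star c = 1 := by field_simp
  rw [this, one_smul]

/-- Schur's lemma. -/
theorem exists_unitary_of_ne_zero {X Y : C} (hX : IsSimpleObj X) (hY : IsSimpleObj Y)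
    (f : X ⟶ Y) (hf : f ≠ 0) : ∃ c : ℂ, c ≠ 0 ∧ IsUnitary (c • f) := by
  obtain ⟨c, hc, h1⟩ := hX.exists_isometry f hf
  refine ⟨c, hc, h1, ?_⟩
  set g := c • f
  obtain ⟨d, hd⟩ := hY.exists_smul (dag g ≫ g)
  have h2 : (dag g ≫ g) ≫ (dag g ≫ g) = dag g ≫ g := by
    rw [Category.assoc, ← Category.assoc g, h1, Category.id_comp]
  rw [hd, Linear.smul_comp, Linear.comp_smul, Category.comp_id, smul_smul] at h2
  have h3 : d * d = d := smul_left_injective ℂ hY.id_ne_zero h2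
  have h4 : d ≠ 0 := by
    rintro rfl
    have : g ≫ (dag g ≫ g) = g := by rw [← Category.assoc, h1, Category.id_comp]
    rw [hd] at this
    simp at this
    rw [← this, Limits.zero_comp] at h1
    exact hX.id_ne_zero h1.symm
  rw [hd, mul_right_cancel₀ h4 (h3.trans (one_mul d).symm), one_smul]

variable (C) in
/-- The class `0` of the unit object. -/
def Irr.unit : Irr C := Irr.mk (𝟙_ C) simple_unit

open Classical in
/-- The chosen representative `X_k` of the class `k`; the unit object represents its class. -/
def Irr.rep (k : Irr C) : C := if k = Irr.unit C then 𝟙_ C else (Quotient.out k).1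

theorem Irr.rep_unit : (Irr.unit C).rep = 𝟙_ C := if_pos rfl

theorem Irr.rep_simple (k : Irr C) : IsSimpleObj k.rep := by
  unfold Irr.rep
  split_ifs
  · exact simple_unit
  · exact (Quotient.out k).2

theorem Irr.mk_rep (k : Irr C) : Irr.mk k.rep k.rep_simple = k := by
  by_cases h : k = Irr.unit C
  · subst h
    simp only [Irr.rep_unit]
    rfl
  · have h1 : k.rep = (Quotient.out k).1 := if_neg h
    simp only [h1]
    exact Quotient.out_eq k

theorem Irr.exists_unitary_rep (X : C) (h : IsSimpleObj X) :
    ∃ f : (Irr.mk X h).rep ⟶ X, IsUnitary f :=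
  Quotient.exact (Irr.mk_rep (Irr.mk X h))

theorem Irr.eq_of_ne_zero {k l : Irr C} (f : k.rep ⟶ l.rep) (hf : f ≠ 0) : k = l := by
  obtain ⟨c, -, hc⟩ := exists_unitary_of_ne_zero k.rep_simple l.rep_simple f hf
  rw [← k.mk_rep, ← l.mk_rep]
  exact Quotient.sound ⟨_, hc⟩

/-- An orthogonal decomposition of `Y` into the chosen simple objects. For every `k`, the morphisms
`emb a` with `idx a = k` form an orthonormal basis of `Mor(X_k, Y)` for the inner product
`⟨ξ, η⟩ 1 = η* ξ`. -/
structure Decomposition (Y : C) where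
  ι : Type
  [fintype : Fintype ι]
  idx : ι → Irr C
  emb : ∀ a, (idx a).rep ⟶ Y
  isometry : ∀ a, emb a ≫ dag (emb a) = 𝟙 (idx a).rep
  orthogonal : ∀ a b, a ≠ b → emb a ≫ dag (emb b) = 0
  complete : ∑ a, dag (emb a) ≫ emb a = 𝟙 Y

attribute [instance] Decomposition.fintype

theorem comp_dag_eq_zero {X Y Z : C} (v : X ⟶ Z) (w : Y ⟶ Z) (hv : v ≫ dag v = 𝟙 X)
    (hvw : dag v ≫ v + dag w ≫ w = 𝟙 Z) (hw : w ≫ dag w = 𝟙 Y) : v ≫ dag w = 0 := by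
  have h : v ≫ (dag v ≫ v + dag w ≫ w) ≫ dag w = v ≫ dag w := by
    rw [hvw, Category.id_comp]
  simp only [Preadditive.add_comp, Preadditive.comp_add, Category.assoc, hw, Category.comp_id] at h
  rw [← Category.assoc v, hv, Category.id_comp] at h
  simpa using h


theorem comp_isometry_dag {A B X Z : C} (v : X ⟶ Z) (hv : v ≫ dag v = 𝟙 X) (f : A ⟶ X)
    (g : B ⟶ X) : (f ≫ v) ≫ dag (g ≫ v) = f ≫ dag g := by
  rw [dag_comp, Category.assoc, ← Category.assoc v, hv, Category.id_comp]

theorem comp_dag_comp_eq_zero {A B X Y Z : C} (v : X ⟶ Z) (w : Y ⟶ Z) (h : v ≫ dag w = 0)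
    (f : A ⟶ X) (g : B ⟶ Y) : (f ≫ v) ≫ dag (g ≫ w) = 0 := by
  rw [dag_comp, Category.assoc, ← Category.assoc v, h, Limits.zero_comp, Limits.comp_zero]

theorem Decomposition.sum_comp {X Z : C} (d : Decomposition X) (v : X ⟶ Z) :
    ∑ a, dag (d.emb a ≫ v) ≫ d.emb a ≫ v = dag v ≫ v := by
  have h : dag v ≫ (∑ a, dag (d.emb a) ≫ d.emb a) ≫ v = dag v ≫ v := by
    rw [d.complete, Category.id_comp]
  rw [← h, Preadditive.sum_comp, Preadditive.comp_sum]
  simp only [dag_comp, Category.assoc]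

theorem Decomposition.sum {X Y Z : C} (dX : Decomposition X) (dY : Decomposition Y)
    (v : X ⟶ Z) (w : Y ⟶ Z) (hv : v ≫ dag v = 𝟙 X) (hw : w ≫ dag w = 𝟙 Y)
    (hvw : dag v ≫ v + dag w ≫ w = 𝟙 Z) : Nonempty (Decomposition Z) := by
  have h1 : v ≫ dag w = 0 := comp_dag_eq_zero v w hv hvw hw
  have h2 : w ≫ dag v = 0 := by
    rw [← dag_dag w, ← dag_comp, h1, dag_zero]
  refine ⟨{ ι := dX.ι ⊕ dY.ι
            idx := Sum.elim dX.idx dY.idx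
            emb := fun a => match a with
              | .inl a => dX.emb a ≫ v
              | .inr a => dY.emb a ≫ w
            isometry := ?_
            orthogonal := ?_
            complete := ?_ }⟩
  · rintro (a | a)
    · exact (comp_isometry_dag v hv _ _).trans (dX.isometry a)
    · exact (comp_isometry_dag w hw _ _).trans (dY.isometry a)
  · rintro (a | a) (b | b) hab
    · exact (comp_isometry_dag v hv _ _).trans (dX.orthogonal a b (fun h => hab (h ▸ rfl)))
    · exact comp_dag_comp_eq_zero v w h1 _ _
    · exact comp_dag_comp_eq_zero w v h2 _ _
    · exact (comp_isometry_dag w hw _ _).trans (dY.orthogonal a b (fun h => hab (h ▸ rfl)))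
  · rw [Fintype.sum_sum_type, ← hvw]
    exact congrArg₂ (· + ·) (dX.sum_comp v) (dY.sum_comp w)

theorem finrank_lt_of_isometry {X Y : C} (v : X ⟶ Y) (hv : v ≫ dag v = 𝟙 X)
    (hne : dag v ≫ v ≠ 𝟙 Y) :
    Module.finrank ℂ (X ⟶ X) < Module.finrank ℂ (Y ⟶ Y) := by
  let L : (X ⟶ X) →ₗ[ℂ] (Y ⟶ Y) :=
    { toFun := fun f => dag v ≫ f ≫ v
      map_add' := fun f g => by simp
      map_smul' := fun c f => by simp }
  have hL : Function.Injective L := by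
    intro f g h
    have h' : v ≫ (dag v ≫ f ≫ v) ≫ dag v = v ≫ (dag v ≫ g ≫ v) ≫ dag v := by
      have h0 : dag v ≫ f ≫ v = dag v ≫ g ≫ v := h
      rw [h0]
    simp only [Category.assoc, hv, Category.comp_id] at h'
    rwa [← Category.assoc v, ← Category.assoc v, hv, Category.id_comp, Category.id_comp] at h'
  rw [← LinearMap.finrank_range_of_inj hL]
  apply Submodule.finrank_lt
  intro htop
  obtain ⟨f, hf⟩ : 𝟙 Y ∈ LinearMap.range L := htop ▸ Submodule.mem_top
  have hf' : dag v ≫ f ≫ v = 𝟙 Y := hf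
  apply hne
  calc dag v ≫ v = (dag v ≫ v) ≫ (dag v ≫ f ≫ v) := by rw [hf', Category.comp_id]
    _ = dag v ≫ f ≫ v := by
      rw [Category.assoc, ← Category.assoc v, hv, Category.id_comp]
    _ = 𝟙 Y := hf'

theorem nonempty_decomposition (Y : C) : Nonempty (Decomposition Y) := by
  induction hn : Module.finrank ℂ (Y ⟶ Y) using Nat.strong_induction_on generalizing Y with
  | _ n ih =>
  rcases lt_trichotomy n 1 with h | h | h
  · have h0 : Module.finrank ℂ (Y ⟶ Y) = 0 := by omega
    have : Subsingleton (Y ⟶ Y) := Module.finrank_zero_iff.1 h0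
    exact ⟨{ ι := Empty
             idx := fun a => a.elim
             emb := fun a => a.elim
             isometry := fun a => a.elim
             orthogonal := fun a => a.elim
             complete := Subsingleton.elim _ _ }⟩
  · have hs : IsSimpleObj Y := hn.trans h
    obtain ⟨f, hf⟩ := Irr.exists_unitary_rep Y hs
    exact ⟨{ ι := Unit
             idx := fun _ => Irr.mk Y hs
             emb := fun _ => f
             isometry := fun _ => hf.1
             orthogonal := fun a b hab => (hab rfl).elim
             complete := by simpa using hf.2 }⟩
  · obtain ⟨p, hp, hps, hp0, hp1⟩ := exists_projection Y (hn ▸ h)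
    obtain ⟨X₁, v, hv, hvp⟩ := exists_subobject Y p hp hps
    have hdag : dag (𝟙 Y - p) = 𝟙 Y - p := by
      have := dag_add (𝟙 Y) ((-1 : ℂ) • p)
      rw [dag_smul, dag_id, hps] at this
      simpa [sub_eq_add_neg] using this
    obtain ⟨X₂, w, hw, hwp⟩ := exists_subobject Y (𝟙 Y - p) (by simp [hp]) hdag
    obtain ⟨d₁⟩ := ih _ (hn ▸ finrank_lt_of_isometry v hv (hvp ▸ hp1)) X₁ rfl
    obtain ⟨d₂⟩ := ih _ (hn ▸ finrank_lt_of_isometry w hw (by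
      rw [hwp]
      intro h
      apply hp0
      simpa using h)) X₂ rfl
    exact d₁.sum d₂ v w hv hw (by rw [hvp, hwp]; simp)

/-- A choice of orthonormal bases of all the spaces `Mor(X_k, Y)`. -/
def decomposition (Y : C) : Decomposition Y := Classical.choice (nonempty_decomposition Y)


theorem dag_whiskerLeft (X : C) {Y Z : C} (f : Y ⟶ Z) : dag (X ◁ f) = X ◁ dag f := by
  rw [← id_tensorHom, dag_tensor, dag_id, id_tensorHom]

theorem dag_whiskerRight {Y Z : C} (f : Y ⟶ Z) (X : C) : dag (f ▷ X) = dag f ▷ X := by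
  rw [← tensorHom_id, dag_tensor, dag_id, tensorHom_id]

theorem IsUnitary.dag {X Y : C} {f : X ⟶ Y} (h : IsUnitary f) : IsUnitary (dag f) := by
  simpa [IsUnitary, dag_dag] using h.symm

theorem homNorm_comp_isometry {X Y Z : C} (f : X ⟶ Y) (w : Y ⟶ Z) (hw : w ≫ dag w = 𝟙 Y) :
    homNorm (f ≫ w) = homNorm f := by
  have h := homNorm_star_mul (f ≫ w)
  rw [dag_comp, Category.assoc, ← Category.assoc w, hw, Category.id_comp, homNorm_star_mul] at h
  exact ((pow_left_inj₀ (homNorm_nonneg _) (homNorm_nonneg _) two_ne_zero).1 h).symm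

namespace IsConjugateSolution
variable {X Xb : C} {R : 𝟙_ C ⟶ Xb ⊗ X} {Rb : 𝟙_ C ⟶ X ⊗ Xb}

theorem symm (h : IsConjugateSolution X Xb R Rb) : IsConjugateSolution Xb X Rb R :=
  ⟨h.right, h.left⟩

/-- A solution of the conjugate equations makes `Xb` a dual of `X`. -/
abbrev exactPairing (h : IsConjugateSolution X Xb R Rb) : ExactPairing X Xb where
  coevaluation' := Rb
  evaluation' := dag R
  coevaluation_evaluation' := by
    have h1 := congrArg dag h.left
    simp only [dag_comp, dag_id, dag_whiskerLeft, dag_whiskerRight, dag_dag, Category.assoc,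
      dag_associator, dag_rightUnitor] at h1
    have h2 : dag (λ_ Xb).inv = (λ_ Xb).hom := by rw [← dag_leftUnitor, dag_dag]
    rw [h2, Iso.inv_comp_eq] at h1
    rw [← cancel_mono (λ_ Xb).hom]
    simpa using h1
  evaluation_coevaluation' := by
    have h1 := h.right
    rw [Iso.inv_comp_eq] at h1
    rw [← cancel_mono (ρ_ X).hom]
    simpa using h1

theorem transport (h : IsConjugateSolution X Xb R Rb) {Yb : C} (u : Xb ⟶ Yb) (hu : IsUnitary u) :
    IsConjugateSolution X Yb (R ≫ u ▷ X) (Rb ≫ X ◁ u) where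
  left := by
    have h1 : dag u ≫ ((λ_ Xb).inv ≫ R ▷ Xb ≫ (α_ Xb X Xb).hom ≫ Xb ◁ dag Rb ≫ (ρ_ Xb).hom)
        ≫ u = 𝟙 Yb := by rw [h.left, Category.id_comp, hu.2]
    rw [← h1]
    simp only [dag_comp, dag_whiskerLeft, comp_whiskerRight, MonoidalCategory.whiskerLeft_comp,
      Category.assoc]
    rw [associator_naturality_left_assoc, ← whisker_exchange_assoc u, ← whisker_exchange_assoc u,
      rightUnitor_naturality, leftUnitor_inv_naturality_assoc, whisker_exchange_assoc,
      associator_naturality_right_assoc]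
  right := by
    rw [← h.right]
    simp only [dag_comp, dag_whiskerRight, comp_whiskerRight, MonoidalCategory.whiskerLeft_comp,
      Category.assoc]
    rw [associator_naturality_middle_assoc, ← MonoidalCategory.whiskerLeft_comp_assoc,
      ← comp_whiskerRight, hu.1]
    simp

theorem eq_smul (hX : IsSimpleObj X) (h : IsConjugateSolution X Xb R Rb) (f : Xb ⊗ X ⟶ 𝟙_ C) :
    ∃ c : ℂ, f = c • dag R := by
  let _ := h.exactPairing
  let T := tensorLeftHomEquiv X X Xb (𝟙_ C)
  have hT : ∀ g, T g = (λ_ _).inv ≫ Rb ▷ X ≫ (α_ _ _ _).hom ≫ X ◁ g := fun g => rfl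
  obtain ⟨c, hc⟩ := hX.exists_smul (T f ≫ (ρ_ X).hom)
  refine ⟨c, T.injective ?_⟩
  rw [← cancel_mono (ρ_ X).hom, hc, hT, MonoidalLinear.whiskerLeft_smul]
  simp only [Linear.comp_smul, Linear.smul_comp, Category.assoc]
  rw [h.right]

theorem id_ne_zero (hX : IsSimpleObj X) (h : IsConjugateSolution X Xb R Rb) : 𝟙 Xb ≠ 0 := by
  intro h0
  apply hX.id_ne_zero
  have h1 : Rb = 0 := by
    rw [← Category.comp_id Rb, ← MonoidalCategory.whiskerLeft_id, h0]
    simp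
  rw [← h.right, h1]
  simp

theorem dual_simple (hX : IsSimpleObj X) (h : IsConjugateSolution X Xb R Rb) :
    IsSimpleObj Xb := by
  refine (finrank_eq_one_iff_of_nonzero' (𝟙 Xb) (h.id_ne_zero hX)).2 fun g => ?_
  obtain ⟨c, hc⟩ := h.eq_smul hX (g ▷ X ≫ dag R)
  refine ⟨c, ?_⟩
  have h1 : Xb ◁ Rb ≫ (α_ Xb X Xb).inv ≫ dag R ▷ Xb = (ρ_ Xb).hom ≫ (λ_ Xb).inv :=
    h.exactPairing.coevaluation_evaluation'
  have h2 : (ρ_ Xb).inv ≫ Xb ◁ Rb ≫ (α_ Xb X Xb).inv ≫ (g ▷ X ≫ dag R) ▷ Xb =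
      g ≫ (λ_ Xb).inv := by
    rw [comp_whiskerRight, ← associator_inv_naturality_left_assoc, whisker_exchange_assoc,
      h1]
    simp
  rw [hc, MonoidalLinear.smul_whiskerRight] at h2
  simp only [Linear.comp_smul] at h2
  rw [h1] at h2
  rw [← cancel_mono (λ_ Xb).inv, ← h2]
  simp

theorem norm_mul_norm_eq_aux (hX : IsSimpleObj X) (h : IsConjugateSolution X Xb R Rb)
    {S : 𝟙_ C ⟶ Xb ⊗ X} {Sb : 𝟙_ C ⟶ X ⊗ Xb} (h' : IsConjugateSolution X Xb S Sb) :
    homNorm S * homNorm Sb = homNorm R * homNorm Rb := by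
  obtain ⟨a, ha⟩ := h.eq_smul hX (dag S)
  obtain ⟨b, hb⟩ := h.symm.eq_smul (h.dual_simple hX) (dag Sb)
  have ha' : S = star a • R := by rw [← dag_dag S, ha, dag_smul, dag_dag]
  have hb' : Sb = star b • Rb := by rw [← dag_dag Sb, hb, dag_smul, dag_dag]
  have h1 := h'.right
  rw [ha, hb', MonoidalLinear.whiskerLeft_smul, MonoidalLinear.smul_whiskerRight] at h1
  simp only [Linear.comp_smul, Linear.smul_comp, h.right] at h1
  have h2 : a * star b = 1 := by
    refine smul_left_injective ℂ hX.id_ne_zero ?_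
    simp only [mul_smul, one_smul]
    exact h1
  have h3 : ‖a‖ * ‖b‖ = 1 := by
    have := congrArg norm h2
    simpa using this
  rw [ha', hb', homNorm_smul, homNorm_smul, norm_star, norm_star, mul_mul_mul_comm, h3, one_mul]

theorem norm_mul_norm_eq (hX : IsSimpleObj X) (h : IsConjugateSolution X Xb R Rb) {Yb : C}
    {S : 𝟙_ C ⟶ Yb ⊗ X} {Sb : 𝟙_ C ⟶ X ⊗ Yb} (h' : IsConjugateSolution X Yb S Sb) :
    homNorm S * homNorm Sb = homNorm R * homNorm Rb := by
  have hXb := h.dual_simple hX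
  let e : Xb ≅ Yb := rightDualIso h.exactPairing h'.exactPairing
  have he : e.hom ≠ 0 := by
    intro h0
    apply hXb.id_ne_zero
    rw [← e.hom_inv_id, h0, Limits.zero_comp]
  obtain ⟨c, -, hu⟩ := exists_unitary_of_ne_zero hXb (h'.dual_simple hX) e.hom he
  set u := c • e.hom
  have ht := h.transport u hu
  rw [← homNorm_comp_isometry R (u ▷ X) (by
      rw [dag_whiskerRight, ← comp_whiskerRight, hu.1, id_whiskerRight]),
    ← homNorm_comp_isometry Rb (X ◁ u) (by
      rw [dag_whiskerLeft, ← MonoidalCategory.whiskerLeft_comp, hu.1,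
        MonoidalCategory.whiskerLeft_id])]
  exact ht.norm_mul_norm_eq_aux hX h'
end IsConjugateSolution

/-- The statistical dimension `d(X) = inf ‖R‖ ‖Rb‖` over all solutions of the conjugate equations. -/
def statDim (X : C) : ℝ :=
  sInf {r | ∃ (Xb : C) (R : 𝟙_ C ⟶ Xb ⊗ X) (Rb : 𝟙_ C ⟶ X ⊗ Xb),
    IsConjugateSolution X Xb R Rb ∧ r = homNorm R * homNorm Rb}

/-- A standard solution of the conjugate equations for `X_k`, with a chosen representative as
conjugate object. -/
structure StandardSolution (k : Irr C) where
  dual : Irr C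
  R : 𝟙_ C ⟶ dual.rep ⊗ k.rep
  Rb : 𝟙_ C ⟶ k.rep ⊗ dual.rep
  conj : IsConjugateSolution k.rep dual.rep R Rb
  norm_R : homNorm R = √(statDim k.rep)
  norm_Rb : homNorm Rb = √(statDim k.rep)

theorem nonempty_standardSolution (k : Irr C) : Nonempty (StandardSolution k) := by
  have hk := k.rep_simple
  obtain ⟨Xb, R₀, Rb₀, h₀⟩ := exists_conjugate k.rep
  obtain ⟨u, hu⟩ := Irr.exists_unitary_rep Xb (h₀.dual_simple hk)
  have h := h₀.transport (dag u) hu.dag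
  set R := R₀ ≫ dag u ▷ k.rep
  set Rb := Rb₀ ≫ k.rep ◁ dag u
  have hd : statDim k.rep = homNorm R * homNorm Rb := by
    rw [statDim, ← csInf_singleton (homNorm R * homNorm Rb)]
    congr 1
    refine Set.ext fun r => ⟨?_, ?_⟩
    · rintro ⟨Yb, S, Sb, hS, rfl⟩
      exact h.norm_mul_norm_eq hk hS
    · rintro rfl
      exact ⟨_, R, Rb, h, rfl⟩
  have hR : 0 < homNorm R := by
    refine (homNorm_nonneg R).lt_of_ne' fun h0 => hk.id_ne_zero ?_
    rw [← h.right, eq_zero_of_homNorm R h0, dag_zero]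
    simp
  have hRb : 0 < homNorm Rb := by
    refine (homNorm_nonneg Rb).lt_of_ne' fun h0 => hk.id_ne_zero ?_
    rw [← h.right, eq_zero_of_homNorm Rb h0]
    simp
  let c : ℝ := √(homNorm Rb / homNorm R)
  have hc : 0 < c := Real.sqrt_pos.2 (div_pos hRb hR)
  have hc2 : c ^ 2 = homNorm Rb / homNorm R := Real.sq_sqrt (div_pos hRb hR).le
  have hcc : (c : ℂ) ≠ 0 := by exact_mod_cast hc.ne'
  refine ⟨⟨_, (c : ℂ) • R, (c : ℂ)⁻¹ • Rb, ⟨?_, ?_⟩, ?_, ?_⟩⟩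
  · rw [dag_smul, MonoidalLinear.whiskerLeft_smul, MonoidalLinear.smul_whiskerRight]
    simp only [Linear.comp_smul, Linear.smul_comp, h.left, smul_smul]
    simp [hcc]
  · rw [dag_smul, MonoidalLinear.whiskerLeft_smul, MonoidalLinear.smul_whiskerRight]
    simp only [Linear.comp_smul, Linear.smul_comp, h.right, smul_smul]
    simp [hcc]
  · rw [homNorm_smul, eq_comm, Real.sqrt_eq_iff_mul_self_eq (by rw [hd]; positivity)
      (by positivity), hd]
    simp only [Complex.norm_real, Real.norm_eq_abs, abs_of_pos hc]
    rw [mul_mul_mul_comm, ← sq, hc2]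
    field_simp
  · rw [homNorm_smul, eq_comm, Real.sqrt_eq_iff_mul_self_eq (by rw [hd]; positivity)
      (by positivity), hd]
    simp only [norm_inv, Complex.norm_real, Real.norm_eq_abs, abs_of_pos hc]
    rw [mul_mul_mul_comm, ← sq, inv_pow, hc2]
    field_simp


/-- The chosen standard solution for `X_k`. -/
def stdSol (k : Irr C) : StandardSolution k := Classical.choice (nonempty_standardSolution k)

/-- The class `k̄` of the conjugate of `X_k`. -/
def Irr.dual (k : Irr C) : Irr C := (stdSol k).dual

/-- The multiplicity `N_{ij}^k` of `X_k` in `X_i ⊗ X_j`. -/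
def fusionMult (i j k : Irr C) : ℕ := Module.finrank ℂ (k.rep ⟶ i.rep ⊗ j.rep)

theorem fusionMult_support_finite (i j : Irr C) :
    (Function.support fun k => (fusionMult i j k : ℂ)).Finite := by
  let d := decomposition (i.rep ⊗ j.rep)
  refine (Set.finite_range d.idx).subset fun k hk => ?_
  by_contra hkd
  apply hk
  have h0 : ∀ f : k.rep ⟶ i.rep ⊗ j.rep, f = 0 := fun f => by
    rw [← Category.comp_id f, ← d.complete, Preadditive.comp_sum]
    refine Finset.sum_eq_zero fun a _ => ?_
    have h1 : f ≫ dag (d.emb a) = 0 := by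
      by_contra hne
      exact hkd ⟨a, (Irr.eq_of_ne_zero _ hne).symm⟩
    rw [← Category.assoc, h1, Limits.zero_comp]
  have : Subsingleton (k.rep ⟶ i.rep ⊗ j.rep) := ⟨fun f g => (h0 f).trans (h0 g).symm⟩
  have h2 : fusionMult i j k = 0 := Module.finrank_zero_of_subsingleton
  simp [h2]

variable (C) in
/-- The fusion algebra `ℂ[Irr(C)]`. -/
def FusionAlgebra : Type u := Irr C →₀ ℂ

instance : AddCommGroup (FusionAlgebra C) := inferInstanceAs (AddCommGroup (Irr C →₀ ℂ))
instance : Module ℂ (FusionAlgebra C) := inferInstanceAs (Module ℂ (Irr C →₀ ℂ))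

/-- The basis element `[X_k]`. -/
def FusionAlgebra.basis (k : Irr C) : FusionAlgebra C := Finsupp.single k (1 : ℂ)

/-- The product `[X_i][X_j] = ∑ k, N_{ij}^k [X_k]`. -/
def FusionAlgebra.basisMul (i j : Irr C) : FusionAlgebra C :=
  Finsupp.ofSupportFinite (fun k => (fusionMult i j k : ℂ)) (fusionMult_support_finite i j)

/-- The unit of the fusion algebra is the class of the unit object. -/
instance : One (FusionAlgebra C) := ⟨FusionAlgebra.basis (Irr.unit C)⟩

/-- The bilinear extension of the fusion rules. -/
instance : Mul (FusionAlgebra C) :=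
  ⟨fun x y => Finsupp.sum x fun i a => Finsupp.sum y fun j b =>
    (a * b) • FusionAlgebra.basisMul i j⟩

/-- The conjugate-linear extension of `[X] ↦ [X̄]`. -/
instance : Star (FusionAlgebra C) :=
  ⟨fun x => Finsupp.sum x fun i a => star a • FusionAlgebra.basis i.dual⟩

/-- The space `A^k_{i,j} = Mor(X_k ⊗ X_i, X_j ⊗ X_k)`. -/
abbrev TubeHom (i j k : Irr C) : Type v := k.rep ⊗ i.rep ⟶ j.rep ⊗ k.rep

variable (C) in
/-- The tube algebra: the algebraic direct sum of the `A^k_{i,j}` over all `(i, j, k)`. -/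
def TubeAlgebra : Type (max u v) :=
  DirectSum (Irr C × Irr C × Irr C) fun t => TubeHom t.1 t.2.1 t.2.2

instance : AddCommGroup (TubeAlgebra C) :=
  inferInstanceAs (AddCommGroup (DirectSum (Irr C × Irr C × Irr C) fun t =>
    TubeHom t.1 t.2.1 t.2.2))
instance : Module ℂ (TubeAlgebra C) :=
  inferInstanceAs (Module ℂ (DirectSum (Irr C × Irr C × Irr C) fun t =>
    TubeHom t.1 t.2.1 t.2.2))

namespace TubeAlgebra

open Classical in
/-- The inclusion of `A^k_{i,j}`. -/
def of (i j k : Irr C) : TubeHom i j k →ₗ[ℂ] TubeAlgebra C :=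
  DirectSum.lof ℂ (Irr C × Irr C × Irr C) (fun t => TubeHom t.1 t.2.1 t.2.2) (i, j, k)

/-- `(1_j ⊗ V*)(x ⊗ 1_l)(1_m ⊗ y)(V ⊗ 1_i)`. -/
def comp {i s j k l m : Irr C} (V : k.rep ⟶ m.rep ⊗ l.rep) (x : TubeHom s j m)
    (y : TubeHom i s l) : TubeHom i j k :=
  V ▷ i.rep ≫ (α_ _ _ _).hom ≫ m.rep ◁ y ≫ (α_ _ _ _).inv ≫ x ▷ l.rep ≫ (α_ _ _ _).hom ≫
    j.rep ◁ dag V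

/-- The product of `x ∈ A^m_{s,j}` and `y ∈ A^l_{i,s}`: the sum over all `k` and over an orthonormal
basis of `Mor(X_k, X_m ⊗ X_l)`. -/
def mulHom {i s j l m : Irr C} : TubeHom s j m →ₗ[ℂ] TubeHom i s l →ₗ[ℂ] TubeAlgebra C :=
  LinearMap.mk₂ ℂ
    (fun x y => ∑ a : (decomposition (m.rep ⊗ l.rep)).ι,
      of i j ((decomposition (m.rep ⊗ l.rep)).idx a)
        (comp ((decomposition (m.rep ⊗ l.rep)).emb a) x y))
    (fun x x' y => by simp [comp, ← Finset.sum_add_distrib])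
    (fun c x y => by simp [comp, Finset.smul_sum])
    (fun x y y' => by simp [comp, ← Finset.sum_add_distrib])
    (fun c x y => by simp [comp, Finset.smul_sum])

open Classical in
/-- The product of `x ∈ A^m_{s,j}` and `y ∈ A^l_{i,s'}`, which is zero unless `s' = s`. -/
def mulHom' (i s' s j l m : Irr C) : TubeHom s j m →ₗ[ℂ] TubeHom i s' l →ₗ[ℂ] TubeAlgebra C :=
  if h : s' = s then h ▸ mulHom else 0

open Classical in
/-- The product of the tube algebra. -/
def mulLin : TubeAlgebra C →ₗ[ℂ] TubeAlgebra C →ₗ[ℂ] TubeAlgebra C :=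
  DirectSum.toModule ℂ _ _ fun t =>
    (DirectSum.toModule ℂ _ _ fun t' =>
      (mulHom' t'.1 t'.2.1 t.1 t.2.1 t'.2.2 t.2.2).flip).flip

instance : Mul (TubeAlgebra C) := ⟨fun x y => mulLin x y⟩

/-- For `x ∈ Mor(X ⊗ A, B ⊗ X)` and a solution `(R, Rb)` of the conjugate equations for `X`, the
morphism `(R* ⊗ 1 ⊗ 1)(1 ⊗ x* ⊗ 1)(1 ⊗ 1 ⊗ Rb) ∈ Mor(Xb ⊗ B, A ⊗ Xb)`. -/
def rotate {A B X Xb : C} (R : 𝟙_ C ⟶ Xb ⊗ X) (Rb : 𝟙_ C ⟶ X ⊗ Xb) (x : X ⊗ A ⟶ B ⊗ X) :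
    Xb ⊗ B ⟶ A ⊗ Xb :=
  (ρ_ (Xb ⊗ B)).inv ≫ (Xb ⊗ B) ◁ Rb ≫ (α_ Xb B (X ⊗ Xb)).hom ≫
    Xb ◁ ((α_ B X Xb).inv ≫ dag x ▷ Xb ≫ (α_ X A Xb).hom) ≫
    (α_ Xb X (A ⊗ Xb)).inv ≫ dag R ▷ (A ⊗ Xb) ≫ (λ_ (A ⊗ Xb)).hom

/-- The involution on the summand `A^k_{i,j}`, with values in `A^{k̄}_{j,i}`. The standard solution
used for `X_{k̄}` is `(Rb_k, R_k)`; the result does not depend on the standard solution, since any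
two differ by a phase that cancels. -/
def starHom (i j k : Irr C) : TubeHom i j k →+ TubeAlgebra C where
  toFun x := of j i k.dual (rotate (stdSol k).R (stdSol k).Rb x)
  map_zero' := by simp [rotate, dag_zero]
  map_add' x y := by
    rw [← map_add]
    congr 1
    simp only [rotate, dag_add, MonoidalPreadditive.add_whiskerRight, Preadditive.comp_add,
      Preadditive.add_comp, MonoidalPreadditive.whiskerLeft_add]

open Classical in
/-- The involution of the tube algebra. -/
instance : Star (TubeAlgebra C) :=
  ⟨DirectSum.toAddMonoid fun t => starHom t.1 t.2.1 t.2.2⟩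

/-- `X_0 = id`. -/
def unitIso : (Irr.unit C).rep ≅ 𝟙_ C := eqToIso Irr.rep_unit

/-- The projection `p_m = 1_m ∈ Mor(id ⊗ X_m, X_m ⊗ id)`. -/
def proj (m : Irr C) : TubeAlgebra C :=
  of m m (Irr.unit C)
    (unitIso.hom ▷ m.rep ≫ (λ_ m.rep).hom ≫ (ρ_ m.rep).inv ≫ m.rep ◁ unitIso.inv)

/-- The map from the fusion algebra onto the corner `p_0 A p_0` with
`[X_k] ↦ 1_k ∈ Mor(X_k ⊗ id, id ⊗ X_k)`. -/
def corner : FusionAlgebra C →ₗ[ℂ] TubeAlgebra C :=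
  Finsupp.lsum ℂ fun k => LinearMap.toSpanSingleton ℂ (TubeAlgebra C)
    (of (Irr.unit C) (Irr.unit C) k
      (k.rep ◁ unitIso.hom ≫ (ρ_ k.rep).hom ≫ (λ_ k.rep).inv ≫ unitIso.inv ▷ k.rep))

end TubeAlgebra

variable (C) in
/-- A non-degenerate `*`-representation of the tube algebra on a Hilbert space. -/
structure TubeRep (H : Type) [NormedAddCommGroup H] [InnerProductSpace ℂ H] [CompleteSpace H] where
  toLin : TubeAlgebra C →ₗ[ℂ] (H →L[ℂ] H)
  map_mul : ∀ x y, toLin (x * y) = toLin x * toLin y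
  map_star : ∀ x, toLin (star x) = star (toLin x)
  nondegenerate : (Submodule.span ℂ {η : H | ∃ x ξ, η = toLin x ξ}).topologicalClosure = ⊤

variable (C) in
/-- An admissible representation: a `*`-representation of the fusion algebra on a nonzero Hilbert
space `H` that is unitarily equivalent, through `U`, to the restriction to the corner `p_0 A p_0`
(acting on the range of `p_0`) of a non-degenerate `*`-representation of the tube algebra.
Hilbert spaces in `Type` suffice, as the tube algebra has countable dimension, so that all its
cyclic representations are separable. -/
structure AdmissibleRep where
  H : Type
  [normedAddCommGroup : NormedAddCommGroup H]
  [innerProductSpace : InnerProductSpace ℂ H]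
  [completeSpace : CompleteSpace H]
  [nontrivial : Nontrivial H]
  toLin : FusionAlgebra C →ₗ[ℂ] (H →L[ℂ] H)
  map_one : toLin 1 = 1
  map_mul : ∀ f g, toLin (f * g) = toLin f * toLin g
  map_star : ∀ f, toLin (star f) = star (toLin f)
  admissible : ∃ (K : Type) (_ : NormedAddCommGroup K) (_ : InnerProductSpace ℂ K)
    (_ : CompleteSpace K) (π : TubeRep C K) (U : H →ₗᵢ[ℂ] K),
    Set.range U = Set.range (π.toLin (TubeAlgebra.proj (Irr.unit C))) ∧
    ∀ f ξ, π.toLin (TubeAlgebra.corner f) (U ξ) = U (toLin f ξ)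

attribute [instance] AdmissibleRep.normedAddCommGroup AdmissibleRep.innerProductSpace
  AdmissibleRep.completeSpace AdmissibleRep.nontrivial

variable (C) in
/-- The bounded families of operators on the spaces of all admissible representations. -/
abbrev AdmissibleProduct := lp (fun π : AdmissibleRep C => π.H →L[ℂ] π.H) ⊤

instance : CStarAlgebra (AdmissibleProduct C) where

variable (C) in
/-- The norm closure of the image of the fusion algebra under the universal admissible
representation `f ↦ (π(f))_π`. -/
def universalSubalgebra : StarSubalgebra ℂ (AdmissibleProduct C) :=
  (StarAlgebra.adjoin ℂ {a : AdmissibleProduct C |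
    ∃ f : FusionAlgebra C, ∀ π, a π = π.toLin f}).topologicalClosure

variable (C) in
/-- The universal C*-algebra `C*(C)` of the fusion algebra. -/
def UniversalCStar : Type (max 1 u) := universalSubalgebra C

instance : CStarAlgebra (UniversalCStar C) :=
  haveI : IsClosed (universalSubalgebra C : Set (AdmissibleProduct C)) :=
    StarSubalgebra.isClosed_topologicalClosure _
  inferInstanceAs (CStarAlgebra (universalSubalgebra C))

/-- The component of an element of `C*(C)` at an admissible representation. -/
def UniversalCStar.apply (a : UniversalCStar C) (π : AdmissibleRep C) : π.H →L[ℂ] π.H := a.1 π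

/-- Annular states: vector states in admissible representations. -/
def IsAnnularState (Φ : FusionAlgebra C →ₗ[ℂ] ℂ) : Prop :=
  ∃ (π : AdmissibleRep C) (ξ : π.H), ‖ξ‖ = 1 ∧ ∀ f, Φ f = inner ℂ ξ (π.toLin f ξ)

/-- The functional `∑ k, c_k [X_k] ↦ ∑ k, c_k d(X_k) φ(k)`. -/
def multiplierFunctional (φ : Irr C → ℂ) : FusionAlgebra C →ₗ[ℂ] ℂ :=
  Finsupp.lsum ℂ fun k => LinearMap.toSpanSingleton ℂ ℂ (statDim k.rep * φ k)

/-- `φ ∈ ℓ^∞(Irr(C))` is a cp-multiplier. -/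
def IsCPMultiplier (φ : lp (fun _ : Irr C => ℂ) ⊤) : Prop :=
  IsAnnularState (multiplierFunctional φ)

open Filter in
variable (C) in
/-- Property (T): every sequence of cp-multipliers that converges to `1` pointwise converges to `1`
uniformly on `Irr(C)`. -/
def PropertyT : Prop :=
  ∀ φ : ℕ → lp (fun _ : Irr C => ℂ) ⊤, (∀ n, IsCPMultiplier (φ n)) →
    (∀ k, Tendsto (fun n => φ n k) atTop (nhds 1)) →
    TendstoUniformly (fun n k => φ n k) (fun _ => 1) atTop

end
end
end RigidCStar

open RigidCStar

/-! ### Calculus in the tube algebra: rotation, non-simple carriers, products -/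

namespace RigidCStar
noncomputable section

open CStarCategory RigidCStarTensorCategory

variable {C : Type u} [Category.{v} C] [Preadditive C] [Linear ℂ C]
    [MonoidalCategory C] [MonoidalPreadditive C] [MonoidalLinear ℂ C]
    [RigidCStarTensorCategory C]

/-! An admissible representation is cut out of a representation of the whole tube algebra, and this
forces `‖π([X_k])‖ ≤ d(X_k)`. Let `v` be `R̄_k`, viewed in degree `0`, and `w` be `1 ⊗ R_k`, viewed
in degree `k`, both with components `v_a`, `w_a` along a decomposition of `X_k ⊗ X̄_k`. The
conjugate equations give `∑ v_a^# w_a = [X_k]`, and closed loops give `∑ v_a^# v_a = ∑ w_a^# w_a =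
d(X_k) p_0`. Cauchy-Schwarz then yields the bound (`AdmissibleRep.norm_basis_le`). So the universal
representation exists, its closure is commutative, and Gelfand duality provides `Z`.

For the point `1_C` one needs the character `[X_k] ↦ d(X_k)` to be admissible, so it must extend to
a `*`-character of the tube algebra. The extension `TubeAlgebra.counit` restricts the strands `X_i`,
`X_j` to the unit and weights the remaining scalar by `d(X_k)`. Its multiplicativity rests on
`sum_trace_tensor`: the trace on `X_m ⊗ X_l` is the dimension-weighted sum of the traces over the
simple components. That in turn follows from `IsConjugateSolution.trace_dag_comp`, where equality of
left and right traces is shown to determine the trace. Characters of `C(Z)` are point evaluations,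
so this character is one point of `Z`.

If that point is isolated, its indicator function is a projection `P` in `C*(C)` onto the vectors
where every `[X_k]` acts by `d(X_k)`. Vector states tending to the trivial character satisfy `‖ξ_n -
P ξ_n‖ → 0`, and `|φ_n(k) - 1| ≤ 2 ‖ξ_n - P ξ_n‖` for all `k` at once.

If it is not isolated, functions supported near it but away from it give almost invariant unit
vectors whose cyclic spaces are annihilated by some `a` of trivial character `1`. Their multipliers
tend to `1` pointwise. Uniform convergence would put a nonzero invariant vector in the closed convex
hull of an orbit `[X_k] ξ / d(X_k)`, by a least-norm argument; there `a` acts both as `1` and as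
`0`. -/

theorem dag_associator_inv (X Y Z : C) : dag (α_ X Y Z).inv = (α_ X Y Z).hom := by
  rw [← dag_associator, dag_dag]

theorem dag_leftUnitor_inv (X : C) : dag (λ_ X).inv = (λ_ X).hom := by
  rw [← dag_leftUnitor, dag_dag]

theorem dag_rightUnitor_inv (X : C) : dag (ρ_ X).inv = (ρ_ X).hom := by
  rw [← dag_rightUnitor, dag_dag]

theorem dag_eqToHom {X Y : C} (h : X = Y) : dag (eqToHom h) = eqToHom h.symm := by
  subst h
  simp [dag_id]

namespace IsConjugateSolution
variable {X Xb : C} {R : 𝟙_ C ⟶ Xb ⊗ X} {Rb : 𝟙_ C ⟶ X ⊗ Xb}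

theorem snake_R_dag (h : IsConjugateSolution X Xb R Rb) :
    R ▷ Xb ⊗≫ Xb ◁ dag Rb = ⊗𝟙.hom := by
  have := congrArg (fun f => (λ_ Xb).hom ≫ f ≫ (ρ_ Xb).inv) h.left
  simp only [Category.assoc, Iso.hom_inv_id, Category.comp_id, Iso.hom_inv_id_assoc,
    Category.id_comp] at this
  simpa [monoidalComp] using this

theorem snake_Rb_dag (h : IsConjugateSolution X Xb R Rb) :
    Rb ▷ X ⊗≫ X ◁ dag R = ⊗𝟙.hom := h.symm.snake_R_dag

theorem snake_Rb (h : IsConjugateSolution X Xb R Rb) :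
    Xb ◁ Rb ⊗≫ dag R ▷ Xb = ⊗𝟙.hom := by
  have : Xb ◁ Rb ≫ (α_ _ _ _).inv ≫ dag R ▷ Xb = (ρ_ _).hom ≫ (λ_ _).inv :=
    h.exactPairing.coevaluation_evaluation'
  simpa [monoidalComp] using this

theorem snake_R (h : IsConjugateSolution X Xb R Rb) :
    X ◁ R ⊗≫ dag Rb ▷ X = ⊗𝟙.hom := h.symm.snake_Rb

end IsConjugateSolution

/-- The morphism `R_k` of the chosen standard solution, with values in `X_{k̄} ⊗ X_k`. -/
def Irr.solR (k : Irr C) : 𝟙_ C ⟶ k.dual.rep ⊗ k.rep := (stdSol k).R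

/-- The morphism `R̄_k` of the chosen standard solution, with values in `X_k ⊗ X_{k̄}`. -/
def Irr.solRb (k : Irr C) : 𝟙_ C ⟶ k.rep ⊗ k.dual.rep := (stdSol k).Rb

theorem Irr.sol_conj (k : Irr C) : IsConjugateSolution k.rep k.dual.rep k.solR k.solRb :=
  (stdSol k).conj

theorem Irr.homNorm_solR (k : Irr C) : homNorm k.solR = √(statDim k.rep) := (stdSol k).norm_R

theorem Irr.homNorm_solRb (k : Irr C) : homNorm k.solRb = √(statDim k.rep) := (stdSol k).norm_Rb

namespace TubeAlgebra

/-- The adjoints `f*` and `g*` sit on strands disjoint from the cup and the cap, so the interchange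
law slides them past. Rotation is therefore natural, with reversed variance, in both side strands.
-/
theorem rotate_comp {X Xb A A' B B' : C} (R : 𝟙_ C ⟶ Xb ⊗ X) (Rb : 𝟙_ C ⟶ X ⊗ Xb)
    (f : A' ⟶ A) (x : X ⊗ A ⟶ B ⊗ X) (g : B ⟶ B') :
    rotate R Rb (X ◁ f ≫ x ≫ g ▷ X) = Xb ◁ dag g ≫ rotate R Rb x ≫ dag f ▷ Xb := by
  simp only [rotate, dag_comp, dag_whiskerLeft, dag_whiskerRight]
  calc _ = 𝟙 _ ⊗≫ ((Xb ⊗ B') ◁ Rb ≫ (Xb ◁ dag g) ▷ (X ⊗ Xb)) ⊗≫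
          Xb ◁ dag x ▷ Xb ⊗≫ (((Xb ⊗ X) ◁ (dag f ▷ Xb)) ≫ dag R ▷ (A' ⊗ Xb)) ⊗≫ 𝟙 _ := by
        monoidal
    _ = 𝟙 _ ⊗≫ ((Xb ◁ dag g) ▷ (𝟙_ C) ≫ (Xb ⊗ B) ◁ Rb) ⊗≫
          Xb ◁ dag x ▷ Xb ⊗≫ (dag R ▷ (A ⊗ Xb) ≫ (𝟙_ C) ◁ (dag f ▷ Xb)) ⊗≫ 𝟙 _ := by
        rw [whisker_exchange, whisker_exchange]
    _ = _ := by monoidal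

theorem rotate_unitors {X Xb : C} {R : 𝟙_ C ⟶ Xb ⊗ X} {Rb : 𝟙_ C ⟶ X ⊗ Xb}
    (h : IsConjugateSolution X Xb R Rb) :
    rotate R Rb ((ρ_ X).hom ≫ (λ_ X).inv) = (ρ_ Xb).hom ≫ (λ_ Xb).inv := by
  simp only [rotate, dag_comp, dag_leftUnitor_inv, dag_rightUnitor]
  calc _ = 𝟙 _ ⊗≫ (Xb ◁ Rb ⊗≫ dag R ▷ Xb) ⊗≫ 𝟙 _ := by monoidal
    _ = _ := by rw [h.snake_Rb]; monoidal

/-- The morphism `1_k ⊗ R` of the tube algebra with values in `X ⊗ X̄`. -/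
theorem rotate_whiskerLeft_R {X Xb : C} {R : 𝟙_ C ⟶ Xb ⊗ X} {Rb : 𝟙_ C ⟶ X ⊗ Xb}
    (h : IsConjugateSolution X Xb R Rb) :
    rotate R Rb (X ◁ R ≫ (α_ X Xb X).inv) = (α_ Xb X Xb).inv ≫ dag R ▷ Xb := by
  simp only [rotate, dag_comp, dag_associator_inv, dag_whiskerLeft]
  calc _ = 𝟙 _ ⊗≫ (Xb ⊗ X) ◁ (Xb ◁ Rb ⊗≫ dag R ▷ Xb) ⊗≫ dag R ▷ Xb ⊗≫ 𝟙 _ := by monoidal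
    _ = _ := by rw [h.snake_Rb]; monoidal

/-- By Schur's lemma a nonzero `c` forces `k = l` and is a scalar, which moves freely. This is the
simple case of the trace property of the tube. -/
theorem of_comp_swap {i j k l : Irr C} (c : k.rep ⟶ l.rep)
    (S : l.rep ⊗ i.rep ⟶ j.rep ⊗ k.rep) :
    of i j k (c ▷ i.rep ≫ S) = of i j l (S ≫ j.rep ◁ c) := by
  by_cases hc : c = 0
  · simp [hc]
  · obtain rfl := Irr.eq_of_ne_zero c hc
    obtain ⟨z, rfl⟩ := k.rep_simple.exists_smul c
    simp

/-- The element of the tube algebra defined by `T ∈ Mor(W ⊗ X_i, X_j ⊗ W)` for a not necessarily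
simple object `W`. -/
def ofObj (i j : Irr C) (W : C) : (W ⊗ i.rep ⟶ j.rep ⊗ W) →ₗ[ℂ] TubeAlgebra C where
  toFun T := ∑ a, of i j ((decomposition W).idx a)
    ((decomposition W).emb a ▷ i.rep ≫ T ≫ j.rep ◁ dag ((decomposition W).emb a))
  map_add' T T' := by simp [Finset.sum_add_distrib]
  map_smul' c T := by simp [Finset.smul_sum]

/-- A morphism of the carrier may be moved once around the tube: expanding `f` in both
decompositions reduces this to simple carriers. It makes `ofObj` invariant under isomorphisms of the
carrier and later closes `R*` and `R` into the loop `R* R`. -/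
theorem ofObj_swap {i j : Irr C} {W W' : C} (f : W ⟶ W') (T : W' ⊗ i.rep ⟶ j.rep ⊗ W) :
    ofObj i j W (f ▷ i.rep ≫ T) = ofObj i j W' (T ≫ j.rep ◁ f) := by
  let d := decomposition W
  let d' := decomposition W'
  have h1 : ∀ a, d.emb a ▷ i.rep ≫ (f ▷ i.rep ≫ T) ≫ j.rep ◁ dag (d.emb a) =
      ∑ b, (d.emb a ≫ f ≫ dag (d'.emb b)) ▷ i.rep ≫
        (d'.emb b ▷ i.rep ≫ T ≫ j.rep ◁ dag (d.emb a)) := by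
    intro a
    simp only [comp_whiskerRight, Category.assoc]
    rw [← Preadditive.comp_sum, ← Preadditive.comp_sum]
    congr 2
    simp only [← Category.assoc]
    simp only [← Preadditive.sum_comp, ← comp_whiskerRight, ← sum_whiskerRight, d'.complete]
    simp
  have h2 : ∀ b, d'.emb b ▷ i.rep ≫ (T ≫ j.rep ◁ f) ≫ j.rep ◁ dag (d'.emb b) =
      ∑ a, (d'.emb b ▷ i.rep ≫ T ≫ j.rep ◁ dag (d.emb a)) ≫
        j.rep ◁ (d.emb a ≫ f ≫ dag (d'.emb b)) := by
    intro b
    simp only [MonoidalCategory.whiskerLeft_comp, Category.assoc]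
    rw [← Preadditive.comp_sum, ← Preadditive.comp_sum]
    congr 2
    simp only [← MonoidalCategory.whiskerLeft_comp, ← Category.assoc]
    simp only [← Preadditive.sum_comp, ← whiskerLeft_sum, d.complete]
    simp
  change ∑ a, of i j (d.idx a) (d.emb a ▷ i.rep ≫ (f ▷ i.rep ≫ T) ≫ j.rep ◁ dag (d.emb a)) =
    ∑ b, of i j (d'.idx b) (d'.emb b ▷ i.rep ≫ (T ≫ j.rep ◁ f) ≫ j.rep ◁ dag (d'.emb b))
  simp only [h1, h2, map_sum, of_comp_swap]
  exact Finset.sum_comm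

theorem ofObj_rep {i j k : Irr C} (T : TubeHom i j k) : ofObj i j k.rep T = of i j k T := by
  let d := decomposition k.rep
  change ∑ a, of i j (d.idx a) (d.emb a ▷ i.rep ≫ T ≫ j.rep ◁ dag (d.emb a)) = _
  simp only [of_comp_swap, ← map_sum, Category.assoc, ← MonoidalCategory.whiskerLeft_comp,
    ← Preadditive.comp_sum, ← whiskerLeft_sum, d.complete]
  simp

/-- The product stacks two tubes over the carrier `X_m ⊗ X_l`; the sum over orthonormal bases in its
definition is the one hidden in `ofObj`. Products can thus be computed without bases. -/
theorem mulHom_eq {i s j l m : Irr C} (x : TubeHom s j m) (y : TubeHom i s l) :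
    mulHom x y = ofObj i j (m.rep ⊗ l.rep) ((α_ _ _ _).hom ≫ m.rep ◁ y ≫ (α_ _ _ _).inv ≫
      x ▷ l.rep ≫ (α_ _ _ _).hom) := by
  simp [mulHom, ofObj, comp]

open Classical in
/-- The linear map on the tube algebra given by its restrictions to the summands. -/
def lift {M : Type*} [AddCommGroup M] [Module ℂ M]
    (φ : ∀ t : Irr C × Irr C × Irr C, TubeHom t.1 t.2.1 t.2.2 →ₗ[ℂ] M) :
    TubeAlgebra C →ₗ[ℂ] M :=
  DirectSum.toModule ℂ (Irr C × Irr C × Irr C) M φ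

theorem lift_of {M : Type*} [AddCommGroup M] [Module ℂ M]
    (φ : ∀ t : Irr C × Irr C × Irr C, TubeHom t.1 t.2.1 t.2.2 →ₗ[ℂ] M) {i j k : Irr C}
    (x : TubeHom i j k) : lift φ (of i j k x) = φ (i, j, k) x := by
  classical
  exact DirectSum.toModule_lof ℂ (φ := φ) (i, j, k) x

theorem mulLin_eq : mulLin (C := C) = lift fun t => (lift fun t' =>
    (mulHom' t'.1 t'.2.1 t.1 t.2.1 t'.2.2 t.2.2).flip).flip := rfl

theorem of_mul_of' {i s' s j l m : Irr C} (x : TubeHom s j m) (y : TubeHom i s' l) :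
    of s j m x * of i s' l y = mulHom' i s' s j l m x y := by
  change mulLin (of s j m x) (of i s' l y) = _
  rw [mulLin_eq, lift_of, LinearMap.flip_apply, lift_of, LinearMap.flip_apply]

theorem of_mul_of {i s j l m : Irr C} (x : TubeHom s j m) (y : TubeHom i s l) :
    of s j m x * of i s l y = mulHom x y := by
  rw [of_mul_of', mulHom', dif_pos rfl]

theorem of_mul_of_ne {i s' s j l m : Irr C} (h : s' ≠ s) (x : TubeHom s j m)
    (y : TubeHom i s' l) : of s j m x * of i s' l y = 0 := by
  rw [of_mul_of', mulHom', dif_neg h]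
  rfl

theorem star_of {i j k : Irr C} (x : TubeHom i j k) :
    star (of i j k x) = of j i k.dual (rotate k.solR k.solRb x) := by
  classical
  change DirectSum.toAddMonoid (fun t : Irr C × Irr C × Irr C => starHom t.1 t.2.1 t.2.2)
    (DirectSum.of (fun t : Irr C × Irr C × Irr C => TubeHom t.1 t.2.1 t.2.2) (i, j, k) x) = _
  rw [DirectSum.toAddMonoid_of]
  rfl

end TubeAlgebra
end
end RigidCStar
-- Dimensions, and the factorisation of `[X_k]` in the tube algebra
namespace RigidCStar
noncomputable section

open CStarCategory RigidCStarTensorCategory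

variable {C : Type u} [Category.{v} C] [Preadditive C] [Linear ℂ C]
    [MonoidalCategory C] [MonoidalPreadditive C] [MonoidalLinear ℂ C]
    [RigidCStarTensorCategory C]

theorem IsSimpleObj.homNorm_id {X : C} (h : IsSimpleObj X) : homNorm (𝟙 X) = 1 := by
  have h1 := homNorm_star_mul (𝟙 X)
  rw [dag_id, Category.comp_id] at h1
  have h2 : homNorm (𝟙 X) ≠ 0 := fun h0 => h.id_ne_zero (eq_zero_of_homNorm _ h0)
  have h3 : homNorm (𝟙 X) * 1 = homNorm (𝟙 X) * homNorm (𝟙 X) := by rw [mul_one, ← sq, ← h1]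
  exact (mul_left_cancel₀ h2 h3).symm

theorem IsSimpleObj.comp_dag_eq {X Y : C} (h : IsSimpleObj X) (f : X ⟶ Y) :
    f ≫ dag f = ((homNorm f ^ 2 : ℝ) : ℂ) • 𝟙 X := by
  obtain ⟨c, hc⟩ := h.star_mul_pos f
  have h1 : f ≫ dag f = ((‖c‖ ^ 2 : ℝ) : ℂ) • 𝟙 X := by
    rw [hc, dag_smul, dag_id, Linear.smul_comp, Linear.comp_smul, smul_smul, Category.comp_id]
    congr 1
    simpa using Complex.mul_conj' c
  have h2 := congrArg homNorm h1
  rw [homNorm_star_mul, homNorm_smul, h.homNorm_id, mul_one, Complex.norm_real,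
    Real.norm_of_nonneg (sq_nonneg _)] at h2
  rw [h1, h2]

theorem IsConjugateSolution.statDim_eq {X Xb : C} {R : 𝟙_ C ⟶ Xb ⊗ X} {Rb : 𝟙_ C ⟶ X ⊗ Xb}
    (h : IsConjugateSolution X Xb R Rb) (hX : IsSimpleObj X) :
    statDim X = homNorm R * homNorm Rb := by
  rw [statDim, ← csInf_singleton (homNorm R * homNorm Rb)]
  congr 1
  refine Set.ext fun r => ⟨?_, ?_⟩
  · rintro ⟨Yb, S, Sb, hS, rfl⟩
    exact h.norm_mul_norm_eq hX hS
  · rintro rfl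
    exact ⟨_, R, Rb, h, rfl⟩

theorem IsConjugateSolution.R_ne_zero {X Xb : C} {R : 𝟙_ C ⟶ Xb ⊗ X} {Rb : 𝟙_ C ⟶ X ⊗ Xb}
    (h : IsConjugateSolution X Xb R Rb) (hX : 𝟙 X ≠ 0) : R ≠ 0 := by
  rintro rfl
  apply hX
  rw [← h.right, dag_zero]
  simp

theorem statDim_pos (k : Irr C) : 0 < statDim k.rep := by
  have h := k.homNorm_solR
  have h1 : homNorm k.solR ≠ 0 := fun h0 =>
    k.sol_conj.R_ne_zero k.rep_simple.id_ne_zero (eq_zero_of_homNorm _ h0)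
  rw [h] at h1
  exact Real.sqrt_ne_zero'.1 h1

theorem R_comp_dag (k : Irr C) :
    k.solR ≫ dag k.solR = (statDim k.rep : ℂ) • 𝟙 (𝟙_ C) := by
  rw [simple_unit.comp_dag_eq, k.homNorm_solR, Real.sq_sqrt (statDim_pos k).le]

theorem Rb_comp_dag (k : Irr C) :
    k.solRb ≫ dag k.solRb = (statDim k.rep : ℂ) • 𝟙 (𝟙_ C) := by
  rw [simple_unit.comp_dag_eq, k.homNorm_solRb, Real.sq_sqrt (statDim_pos k).le]

/-- Up to unitors, `R_0` is itself a nonzero morphism between `X_0` and its conjugate, so Schur's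
lemma identifies the classes. -/
theorem Irr.dual_unit : (Irr.unit C).dual = Irr.unit C := by
  let J : (Irr.unit C).rep ≅ 𝟙_ C := TubeAlgebra.unitIso
  let R : 𝟙_ C ⟶ (Irr.unit C).dual.rep ⊗ (Irr.unit C).rep := (Irr.unit C).solR
  have hR : R ≠ 0 :=
    (Irr.unit C).sol_conj.R_ne_zero (Irr.unit C).rep_simple.id_ne_zero
  refine (Irr.eq_of_ne_zero (J.hom ≫ R ≫ _ ◁ J.hom ≫ (ρ_ _).hom) fun h => hR ?_).symm
  rw [← cancel_mono ((Irr.unit C).dual.rep ◁ J.hom ≫ (ρ_ _).hom), ← cancel_epi J.hom, h]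
  simp

namespace TubeAlgebra

theorem dag_unitIso_hom : dag (unitIso (C := C)).hom = unitIso.inv := dag_eqToHom Irr.rep_unit

theorem dag_unitIso_inv : dag (unitIso (C := C)).inv = unitIso.hom := dag_eqToHom Irr.rep_unit.symm

/-- The canonical isomorphism `W ⊗ X_0 ≅ X_0 ⊗ W`. -/
def swapUnit (W : C) : W ⊗ (Irr.unit C).rep ⟶ (Irr.unit C).rep ⊗ W :=
  W ◁ unitIso.hom ≫ (ρ_ W).hom ≫ (λ_ W).inv ≫ unitIso.inv ▷ W

theorem swapUnit_naturality {W W' : C} (f : W ⟶ W') :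
    f ▷ (Irr.unit C).rep ≫ swapUnit W' = swapUnit W ≫ (Irr.unit C).rep ◁ f := by
  simp only [swapUnit, Category.assoc]
  rw [← whisker_exchange_assoc, rightUnitor_naturality_assoc, leftUnitor_inv_naturality_assoc,
    whisker_exchange]

theorem ofObj_swapUnit_iso {W W' : C} (e : W ≅ W') :
    ofObj (Irr.unit C) (Irr.unit C) W (swapUnit W) =
      ofObj (Irr.unit C) (Irr.unit C) W' (swapUnit W') := by
  have h : swapUnit W = e.hom ▷ (Irr.unit C).rep ≫ swapUnit W' ≫ (Irr.unit C).rep ◁ e.inv := by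
    rw [← Category.assoc, swapUnit_naturality, Category.assoc,
      ← MonoidalCategory.whiskerLeft_comp]
    simp
  rw [h, ofObj_swap, Category.assoc, ← MonoidalCategory.whiskerLeft_comp]
  simp

theorem corner_basis (k : Irr C) :
    corner (FusionAlgebra.basis k) = of (Irr.unit C) (Irr.unit C) k (swapUnit k.rep) := by
  unfold corner FusionAlgebra.basis
  erw [Finsupp.lsum_single]
  simp [swapUnit]

/-- The components along `Y` are glued back together by the completeness relation of `d`. The sum is
thus the product `x^# y` with the non-simple object `Y` as intermediate strand. -/
theorem sum_star_of_mul_of {i i' m l : Irr C} {Y : C} (d : Decomposition Y)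
    (x : m.rep ⊗ i.rep ⟶ Y ⊗ m.rep) (y : l.rep ⊗ i'.rep ⟶ Y ⊗ l.rep) :
    ∑ a, star (of i (d.idx a) m (x ≫ dag (d.emb a) ▷ m.rep)) *
        of i' (d.idx a) l (y ≫ dag (d.emb a) ▷ l.rep) =
      ofObj i' i (m.dual.rep ⊗ l.rep) ((α_ _ _ _).hom ≫ m.dual.rep ◁ y ≫ (α_ _ _ _).inv ≫
        rotate m.solR m.solRb x ▷ l.rep ≫ (α_ _ _ _).hom) := by
  have h : ∀ a, rotate m.solR m.solRb (x ≫ dag (d.emb a) ▷ m.rep) =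
      m.dual.rep ◁ d.emb a ≫ rotate m.solR m.solRb x := fun a => by
    have := rotate_comp m.solR m.solRb (𝟙 i.rep) x (dag (d.emb a))
    simp only [whiskerLeft_id, Category.id_comp, Category.comp_id, dag_id, id_whiskerRight,
      dag_dag] at this
    exact this
  simp only [star_of, of_mul_of, mulHom_eq, h]
  rw [← map_sum]
  congr 1
  simp only [← Preadditive.comp_sum]
  congr 1
  simp only [MonoidalCategory.whiskerLeft_comp, comp_whiskerRight, Category.assoc]
  rw [← Preadditive.comp_sum]
  congr 1
  have h2 : ∀ a, m.dual.rep ◁ dag (d.emb a) ▷ l.rep ≫ (α_ _ _ _).inv ≫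
      (m.dual.rep ◁ d.emb a) ▷ l.rep ≫
        rotate m.solR m.solRb x ▷ l.rep ≫ (α_ _ _ _).hom =
      m.dual.rep ◁ (dag (d.emb a) ≫ d.emb a) ▷ l.rep ≫ (α_ _ _ _).inv ≫
        rotate m.solR m.solRb x ▷ l.rep ≫ (α_ _ _ _).hom := fun a => by
    simp
  rw [Finset.sum_congr rfl fun a _ => h2 a]
  rw [← Preadditive.sum_comp, ← whiskerLeft_sum, ← sum_whiskerRight, d.complete]
  simp

/-- The morphism `R̄ ∈ Mor(id, X ⊗ X̄)`, as a degree `0` morphism of the tube algebra. -/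
def tubeRb (k : Irr C) : (Irr.unit C).rep ⊗ (Irr.unit C).rep ⟶
    (k.rep ⊗ k.dual.rep) ⊗ (Irr.unit C).rep :=
  (Irr.unit C).rep ◁ unitIso.hom ≫ ((ρ_ _).hom ≫ (λ_ _).inv) ≫ k.solRb ▷ _

/-- The morphism `1 ⊗ R`, as a morphism of degree `k` from `X_0` to `X_k ⊗ X̄_k`. -/
def tubeR (k : Irr C) : k.rep ⊗ (Irr.unit C).rep ⟶ (k.rep ⊗ k.dual.rep) ⊗ k.rep :=
  k.rep ◁ unitIso.hom ≫ k.rep ◁ k.solR ≫ (α_ _ _ _).inv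

theorem rotate_tubeRb (k : Irr C) :
    rotate (Irr.unit C).solR (Irr.unit C).solRb (tubeRb k) =
      (Irr.unit C).dual.rep ◁ dag k.solRb ≫ ((ρ_ _).hom ≫ (λ_ _).inv) ≫
        unitIso.inv ▷ _ := by
  rw [tubeRb, rotate_comp, rotate_unitors (Irr.unit C).sol_conj, dag_unitIso_hom]

theorem rotate_tubeR (k : Irr C) :
    rotate k.solR k.solRb (tubeR k) =
      (α_ _ _ _).inv ≫ dag k.solR ▷ k.dual.rep ≫ unitIso.inv ▷ _ := by
  have := rotate_comp k.solR k.solRb unitIso.hom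
    (k.rep ◁ k.solR ≫ (α_ _ _ _).inv) (𝟙 _)
  rw [rotate_whiskerLeft_R k.sol_conj] at this
  simp only [id_whiskerRight, Category.comp_id, dag_id, whiskerLeft_id, Category.id_comp,
    dag_unitIso_hom, Category.assoc] at this
  exact this

/-- This zigzag is the source of `∑ v_a^# w_a = [X_k]`. -/
theorem tubeR_comp (k : Irr C) : tubeR k ≫ dag k.solRb ▷ k.rep =
    k.rep ◁ unitIso.hom ≫ (ρ_ _).hom ≫ (λ_ _).inv := by
  simp only [tubeR, Category.assoc]
  congr 1
  calc _ = k.rep ◁ k.solR ⊗≫ dag k.solRb ▷ k.rep := by monoidal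
    _ = _ := by rw [k.sol_conj.snake_R]; simp

theorem tubeRb_comp (k : Irr C) : tubeRb k ≫ dag k.solRb ▷ _ =
    (statDim k.rep : ℂ) • ((Irr.unit C).rep ◁ unitIso.hom ≫ (ρ_ _).hom ≫ (λ_ _).inv) := by
  simp only [tubeRb, Category.assoc, ← comp_whiskerRight]
  rw [Rb_comp_dag]
  generalize (statDim k.rep : ℂ) = c
  simp

/-- `Σ_a v_a^# w_a` for the components `v_a` of `R̄` and `w_a` of `w`. -/
theorem sum_star_tubeRb_mul (k l : Irr C) (w : l.rep ⊗ (Irr.unit C).rep ⟶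
    (k.rep ⊗ k.dual.rep) ⊗ l.rep) (c : ℂ) (hw : w ≫ dag k.solRb ▷ l.rep =
      c • (l.rep ◁ unitIso.hom ≫ (ρ_ _).hom ≫ (λ_ _).inv))
    (d : Decomposition (k.rep ⊗ k.dual.rep)) :
    ∑ a, star (of (Irr.unit C) (d.idx a) (Irr.unit C) (tubeRb k ≫ dag (d.emb a) ▷ _)) *
        of (Irr.unit C) (d.idx a) l (w ≫ dag (d.emb a) ▷ l.rep) =
      c • corner (FusionAlgebra.basis l) := by
  -- The product has carrier `X̄_0 ⊗ X_l`, whereas `[X_l]` has carrier `X_l`; they are isomorphic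
  -- because the conjugate of the unit class is the unit class.
  rw [sum_star_of_mul_of, rotate_tubeRb, corner_basis, ← ofObj_rep,
    ← ofObj_swapUnit_iso (W := (Irr.unit C).dual.rep ⊗ l.rep) (W' := l.rep)
      (whiskerRightIso (eqToIso (congrArg Irr.rep Irr.dual_unit) ≪≫ unitIso) l.rep ≪≫ λ_ l.rep),
    ← map_smul]
  congr 1
  calc _ = (α_ _ _ _).hom ≫ (Irr.unit C).dual.rep ◁ (w ≫ dag k.solRb ▷ l.rep) ≫
        (α_ _ _ _).inv ≫ (((ρ_ (Irr.unit C).dual.rep).hom ≫ (λ_ _).inv) ≫ unitIso.inv ▷ _) ▷ _ ≫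
        (α_ _ _ _).hom := by
        simp
    _ = _ := by
        rw [hw]
        simp [swapUnit]

/-- In `w^# w` the carrier `X̄_k ⊗ X_k` is entered through `R*` and left through `R`. Moving `R*`
around the tube by `ofObj_swap` leaves the unit as carrier and the loop `R* R = d(X_k)`. -/
theorem sum_star_tubeR_mul (k : Irr C) (d : Decomposition (k.rep ⊗ k.dual.rep)) :
    ∑ a, star (of (Irr.unit C) (d.idx a) k (tubeR k ≫ dag (d.emb a) ▷ _)) *
        of (Irr.unit C) (d.idx a) k (tubeR k ≫ dag (d.emb a) ▷ k.rep) =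
      (statDim k.rep : ℂ) • corner 1 := by
  rw [sum_star_of_mul_of, rotate_tubeR]
  change _ = _ • corner (FusionAlgebra.basis _)
  rw [corner_basis, ← ofObj_rep, ofObj_swapUnit_iso unitIso, ← map_smul]
  have h : (α_ k.dual.rep k.rep (Irr.unit C).rep).hom ≫ k.dual.rep ◁ tubeR k ≫
      (α_ _ _ _).inv ≫ ((α_ _ _ _).inv ≫ dag k.solR ▷ k.dual.rep ≫ unitIso.inv ▷ _) ▷ k.rep
        ≫ (α_ _ _ _).hom =
      dag k.solR ▷ (Irr.unit C).rep ≫ swapUnit (𝟙_ C) ≫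
        (Irr.unit C).rep ◁ k.solR := by
    simp only [tubeR, swapUnit]
    calc _ = 𝟙 _ ⊗≫ (k.dual.rep ⊗ k.rep) ◁ unitIso.hom ⊗≫
          ((k.dual.rep ⊗ k.rep) ◁ k.solR ≫
            dag k.solR ▷ (k.dual.rep ⊗ k.rep)) ⊗≫
          unitIso.inv ▷ (k.dual.rep ⊗ k.rep) := by monoidal
      _ = 𝟙 _ ⊗≫ ((k.dual.rep ⊗ k.rep) ◁ unitIso.hom ≫ dag k.solR ▷ (𝟙_ C)) ⊗≫
          ((𝟙_ C) ◁ k.solR ⊗≫ unitIso.inv ▷ (k.dual.rep ⊗ k.rep)) := by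
        rw [whisker_exchange (dag k.solR) k.solR]
        monoidal
      _ = 𝟙 _ ⊗≫ (dag k.solR ▷ (Irr.unit C).rep ≫ (𝟙_ C) ◁ unitIso.hom) ⊗≫
          (unitIso.inv ▷ (𝟙_ C) ≫ (Irr.unit C).rep ◁ k.solR) := by
        rw [whisker_exchange (dag k.solR) unitIso.hom, ← whisker_exchange unitIso.inv k.solR]
        monoidal
      _ = _ := by monoidal
  rw [h]
  rw [ofObj_swap]
  congr 1
  simp only [Category.assoc, ← MonoidalCategory.whiskerLeft_comp, R_comp_dag]
  generalize (statDim k.rep : ℂ) = c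
  simp

end TubeAlgebra

end
end RigidCStar
-- The uniform bound on admissible representations
namespace RigidCStar
noncomputable section

open CStarCategory RigidCStarTensorCategory

theorem sum_norm_sq_of_sum_star_mul {K : Type*} [NormedAddCommGroup K] [InnerProductSpace ℂ K]
    [CompleteSpace K] {κ : Type*} [Fintype κ] {A : κ → K →L[ℂ] K} {P : K →L[ℂ] K} {d : ℝ}
    (hA : ∑ a, star (A a) * A a = (d : ℂ) • P) {η : K} (hη : P η = η) :
    ∑ a, ‖A a η‖ ^ 2 = d * ‖η‖ ^ 2 := by
  have h := congrArg (fun T : K →L[ℂ] K => inner ℂ η (T η)) hA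
  simp only [sum_apply, smul_apply, hη, inner_sum,
    inner_smul_right, mul_apply_eq_comp, ContinuousLinearMap.star_eq_adjoint,
    ContinuousLinearMap.adjoint_inner_right, inner_self_eq_norm_sq_to_K] at h
  apply Complex.ofReal_injective
  simpa using h

/-- A Cauchy-Schwarz estimate for an operator that factors as `∑ V* A` on the range of `U`. -/
theorem opNorm_le_of_intertwines {H K : Type*} [NormedAddCommGroup H] [InnerProductSpace ℂ H]
    [NormedAddCommGroup K] [InnerProductSpace ℂ K] [CompleteSpace K] {κ : Type*} [Fintype κ]
    {A V : κ → K →L[ℂ] K} {P S : K →L[ℂ] K} {T : H →L[ℂ] H} {d : ℝ} (hd : 0 ≤ d) (U : H →ₗᵢ[ℂ] K)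
    (hT : ∀ ξ, S (U ξ) = U (T ξ)) (hP : ∀ ξ, P (U ξ) = U ξ) (hS : ∑ a, star (V a) * A a = S)
    (hA : ∑ a, star (A a) * A a = (d : ℂ) • P) (hV : ∑ a, star (V a) * V a = (d : ℂ) • P) :
    ‖T‖ ≤ d := by
  refine T.opNorm_le_bound hd fun ξ => ?_
  -- Pairing with `T ξ` itself lets the `V a` act on the left entry, so both families are evaluated
  -- on vectors fixed by `P`.
  have h1 : inner ℂ (T ξ) (T ξ) = ∑ a, inner ℂ (V a (U (T ξ))) (A a (U ξ)) := by
    rw [← U.inner_map_map, ← hT ξ, ← hS]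
    simp only [sum_apply, inner_sum, mul_apply_eq_comp,
      ContinuousLinearMap.star_eq_adjoint, ContinuousLinearMap.adjoint_inner_right]
  have h2 : ‖T ξ‖ ^ 2 ≤ ∑ a, ‖V a (U (T ξ))‖ * ‖A a (U ξ)‖ := by
    have : ‖inner ℂ (T ξ) (T ξ)‖ = ‖T ξ‖ ^ 2 := by
      rw [inner_self_eq_norm_sq_to_K]
      simp
    rw [← this, h1]
    exact (norm_sum_le _ _).trans (Finset.sum_le_sum fun a _ => norm_inner_le_norm _ _)
  have h3 := Finset.sum_mul_sq_le_sq_mul_sq Finset.univ (fun a => ‖V a (U (T ξ))‖)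
    fun a => ‖A a (U ξ)‖
  rw [sum_norm_sq_of_sum_star_mul hA (hP ξ), sum_norm_sq_of_sum_star_mul hV (hP (T ξ)),
    U.norm_map, U.norm_map] at h3
  have h4 : (‖T ξ‖ ^ 2) ^ 2 ≤ (d * ‖T ξ‖ * ‖ξ‖) ^ 2 := by
    refine (pow_le_pow_left₀ (sq_nonneg _) h2 2).trans (h3.trans_eq ?_)
    ring
  have h5 := (pow_le_pow_iff_left₀ (sq_nonneg _) (by positivity) two_ne_zero).1 h4
  rcases (norm_nonneg (T ξ)).eq_or_lt with h | h
  · rw [← h]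
    positivity
  · refine le_of_mul_le_mul_left ?_ h
    linarith

variable {C : Type u} [Category.{v} C] [Preadditive C] [Linear ℂ C]
    [MonoidalCategory C] [MonoidalPreadditive C] [MonoidalLinear ℂ C]
    [RigidCStarTensorCategory C]

/-- Here `V a` and `A a` are the images of the components of `R̄_k` and of `1 ⊗ R_k`, and `P` is the
image of the unit of the corner. The ambient tube representation is indispensable, since these
components lie outside the corner in general. -/
theorem AdmissibleRep.norm_basis_le (π : AdmissibleRep C) (k : Irr C) :
    ‖π.toLin (FusionAlgebra.basis k)‖ ≤ statDim k.rep := by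
  obtain ⟨K, _, _, _, τ, U, -, hU⟩ := π.admissible
  let d := decomposition (k.rep ⊗ k.dual.rep)
  have h1 := congrArg τ.toLin (TubeAlgebra.sum_star_tubeRb_mul k k _ 1
    ((TubeAlgebra.tubeR_comp k).trans (one_smul _ _).symm) d)
  have h2 := congrArg τ.toLin (TubeAlgebra.sum_star_tubeR_mul k d)
  have h3 := congrArg τ.toLin (TubeAlgebra.sum_star_tubeRb_mul k _ _ _
    (TubeAlgebra.tubeRb_comp k) d)
  simp only [map_sum, τ.map_mul, τ.map_star, map_smul, one_smul] at h1 h2 h3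
  refine opNorm_le_of_intertwines (statDim_pos k).le U (hU _) (fun ξ => ?_) h1 h2 h3
  exact (hU 1 ξ).trans (by rw [π.map_one]; rfl)

@[elab_as_elim]
theorem FusionAlgebra.induction {p : FusionAlgebra C → Prop} (f : FusionAlgebra C)
    (zero : p 0) (add : ∀ f g, p f → p g → p (f + g))
    (smul_basis : ∀ (c : ℂ) k, p (c • FusionAlgebra.basis k)) : p f := by
  refine Finsupp.induction_linear (motive := p) f zero add fun k c => ?_
  have h : (Finsupp.single k c : Irr C →₀ ℂ) = c • Finsupp.single k (1 : ℂ) := by simp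
  rw [h]
  exact smul_basis c k

theorem FusionAlgebra.linearMap_ext {M : Type*} [AddCommGroup M] [Module ℂ M]
    {S T : FusionAlgebra C →ₗ[ℂ] M} (h : ∀ k, S (FusionAlgebra.basis k) = T (FusionAlgebra.basis k)) :
    S = T := by
  ext f
  induction f using FusionAlgebra.induction with
  | zero => simp
  | add f g hf hg => simp [hf, hg]
  | smul_basis c k => simp [h]

theorem AdmissibleRep.exists_norm_toLin_le (f : FusionAlgebra C) :
    ∃ c, ∀ π : AdmissibleRep C, ‖π.toLin f‖ ≤ c := by
  induction f using FusionAlgebra.induction with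
  | zero => exact ⟨0, by simp⟩
  | add f g hf hg =>
    obtain ⟨c, hc⟩ := hf
    obtain ⟨c', hc'⟩ := hg
    exact ⟨c + c', fun π => by
      rw [map_add]
      exact (norm_add_le _ _).trans (add_le_add (hc π) (hc' π))⟩
  | smul_basis c k =>
    exact ⟨‖c‖ * statDim k.rep, fun π => by
      rw [map_smul, norm_smul]
      exact mul_le_mul_of_nonneg_left (π.norm_basis_le k) (norm_nonneg _)⟩

end
end RigidCStar
-- Traces: equality of left and right traces and its consequences
namespace RigidCStar
noncomputable section

open CStarCategory RigidCStarTensorCategory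

variable {C : Type u} [Category.{v} C] [Preadditive C] [Linear ℂ C]
    [MonoidalCategory C] [MonoidalPreadditive C] [MonoidalLinear ℂ C]
    [RigidCStarTensorCategory C]

/-- The scalar by which an endomorphism of a simple object acts. -/
def IsSimpleObj.coeff {X : C} (h : IsSimpleObj X) : (X ⟶ X) →ₗ[ℂ] ℂ where
  toFun f := (h.exists_smul f).choose
  map_add' f g := smul_left_injective ℂ h.id_ne_zero (by
    simp only [add_smul]
    rw [← (h.exists_smul f).choose_spec, ← (h.exists_smul g).choose_spec,
      ← (h.exists_smul (f + g)).choose_spec])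
  map_smul' c f := smul_left_injective ℂ h.id_ne_zero (by
    simp only [RingHom.id_apply, smul_eq_mul, mul_smul]
    rw [← (h.exists_smul f).choose_spec, ← (h.exists_smul (c • f)).choose_spec])

namespace IsSimpleObj
variable {X : C} (h : IsSimpleObj X)
include h

theorem eq_coeff_smul (f : X ⟶ X) : f = h.coeff f • 𝟙 X := (h.exists_smul f).choose_spec

theorem coeff_eq_of_eq_smul {f : X ⟶ X} {c : ℂ} (hf : f = c • 𝟙 X) : h.coeff f = c :=
  smul_left_injective ℂ h.id_ne_zero ((h.eq_coeff_smul f).symm.trans hf)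

theorem coeff_id : h.coeff (𝟙 X) = 1 := h.coeff_eq_of_eq_smul (one_smul _ _).symm

theorem coeff_dag (f : X ⟶ X) : h.coeff (dag f) = star (h.coeff f) := by
  apply h.coeff_eq_of_eq_smul
  conv_lhs => rw [h.eq_coeff_smul f]
  rw [dag_smul, dag_id]

theorem coeff_comp_dag {Y : C} (f : X ⟶ Y) :
    h.coeff (f ≫ dag f) = ((homNorm f ^ 2 : ℝ) : ℂ) :=
  h.coeff_eq_of_eq_smul (h.comp_dag_eq f)

theorem norm_coeff (f : X ⟶ X) : ‖h.coeff f‖ = homNorm f := by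
  conv_rhs => rw [h.eq_coeff_smul f]
  rw [homNorm_smul, h.homNorm_id, mul_one]

end IsSimpleObj

theorem homNorm_dag {X Y : C} (f : X ⟶ Y) : homNorm (dag f) = homNorm f := by
  have h1 := homNorm_mul_star (dag f)
  rw [dag_dag, homNorm_star_mul] at h1
  exact ((pow_left_inj₀ (homNorm_nonneg _) (homNorm_nonneg _) two_ne_zero).1 h1).symm

theorem dag_neg {X Y : C} (f : X ⟶ Y) : dag (-f) = -dag f := by
  have := dag_smul (-1 : ℂ) f
  simpa using this

theorem dag_sub {X Y : C} (f g : X ⟶ Y) : dag (f - g) = dag f - dag g := by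
  rw [sub_eq_add_neg, dag_add, dag_neg, sub_eq_add_neg]

namespace IsConjugateSolution
variable {X Xb : C} {R : 𝟙_ C ⟶ Xb ⊗ X} {Rb : 𝟙_ C ⟶ X ⊗ Xb}

/-- Frobenius reciprocity. -/
theorem exists_comp_whiskerRight (h : IsConjugateSolution X Xb R Rb) {B : C}
    (f : 𝟙_ C ⟶ B ⊗ X) : ∃ t : Xb ⟶ B, R ≫ t ▷ X = f := by
  refine ⟨(λ_ Xb).inv ≫ f ▷ Xb ≫ (α_ B X Xb).hom ≫ B ◁ dag Rb ≫ (ρ_ B).hom, ?_⟩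
  calc _ = 𝟙 _ ⊗≫ ((𝟙_ C) ◁ R ≫ f ▷ (Xb ⊗ X)) ⊗≫ B ◁ dag Rb ▷ X ⊗≫ 𝟙 _ := by monoidal
    _ = 𝟙 _ ⊗≫ f ⊗≫ B ◁ (X ◁ R ⊗≫ dag Rb ▷ X) ⊗≫ 𝟙 _ := by
      rw [whisker_exchange]
      monoidal
    _ = _ := by
      rw [h.snake_R]
      monoidal

theorem exists_comp_whiskerLeft (h : IsConjugateSolution X Xb R Rb) {B : C}
    (f : 𝟙_ C ⟶ X ⊗ B) : ∃ t : Xb ⟶ B, Rb ≫ X ◁ t = f := by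
  refine ⟨(ρ_ Xb).inv ≫ Xb ◁ f ≫ (α_ Xb X B).inv ≫ dag R ▷ B ≫ (λ_ B).hom, ?_⟩
  calc _ = 𝟙 _ ⊗≫ (Rb ▷ (𝟙_ C) ≫ (X ⊗ Xb) ◁ f) ⊗≫ X ◁ dag R ▷ B ⊗≫ 𝟙 _ := by monoidal
    _ = 𝟙 _ ⊗≫ f ⊗≫ (Rb ▷ X ⊗≫ X ◁ dag R) ▷ B ⊗≫ 𝟙 _ := by
      rw [← whisker_exchange]
      monoidal
    _ = _ := by
      rw [h.snake_Rb_dag]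
      monoidal

theorem comp_whiskerRight_dag {Y Yb : C} {S : 𝟙_ C ⟶ Yb ⊗ Y} {Sb : 𝟙_ C ⟶ Y ⊗ Yb}
    (h : IsConjugateSolution X Xb R Rb) (hY : IsConjugateSolution Y Yb S Sb) (w : X ⟶ Y)
    (t : Xb ⟶ Yb) (ht : Rb ≫ X ◁ t = Sb ≫ dag w ▷ Yb) : S ≫ dag t ▷ Y = R ≫ Xb ◁ w := by
  have h1 : X ◁ dag t ≫ dag Rb = w ▷ Yb ≫ dag Sb := by
    have := congrArg dag ht
    simpa only [dag_comp, dag_whiskerLeft, dag_whiskerRight, dag_dag] using this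
  calc _ = 𝟙 _ ⊗≫ S ⊗≫ dag t ▷ Y ⊗≫ (⊗𝟙.hom : 𝟙_ C ⊗ Xb ⟶ Xb ⊗ 𝟙_ C) ▷ Y ⊗≫ 𝟙 _ := by monoidal
    _ = 𝟙 _ ⊗≫ S ⊗≫ ((𝟙_ C) ◁ dag t ≫ R ▷ Xb) ▷ Y ⊗≫ Xb ◁ dag Rb ▷ Y ⊗≫ 𝟙 _ := by
      rw [← h.snake_R_dag]
      monoidal
    _ = 𝟙 _ ⊗≫ S ⊗≫ R ▷ Yb ▷ Y ⊗≫ (Xb ◁ (X ◁ dag t ≫ dag Rb)) ▷ Y ⊗≫ 𝟙 _ := by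
      rw [whisker_exchange]
      monoidal
    _ = 𝟙 _ ⊗≫ ((𝟙_ C) ◁ S ≫ (R ≫ Xb ◁ w) ▷ (Yb ⊗ Y)) ⊗≫ Xb ◁ dag Sb ▷ Y ⊗≫ 𝟙 _ := by
      rw [h1]
      monoidal
    _ = 𝟙 _ ⊗≫ (R ≫ Xb ◁ w) ⊗≫ Xb ◁ (Y ◁ S ⊗≫ dag Sb ▷ Y) ⊗≫ 𝟙 _ := by
      rw [whisker_exchange]
      monoidal
    _ = _ := by
      rw [hY.snake_R]
      monoidal

end IsConjugateSolution

/-- The left trace of an endomorphism of `X_k`. -/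
theorem solR_trace {k : Irr C} (f : k.rep ⟶ k.rep) :
    k.solR ≫ k.dual.rep ◁ f ≫ dag k.solR =
      (statDim k.rep * k.rep_simple.coeff f : ℂ) • 𝟙 (𝟙_ C) := by
  conv_lhs => rw [k.rep_simple.eq_coeff_smul f]
  have := R_comp_dag k
  simp [this, mul_smul, smul_comm _ (k.rep_simple.coeff f)]

theorem solRb_trace {k : Irr C} (f : k.rep ⟶ k.rep) :
    k.solRb ≫ f ▷ k.dual.rep ≫ dag k.solRb =
      (statDim k.rep * k.rep_simple.coeff f : ℂ) • 𝟙 (𝟙_ C) := by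
  conv_lhs => rw [k.rep_simple.eq_coeff_smul f]
  have := Rb_comp_dag k
  simp [this, mul_smul, smul_comm _ (k.rep_simple.coeff f)]

theorem solR_trace_dual {k : Irr C} (f : k.dual.rep ⟶ k.dual.rep) :
    k.solR ≫ f ▷ k.rep ≫ dag k.solR =
      (statDim k.rep * k.dual.rep_simple.coeff f : ℂ) • 𝟙 (𝟙_ C) := by
  conv_lhs => rw [k.dual.rep_simple.eq_coeff_smul f]
  have := R_comp_dag k
  simp [this, mul_smul, smul_comm _ (k.dual.rep_simple.coeff f)]

theorem solRb_trace_dual {k : Irr C} (f : k.dual.rep ⟶ k.dual.rep) :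
    k.solRb ≫ k.rep ◁ f ≫ dag k.solRb =
      (statDim k.rep * k.dual.rep_simple.coeff f : ℂ) • 𝟙 (𝟙_ C) := by
  conv_lhs => rw [k.dual.rep_simple.eq_coeff_smul f]
  have := Rb_comp_dag k
  simp [this, mul_smul, smul_comm _ (k.dual.rep_simple.coeff f)]

/-- A solution of the conjugate equations whose left and right traces agree computes the
dimension-weighted trace on the isotypic components. -/
theorem IsConjugateSolution.trace_dag_comp {Y Yb : C} {S : 𝟙_ C ⟶ Yb ⊗ Y} {Sb : 𝟙_ C ⟶ Y ⊗ Yb}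
    (hY : IsConjugateSolution Y Yb S Sb)
    (sph : ∀ F : Y ⟶ Y, S ≫ Yb ◁ F ≫ dag S = Sb ≫ F ▷ Yb ≫ dag Sb) {k : Irr C}
    (v w : k.rep ⟶ Y) : S ≫ Yb ◁ (dag v ≫ w) ≫ dag S =
      (statDim k.rep * k.rep_simple.coeff (w ≫ dag v) : ℂ) • 𝟙 (𝟙_ C) := by
  have hk := k.rep_simple
  have hkd := k.dual.rep_simple
  have hd : (statDim k.rep : ℂ) ≠ 0 := by exact_mod_cast (statDim_pos k).ne'
  -- `l v` and `r v` are the transposes of `v*` through the left and the right solutions. The aim is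
  -- `l = r`.
  choose l hl using fun v : k.rep ⟶ Y =>
    k.sol_conj.exists_comp_whiskerRight (S ≫ Yb ◁ dag v)
  choose r hr using fun v : k.rep ⟶ Y =>
    k.sol_conj.exists_comp_whiskerLeft (Sb ≫ dag v ▷ Yb)
  have hL : ∀ v w : k.rep ⟶ Y, S ≫ Yb ◁ (dag v ≫ w) ≫ dag S =
      (statDim k.rep * hkd.coeff (l v ≫ dag (l w)) : ℂ) • 𝟙 (𝟙_ C) := by
    intro v w
    have h2 := congrArg dag (hl w)
    simp only [dag_comp, dag_whiskerLeft, dag_whiskerRight, dag_dag] at h2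
    rw [← solR_trace_dual, comp_whiskerRight, Category.assoc, h2, ← Category.assoc k.solR, hl v]
    simp
  -- The only use of `sph`: the left and right traces of `w w*` are `d` times the squared norms of
  -- the two transposes.
  have hR : ∀ (w : k.rep ⟶ Y) (t : k.dual.rep ⟶ Yb), k.solRb ≫ k.rep ◁ t = Sb ≫ dag w ▷ Yb →
      homNorm (l w) = homNorm t := by
    intro w t ht
    have h2 := congrArg dag ht
    simp only [dag_comp, dag_whiskerLeft, dag_whiskerRight, dag_dag] at h2
    have h3 := solRb_trace_dual (t ≫ dag t)
    rw [MonoidalCategory.whiskerLeft_comp, Category.assoc, h2, ← Category.assoc, ht] at h3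
    have h4 := (hL w w).symm.trans (sph _)
    simp only [comp_whiskerRight, Category.assoc] at h3 h4
    have h5 := mul_left_cancel₀ hd (smul_left_injective ℂ simple_unit.id_ne_zero (h4.trans h3))
    rw [hkd.coeff_comp_dag, hkd.coeff_comp_dag, Complex.ofReal_inj] at h5
    exact (pow_left_inj₀ (homNorm_nonneg _) (homNorm_nonneg _) two_ne_zero).1 h5
  -- A left transpose paired with a right transpose returns the original inner product, without any
  -- assumption on the traces.
  have hmix : ∀ (v w : k.rep ⟶ Y) (t : k.dual.rep ⟶ Yb),
      k.solRb ≫ k.rep ◁ t = Sb ≫ dag w ▷ Yb →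
      hkd.coeff (l v ≫ dag t) = hk.coeff (w ≫ dag v) := by
    intro v w t ht
    have h2 : k.solR ≫ (l v ≫ dag t) ▷ k.rep = k.solR ≫ k.dual.rep ◁ (w ≫ dag v) := by
      rw [comp_whiskerRight, ← Category.assoc, hl, Category.assoc, whisker_exchange,
        ← Category.assoc, k.sol_conj.comp_whiskerRight_dag hY w t ht]
      simp
    rw [hkd.eq_coeff_smul (l v ≫ dag t), hk.eq_coeff_smul (w ≫ dag v)] at h2
    simp only [MonoidalLinear.smul_whiskerRight, MonoidalLinear.whiskerLeft_smul, id_whiskerRight,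
      MonoidalCategory.whiskerLeft_id, Linear.comp_smul, Category.comp_id] at h2
    exact smul_left_injective ℂ (k.sol_conj.R_ne_zero hk.id_ne_zero) h2
  -- Both cross terms equal `‖v‖²` by `hmix`, and `‖r v‖ = ‖l v‖` by `hR`. In particular `‖v‖ ≤ ‖l
  -- v‖`.
  have hdiff : ∀ v, homNorm (l v - r v) ^ 2 = 2 * (homNorm (l v) ^ 2 - homNorm v ^ 2) := by
    intro v
    have h1 := hmix v v (r v) (hr v)
    rw [hk.coeff_comp_dag] at h1
    have h2 : hkd.coeff (r v ≫ dag (l v)) = ((homNorm v ^ 2 : ℝ) : ℂ) := by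
      have := hkd.coeff_dag (l v ≫ dag (r v))
      rw [dag_comp, dag_dag, h1] at this
      rw [this]
      exact Complex.conj_ofReal _
    have h3 := hkd.coeff_comp_dag (l v - r v)
    rw [dag_sub, Preadditive.sub_comp, Preadditive.comp_sub, Preadditive.comp_sub, map_sub,
      map_sub, map_sub, h1, h2, hkd.coeff_comp_dag, hkd.coeff_comp_dag, ← hR v _ (hr v)] at h3
    have h4 := congrArg Complex.re h3
    simp only [Complex.sub_re, Complex.ofReal_re] at h4
    linarith
  have hge : ∀ v, homNorm v ≤ homNorm (l v) := fun v => by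
    have := hdiff v
    exact (pow_le_pow_iff_left₀ (homNorm_nonneg _) (homNorm_nonneg _) two_ne_zero).1
      (by nlinarith [sq_nonneg (homNorm (l v - r v))])
  -- Every morphism is a right transpose, so `l v` is the right transpose of some `u`, namely `dag
  -- t`. Then `‖l v‖² = |⟨u, v⟩| ≤ ‖u‖ ‖v‖ ≤ ‖l u‖ ‖v‖ = ‖l v‖ ‖v‖`. With equality of norms, `hdiff`
  -- forces `l v = r v`.
  have hle : ∀ v, homNorm (l v) ≤ homNorm v := fun v => by
    obtain ⟨t, ht⟩ := hY.symm.exists_comp_whiskerRight (k.solRb ≫ k.rep ◁ l v)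
    have ht' : k.solRb ≫ k.rep ◁ l v = Sb ≫ dag (dag t) ▷ Yb := by rw [dag_dag, ht]
    have h1 := congrArg norm (hmix v (dag t) (l v) ht')
    rw [hkd.norm_coeff, hk.norm_coeff, homNorm_star_mul] at h1
    have h2 := homNorm_comp_le (dag t) (dag v)
    rw [← h1, homNorm_dag v] at h2
    have h3 := hge (dag t)
    rw [hR (dag t) (l v) ht'] at h3
    rcases (homNorm_nonneg (l v)).eq_or_lt with h | h
    · rw [← h]
      exact homNorm_nonneg v
    · nlinarith [homNorm_nonneg v]
  have heq : ∀ v, l v = r v := fun v => by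
    have h1 := hdiff v
    rw [le_antisymm (hle v) (hge v), sub_self, mul_zero] at h1
    exact sub_eq_zero.1 (eq_zero_of_homNorm _ (pow_eq_zero_iff two_ne_zero |>.1 h1))
  rw [hL, heq w, hmix v w (r w) (hr w)]

theorem IsConjugateSolution.trace_eq_sum {Y Yb : C} {S : 𝟙_ C ⟶ Yb ⊗ Y} {Sb : 𝟙_ C ⟶ Y ⊗ Yb}
    (hY : IsConjugateSolution Y Yb S Sb)
    (sph : ∀ F : Y ⟶ Y, S ≫ Yb ◁ F ≫ dag S = Sb ≫ F ▷ Yb ≫ dag Sb) (d : Decomposition Y)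
    (F : Y ⟶ Y) : S ≫ Yb ◁ F ≫ dag S =
      (∑ a, statDim (d.idx a).rep *
        (d.idx a).rep_simple.coeff (d.emb a ≫ F ≫ dag (d.emb a)) : ℂ) • 𝟙 (𝟙_ C) := by
  have h : F = ∑ a, dag (d.emb a ≫ dag F) ≫ d.emb a := by
    simp only [dag_comp, dag_dag, Category.assoc]
    rw [← Preadditive.comp_sum, d.complete, Category.comp_id]
  conv_lhs => rw [h]
  simp only [whiskerLeft_sum, Preadditive.sum_comp, Preadditive.comp_sum, Finset.sum_smul]
  refine Finset.sum_congr rfl fun a _ => ?_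
  rw [hY.trace_dag_comp sph, dag_comp, dag_dag]

/-- The solution of the conjugate equations for a tensor product. -/
theorem IsConjugateSolution.tensor {X Xb Z Zb : C} {R : 𝟙_ C ⟶ Xb ⊗ X} {Rb : 𝟙_ C ⟶ X ⊗ Xb}
    {S : 𝟙_ C ⟶ Zb ⊗ Z} {Sb : 𝟙_ C ⟶ Z ⊗ Zb} (hX : IsConjugateSolution X Xb R Rb)
    (hZ : IsConjugateSolution Z Zb S Sb) :
    IsConjugateSolution (X ⊗ Z) (Zb ⊗ Xb)
      (S ≫ Zb ◁ ((λ_ Z).inv ≫ R ▷ Z ≫ (α_ _ _ _).hom) ≫ (α_ _ _ _).inv)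
      (Rb ≫ ((ρ_ X).inv ≫ X ◁ Sb ≫ (α_ _ _ _).inv) ▷ Xb ≫ (α_ _ _ _).hom) := by
  let _ := hX.exactPairing
  let _ := hZ.exactPairing
  have e1 : η_ (X ⊗ Z) (Zb ⊗ Xb) =
      Rb ≫ ((ρ_ X).inv ≫ X ◁ Sb ≫ (α_ _ _ _).inv) ▷ Xb ≫ (α_ _ _ _).hom := by
    rw [ExactPairing.tensor_coevaluation]
    change Rb ⊗≫ (X ◁ Sb) ▷ Xb ⊗≫ 𝟙 _ = _
    monoidal
  have e2 : ε_ (X ⊗ Z) (Zb ⊗ Xb) =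
      dag (S ≫ Zb ◁ ((λ_ Z).inv ≫ R ▷ Z ≫ (α_ _ _ _).hom) ≫ (α_ _ _ _).inv) := by
    rw [ExactPairing.tensor_evaluation]
    change 𝟙 _ ⊗≫ Zb ◁ (dag R ▷ Z) ⊗≫ dag S = _
    simp only [dag_comp, dag_whiskerLeft, dag_whiskerRight, dag_associator, dag_associator_inv,
      dag_leftUnitor_inv]
    monoidal
  have h1 := ExactPairing.coevaluation_evaluation (X ⊗ Z) (Zb ⊗ Xb)
  have h2 := ExactPairing.evaluation_coevaluation (X ⊗ Z) (Zb ⊗ Xb)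
  rw [e1, e2] at h1 h2
  constructor
  · have h3 := congrArg dag h1
    simp only [dag_comp (_ ◁ _), dag_comp (α_ _ _ _).inv, dag_comp (ρ_ _).hom,
      dag_associator_inv, dag_rightUnitor, dag_leftUnitor_inv, dag_whiskerLeft,
      dag_whiskerRight, dag_dag, Category.assoc] at h3
    rw [Iso.inv_comp_eq, Category.comp_id, ← cancel_mono (ρ_ (Zb ⊗ Xb)).inv]
    simpa only [Category.assoc, Iso.hom_inv_id, Category.comp_id] using h3
  · rw [Iso.inv_comp_eq, Category.comp_id, ← cancel_mono (ρ_ (X ⊗ Z)).inv]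
    simpa only [Category.assoc, Iso.hom_inv_id, Category.comp_id] using h2

/-- The left partial trace. -/
def partialTrace {X Xb Z W : C} (R : 𝟙_ C ⟶ Xb ⊗ X) (F : X ⊗ Z ⟶ X ⊗ W) : Z ⟶ W :=
  (λ_ Z).inv ≫ R ▷ Z ≫ (α_ _ _ _).hom ≫ Xb ◁ F ≫ (α_ _ _ _).inv ≫ dag R ▷ W ≫ (λ_ W).hom

/-- Both sides compute the trace of `F` for the tensor product solution: once over the simple
components by `trace_eq_sum`, once by closing the `m` strand and then the `l` strand. -/
theorem sum_trace_tensor (m l : Irr C) (d : Decomposition (m.rep ⊗ l.rep))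
    (F : m.rep ⊗ l.rep ⟶ m.rep ⊗ l.rep) :
    (∑ a, statDim (d.idx a).rep *
        (d.idx a).rep_simple.coeff (d.emb a ≫ F ≫ dag (d.emb a)) : ℂ) =
      statDim l.rep * l.rep_simple.coeff (partialTrace m.solR F) := by
  have hY := m.sol_conj.tensor l.sol_conj
  set S := l.solR ≫ l.dual.rep ◁ ((λ_ l.rep).inv ≫ m.solR ▷ l.rep ≫ (α_ _ _ _).hom) ≫
    (α_ _ _ _).inv with hS
  set Sb := m.solRb ≫ ((ρ_ m.rep).inv ≫ m.rep ◁ l.solRb ≫ (α_ _ _ _).inv) ▷ m.dual.rep ≫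
    (α_ _ _ _).hom with hSb
  have dagS : dag S = (α_ _ _ _).hom ≫ l.dual.rep ◁ ((α_ _ _ _).inv ≫ dag m.solR ▷ l.rep ≫
      (λ_ l.rep).hom) ≫ dag l.solR := by
    simp only [hS, dag_comp, dag_whiskerLeft, dag_whiskerRight, dag_associator,
      dag_associator_inv, dag_leftUnitor_inv, Category.assoc]
  have dagSb : dag Sb = (α_ _ _ _).inv ≫ ((α_ _ _ _).hom ≫ m.rep ◁ dag l.solRb ≫
      (ρ_ m.rep).hom) ▷ m.dual.rep ≫ dag m.solRb := by
    simp only [hSb, dag_comp, dag_whiskerLeft, dag_whiskerRight, dag_associator,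
      dag_associator_inv, dag_rightUnitor_inv, Category.assoc]
  have hleft : ∀ F, S ≫ (l.dual.rep ⊗ m.dual.rep) ◁ F ≫ dag S =
      (statDim l.rep * l.rep_simple.coeff (partialTrace m.solR F) : ℂ) • 𝟙 (𝟙_ C) := by
    intro F
    rw [← solR_trace, dagS, hS, partialTrace]
    monoidal
  -- On a simple object both traces are `d` times the scalar, because `‖R‖ = ‖R̄‖`. So the `l` loop
  -- is moved to the right first; the `m` and `l` loops are then interchanged, and the `m` loop is
  -- moved to the right.
  have sph : ∀ F, S ≫ (l.dual.rep ⊗ m.dual.rep) ◁ F ≫ dag S =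
      Sb ≫ F ▷ (l.dual.rep ⊗ m.dual.rep) ≫ dag Sb := by
    intro F
    let G : m.rep ⟶ m.rep := (ρ_ m.rep).inv ≫ m.rep ◁ l.solRb ≫ (α_ _ _ _).inv ≫
      F ▷ l.dual.rep ≫ (α_ _ _ _).hom ≫ m.rep ◁ dag l.solRb ≫ (ρ_ m.rep).hom
    calc _ = m.solR ≫ m.dual.rep ◁ G ≫ dag m.solR := by
          rw [hleft, ← solRb_trace]
          calc _ = 𝟙 _ ⊗≫ ((𝟙_ C) ◁ l.solRb ≫ m.solR ▷ (l.rep ⊗ l.dual.rep)) ⊗≫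
                  m.dual.rep ◁ F ▷ l.dual.rep ⊗≫
                  (dag m.solR ▷ (l.rep ⊗ l.dual.rep) ≫ (𝟙_ C) ◁ dag l.solRb) ⊗≫ 𝟙 _ := by
                rw [partialTrace]
                monoidal
            _ = 𝟙 _ ⊗≫ (m.solR ▷ (𝟙_ C) ≫ (m.dual.rep ⊗ m.rep) ◁ l.solRb) ⊗≫
                  m.dual.rep ◁ F ▷ l.dual.rep ⊗≫
                  ((m.dual.rep ⊗ m.rep) ◁ dag l.solRb ≫ dag m.solR ▷ (𝟙_ C)) ⊗≫ 𝟙 _ := by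
                rw [whisker_exchange, ← whisker_exchange (dag m.solR) (dag l.solRb)]
            _ = _ := by
                dsimp only [G]
                monoidal
      _ = m.solRb ≫ G ▷ m.dual.rep ≫ dag m.solRb := by rw [solR_trace, solRb_trace]
      _ = _ := by
          rw [dagSb, hSb]
          dsimp only [G]
          monoidal
  exact smul_left_injective ℂ simple_unit.id_ne_zero
    ((hY.trace_eq_sum sph d F).symm.trans (hleft F))

end
end RigidCStar
-- The dimension character of the fusion algebra
namespace RigidCStar
noncomputable section

open CStarCategory RigidCStarTensorCategory

variable {C : Type u} [Category.{v} C] [Preadditive C] [Linear ℂ C]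
    [MonoidalCategory C] [MonoidalPreadditive C] [MonoidalLinear ℂ C]
    [RigidCStarTensorCategory C]

theorem partialTrace_id (m l : Irr C) :
    partialTrace m.solR (𝟙 (m.rep ⊗ l.rep)) = (statDim m.rep : ℂ) • 𝟙 l.rep := by
  have h : partialTrace m.solR (𝟙 (m.rep ⊗ l.rep)) =
      (λ_ _).inv ≫ (m.solR ≫ dag m.solR) ▷ l.rep ≫ (λ_ _).hom := by
    simp [partialTrace]
  rw [h, (R_comp_dag m : m.solR ≫ dag m.solR = _)]
  generalize (statDim m.rep : ℂ) = c
  simp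

/-- The case `F = 1` of `sum_trace_tensor`. Besides making `dimChar` multiplicative, it normalises
the convex weights in `AdmissibleRep.exists_invariant_vector`. -/
theorem sum_statDim_decomposition (m l : Irr C) (d : Decomposition (m.rep ⊗ l.rep)) :
    (∑ a, statDim (d.idx a).rep : ℂ) = statDim m.rep * statDim l.rep := by
  have h := sum_trace_tensor m l d (𝟙 _)
  rw [partialTrace_id, map_smul, l.rep_simple.coeff_id] at h
  simp only [Category.id_comp, d.isometry, IsSimpleObj.coeff_id, mul_one] at h
  rw [h, smul_eq_mul, mul_one, mul_comm]

theorem statDim_dual (k : Irr C) : statDim k.dual.rep = statDim k.rep := by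
  rw [k.sol_conj.symm.statDim_eq k.dual.rep_simple, k.sol_conj.statDim_eq k.rep_simple, mul_comm]

theorem statDim_unit : statDim (Irr.unit C).rep = 1 := by
  have h : IsConjugateSolution (𝟙_ C) (𝟙_ C) (λ_ _).inv (λ_ _).inv := by
    constructor <;> (rw [dag_leftUnitor_inv]; monoidal)
  have hn := homNorm_star_mul (λ_ (𝟙_ C)).inv
  rw [dag_leftUnitor_inv, Iso.inv_hom_id, simple_unit.homNorm_id, sq] at hn
  rw [Irr.rep_unit, h.statDim_eq simple_unit, ← hn]

theorem finrank_hom_rep (k l : Irr C) [Decidable (l = k)] :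
    Module.finrank ℂ (k.rep ⟶ l.rep) = if l = k then 1 else 0 := by
  split_ifs with h
  · subst h
    exact l.rep_simple
  · have : Subsingleton (k.rep ⟶ l.rep) := by
      refine subsingleton_of_forall_eq 0 fun f => ?_
      by_contra hf
      exact h (Irr.eq_of_ne_zero f hf).symm
    exact Module.finrank_zero_of_subsingleton

/-- Composition with the orthonormal basis. -/
def Decomposition.homEquiv {Y : C} (d : Decomposition Y) (X : C) :
    (X ⟶ Y) ≃ₗ[ℂ] ∀ a, X ⟶ (d.idx a).rep where
  toFun f a := f ≫ dag (d.emb a)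
  map_add' f g := by
    ext a
    simp
  map_smul' c f := by
    ext a
    simp
  invFun g := ∑ a, g a ≫ d.emb a
  left_inv f := by
    simp only [Category.assoc]
    rw [← Preadditive.comp_sum, d.complete, Category.comp_id]
  right_inv g := by
    ext b
    change (∑ a, g a ≫ d.emb a) ≫ dag (d.emb b) = g b
    rw [Preadditive.sum_comp, Finset.sum_eq_single b]
    · rw [Category.assoc, d.isometry, Category.comp_id]
    · intro a _ hab
      rw [Category.assoc, d.orthogonal a b hab, Limits.comp_zero]
    · simp

open Classical in
theorem Decomposition.finrank_eq {Y : C} (d : Decomposition Y) (k : Irr C) :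
    Module.finrank ℂ (k.rep ⟶ Y) = ∑ a, if d.idx a = k then 1 else 0 := by
  rw [(d.homEquiv k.rep).finrank_eq, Module.finrank_pi_fintype]
  simp only [finrank_hom_rep]

/-- The character `[X_k] ↦ d(X_k)` of the fusion algebra. -/
def dimChar : FusionAlgebra C →ₗ[ℂ] ℂ :=
  Finsupp.lsum ℂ fun k => LinearMap.toSpanSingleton ℂ ℂ (statDim k.rep : ℂ)

theorem dimChar_basis (k : Irr C) : dimChar (FusionAlgebra.basis k) = statDim k.rep := by
  unfold dimChar FusionAlgebra.basis
  erw [Finsupp.lsum_single]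
  simp

namespace FusionAlgebra

/-- The coefficient of `[X_k]`. -/
def coord (k : Irr C) : FusionAlgebra C →ₗ[ℂ] ℂ := Finsupp.lapply (R := ℂ) k

theorem ext_coord {f g : FusionAlgebra C} (h : ∀ k, coord k f = coord k g) : f = g :=
  Finsupp.ext (α := Irr C) (M := ℂ) h

open Classical in
theorem coord_basis (k l : Irr C) : coord k (basis l) = if l = k then 1 else 0 :=
  Finsupp.single_apply

theorem basisMul_eq_sum (i j : Irr C) (d : Decomposition (i.rep ⊗ j.rep)) :
    basisMul i j = ∑ a, basis (d.idx a) := by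
  classical
  refine ext_coord fun k => ?_
  change (fusionMult i j k : ℂ) = _
  rw [map_sum, fusionMult, d.finrank_eq]
  simp [coord_basis]

/-- Multiplication as a bilinear map. -/
def mulBilin : FusionAlgebra C →ₗ[ℂ] FusionAlgebra C →ₗ[ℂ] FusionAlgebra C :=
  Finsupp.lsum ℂ fun i => LinearMap.toSpanSingleton ℂ _
    (Finsupp.lsum ℂ fun j => LinearMap.toSpanSingleton ℂ _ (basisMul i j))

theorem mulBilin_apply (f g : FusionAlgebra C) : mulBilin f g = f * g := by
  change (Finsupp.sum f fun i a => a • (show FusionAlgebra C →ₗ[ℂ] FusionAlgebra C from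
    Finsupp.lsum ℂ fun j => LinearMap.toSpanSingleton ℂ _ (basisMul i j))) g =
    Finsupp.sum f fun i a => Finsupp.sum g fun j b => (a * b) • basisMul i j
  refine (LinearMap.sum_apply _ _ _).trans (Finset.sum_congr rfl fun i _ => ?_)
  have h : ∀ (g : Irr C →₀ ℂ) (a : ℂ), a • Finsupp.sum g (fun j b => b • basisMul i j) =
      Finsupp.sum g fun j b => (a * b) • basisMul i j := fun g a => by
    rw [Finsupp.smul_sum]
    simp only [smul_smul]
  exact h g _

theorem basis_mul_basis (i j : Irr C) : basis i * basis j = basisMul i j := by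
  change Finsupp.sum (Finsupp.single i (1 : ℂ)) (fun i a => Finsupp.sum (Finsupp.single j (1 : ℂ))
    fun j b => (a * b) • basisMul i j) = _
  rw [Finsupp.sum_single_index (by simp), Finsupp.sum_single_index (by simp), mul_one, one_smul]

theorem star_add' (f g : FusionAlgebra C) : star (f + g) = star f + star g := by
  exact Finsupp.sum_add_index' (by simp) (by simp [add_smul])

theorem star_smul_basis (c : ℂ) (k : Irr C) : star (c • basis k) = star c • basis k.dual := by
  have h : c • basis k = (Finsupp.single k c : Irr C →₀ ℂ) := Finsupp.smul_single_one k c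
  rw [h]
  exact Finsupp.sum_single_index (by simp)

end FusionAlgebra

theorem dimChar_mul (f g : FusionAlgebra C) : dimChar (f * g) = dimChar f * dimChar g := by
  rw [← FusionAlgebra.mulBilin_apply]
  suffices h : FusionAlgebra.mulBilin.compr₂ dimChar =
      (LinearMap.mul ℂ ℂ).compl₁₂ (dimChar (C := C)) dimChar from
    LinearMap.congr_fun (LinearMap.congr_fun h f) g
  refine FusionAlgebra.linearMap_ext fun i => FusionAlgebra.linearMap_ext fun j => ?_
  simp only [LinearMap.compr₂_apply, LinearMap.compl₁₂_apply, FusionAlgebra.mulBilin_apply,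
    FusionAlgebra.basis_mul_basis, LinearMap.mul_apply', dimChar_basis,
    FusionAlgebra.basisMul_eq_sum i j (decomposition _), map_sum, sum_statDim_decomposition]

theorem dimChar_star (f : FusionAlgebra C) : dimChar (star f) = star (dimChar f) := by
  induction f using FusionAlgebra.induction with
  | zero =>
    have : star (0 : FusionAlgebra C) = 0 := Finsupp.sum_zero_index
    simp [this]
  | add f g hf hg => rw [FusionAlgebra.star_add', map_add, map_add, star_add, hf, hg]
  | smul_basis c k =>
    rw [FusionAlgebra.star_smul_basis, map_smul, map_smul, dimChar_basis, dimChar_basis,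
      statDim_dual]
    simp

end
end RigidCStar
-- The trivial representation of the tube algebra
namespace RigidCStar
noncomputable section

open CStarCategory RigidCStarTensorCategory

variable {C : Type u} [Category.{v} C] [Preadditive C] [Linear ℂ C]
    [MonoidalCategory C] [MonoidalPreadditive C] [MonoidalLinear ℂ C]
    [RigidCStarTensorCategory C]

open Classical in
/-- The identity `id = X_0` as a morphism `id → X_i`, which is zero unless `i = 0`. -/
def Irr.unitHom (i : Irr C) : 𝟙_ C ⟶ i.rep :=
  if h : i = Irr.unit C then eqToHom ((congrArg Irr.rep h).trans Irr.rep_unit).symm else 0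

theorem Irr.unitHom_of_ne {i : Irr C} (h : i ≠ Irr.unit C) : i.unitHom = 0 := dif_neg h

theorem Irr.unitHom_unit : (Irr.unit C).unitHom = TubeAlgebra.unitIso.inv := dif_pos rfl

/-- Morphisms from a simple object to the unit are multiples of the canonical one. -/
theorem Irr.eq_smul_dag_unitHom (s : Irr C) (θ : s.rep ⟶ 𝟙_ C) {c : ℂ}
    (h : s.unitHom ≫ θ = c • 𝟙 (𝟙_ C)) : θ = c • dag s.unitHom := by
  by_cases hs : s = Irr.unit C
  · subst hs
    rw [Irr.unitHom_unit] at h ⊢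
    rw [TubeAlgebra.dag_unitIso_inv, ← cancel_epi TubeAlgebra.unitIso.inv, h]
    simp
  · have h0 : θ ≫ TubeAlgebra.unitIso.inv = 0 := by
      by_contra hne
      exact hs (Irr.eq_of_ne_zero _ hne)
    rw [Irr.unitHom_of_ne hs, dag_zero, smul_zero, ← cancel_mono TubeAlgebra.unitIso.inv, h0]
    simp

namespace TubeAlgebra

/-- The endomorphism of `W` obtained from a morphism in `Mor(W ⊗ X_i, X_j ⊗ W)` by restricting
both `X_i` and `X_j` to `id`. -/
def compress (i j : Irr C) (W : C) : (W ⊗ i.rep ⟶ j.rep ⊗ W) →ₗ[ℂ] (W ⟶ W) where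
  toFun T := (ρ_ W).inv ≫ W ◁ i.unitHom ≫ T ≫ dag j.unitHom ▷ W ≫ (λ_ W).hom
  map_add' S T := by simp
  map_smul' c T := by simp

theorem compress_apply (i j : Irr C) (W : C) (T : W ⊗ i.rep ⟶ j.rep ⊗ W) :
    compress i j W T = (ρ_ W).inv ≫ W ◁ i.unitHom ≫ T ≫ dag j.unitHom ▷ W ≫ (λ_ W).hom := rfl

theorem compress_conj {i j : Irr C} {W W' : C} (f : W' ⟶ W) (g : W ⟶ W')
    (T : W ⊗ i.rep ⟶ j.rep ⊗ W) :
    compress i j W' (f ▷ i.rep ≫ T ≫ j.rep ◁ g) = f ≫ compress i j W T ≫ g := by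
  simp only [compress_apply, Category.assoc]
  rw [whisker_exchange_assoc, ← rightUnitor_inv_naturality_assoc, whisker_exchange_assoc,
    leftUnitor_naturality]

theorem compress_eq_zero_left {i j : Irr C} (h : i ≠ Irr.unit C) {W : C}
    (T : W ⊗ i.rep ⟶ j.rep ⊗ W) : compress i j W T = 0 := by
  simp [compress_apply, Irr.unitHom_of_ne h]

theorem compress_eq_zero_right {i j : Irr C} (h : j ≠ Irr.unit C) {W : C}
    (T : W ⊗ i.rep ⟶ j.rep ⊗ W) : compress i j W T = 0 := by
  simp [compress_apply, Irr.unitHom_of_ne h, dag_zero]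

/-- Closing the `m` strand around `x` leaves a morphism `θ` from `X_s` to the unit, which Schur's
lemma makes a multiple of the canonical one. The two factors are thereby decoupled; for `s ≠ 0` both
sides vanish. -/
theorem partialTrace_compress {i s j m l : Irr C} (x : TubeHom s j m) (y : TubeHom i s l) :
    partialTrace m.solR (compress i j (m.rep ⊗ l.rep) ((α_ _ _ _).hom ≫ m.rep ◁ y ≫
      (α_ _ _ _).inv ≫ x ▷ l.rep ≫ (α_ _ _ _).hom)) =
      (statDim m.rep * m.rep_simple.coeff (compress s j m.rep x) : ℂ) •
        compress i s l.rep y := by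
  let θ : s.rep ⟶ 𝟙_ C := (λ_ s.rep).inv ≫ m.solR ▷ s.rep ≫ (α_ _ _ _).hom ≫
    m.dual.rep ◁ (x ≫ dag j.unitHom ▷ m.rep ≫ (λ_ m.rep).hom) ≫ dag m.solR
  have h1 : s.unitHom ≫ θ =
      (statDim m.rep * m.rep_simple.coeff (compress s j m.rep x) : ℂ) • 𝟙 (𝟙_ C) := by
    rw [← solR_trace, compress_apply]
    calc _ = 𝟙 _ ⊗≫ ((𝟙_ C) ◁ s.unitHom ≫ m.solR ▷ s.rep) ⊗≫
          m.dual.rep ◁ (x ≫ dag j.unitHom ▷ m.rep ≫ (λ_ m.rep).hom) ≫ dag m.solR := by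
          dsimp only [θ]
          monoidal
      _ = _ := by
          rw [whisker_exchange]
          monoidal
  have h2 := s.eq_smul_dag_unitHom θ h1
  calc _ = 𝟙 _ ⊗≫ (m.solR ▷ l.rep ≫ (m.dual.rep ⊗ m.rep) ◁ ((ρ_ l.rep).inv ≫
          l.rep ◁ i.unitHom ≫ y)) ⊗≫
          m.dual.rep ◁ (x ≫ dag j.unitHom ▷ m.rep ≫ (λ_ m.rep).hom) ▷ l.rep ⊗≫
          dag m.solR ▷ l.rep ⊗≫ 𝟙 _ := by
        rw [partialTrace, compress_apply]
        monoidal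
    _ = (ρ_ l.rep).inv ≫ l.rep ◁ i.unitHom ≫ y ≫ θ ▷ l.rep ≫ (λ_ l.rep).hom := by
        rw [← whisker_exchange]
        dsimp only [θ]
        monoidal
    _ = _ := by
        rw [h2, compress_apply i s]
        simp

/-- The functional of the trivial representation. -/
def counit : TubeAlgebra C →ₗ[ℂ] ℂ :=
  lift fun t => (statDim t.2.2.rep : ℂ) • t.2.2.rep_simple.coeff ∘ₗ compress t.1 t.2.1 t.2.2.rep

theorem counit_of {i j k : Irr C} (x : TubeHom i j k) :
    counit (of i j k x) = statDim k.rep * k.rep_simple.coeff (compress i j k.rep x) :=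
  lift_of _ x

/-- The weighted sum over the components of `X_m ⊗ X_l` becomes, by `sum_trace_tensor`, a scalar of
a partial trace, and the partial trace splits. -/
theorem counit_of_mul_of {i s j l m : Irr C} (x : TubeHom s j m) (y : TubeHom i s l) :
    counit (of s j m x * of i s l y) = counit (of s j m x) * counit (of i s l y) := by
  rw [of_mul_of, mulHom_eq]
  let d := decomposition (m.rep ⊗ l.rep)
  change counit (∑ a, of i j (d.idx a) _) = _
  simp only [map_sum, counit_of, compress_conj]
  rw [sum_trace_tensor, partialTrace_compress, map_smul, smul_eq_mul]
  ring

theorem counit_of_mul_of' {i s' s j l m : Irr C} (x : TubeHom s j m) (y : TubeHom i s' l) :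
    counit (of s j m x * of i s' l y) = counit (of s j m x) * counit (of i s' l y) := by
  by_cases h : s' = s
  · subst h
    exact counit_of_mul_of x y
  · rw [of_mul_of_ne h, map_zero, counit_of, counit_of]
    -- At least one of the distinct labels `s`, `s'` is not the unit, and the factor carrying it
    -- compresses to zero.
    by_cases hs : s = Irr.unit C
    · rw [compress_eq_zero_right (fun h' => h (h'.trans hs.symm)) y]
      simp
    · rw [compress_eq_zero_left hs x]
      simp

theorem rotate_smul {A B X Xb : C} (R : 𝟙_ C ⟶ Xb ⊗ X) (Rb : 𝟙_ C ⟶ X ⊗ Xb) (c : ℂ)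
    (x : X ⊗ A ⟶ B ⊗ X) : rotate R Rb (c • x) = star c • rotate R Rb x := by
  simp [rotate, dag_smul]

/-- Restriction to the unit strands commutes with rotation, and rotating `c` times the canonical
morphism of `X_k` gives `c̄` times that of `X̄_k`. Since the dimensions agree, the values are
conjugate. -/
theorem counit_star_of {i j k : Irr C} (x : TubeHom i j k) :
    counit (star (of i j k x)) = star (counit (of i j k x)) := by
  rw [star_of, counit_of, counit_of, statDim_dual]
  obtain ⟨c, hc⟩ : ∃ c, k.rep_simple.coeff (compress i j k.rep x) = c := ⟨_, rfl⟩
  have h1 : k.rep ◁ i.unitHom ≫ x ≫ dag j.unitHom ▷ k.rep =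
      c • ((ρ_ k.rep).hom ≫ (λ_ k.rep).inv) := by
    have := k.rep_simple.eq_coeff_smul (compress i j k.rep x)
    rw [hc, compress_apply, Iso.inv_comp_eq, ← cancel_mono (λ_ k.rep).inv] at this
    simpa using this
  have h2 := congrArg (rotate k.solR k.solRb) h1
  rw [rotate_comp, rotate_smul, rotate_unitors k.sol_conj, dag_dag] at h2
  have h3 : compress j i k.dual.rep (rotate k.solR k.solRb x) = star c • 𝟙 _ := by
    rw [compress_apply]
    have : (ρ_ k.dual.rep).inv ≫ (k.dual.rep ◁ j.unitHom ≫ rotate k.solR k.solRb x ≫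
        dag i.unitHom ▷ k.dual.rep) ≫ (λ_ k.dual.rep).hom = star c • 𝟙 _ := by
      rw [h2]
      simp
    simpa using this
  rw [k.dual.rep_simple.coeff_eq_of_eq_smul h3, hc]
  simp

@[elab_as_elim]
theorem induction {p : TubeAlgebra C → Prop} (x : TubeAlgebra C) (zero : p 0)
    (add : ∀ x y, p x → p y → p (x + y)) (of : ∀ i j k (x : TubeHom i j k), p (of i j k x)) :
    p x := by
  classical
  exact DirectSum.induction_on (motive := p) x zero (fun t x => of t.1 t.2.1 t.2.2 x) add

theorem counit_mul (x y : TubeAlgebra C) : counit (x * y) = counit x * counit y := by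
  change counit (mulLin x y) = _
  induction x using TubeAlgebra.induction with
  | zero => simp
  | add x x' hx hx' => rw [map_add, LinearMap.add_apply, map_add, hx, hx', map_add, add_mul]
  | of s j m x =>
    induction y using TubeAlgebra.induction with
    | zero => simp
    | add y y' hy hy' => rw [map_add, map_add, hy, hy', map_add, mul_add]
    | of i s' l y => exact counit_of_mul_of' x y

theorem counit_star (x : TubeAlgebra C) : counit (star x) = star (counit x) := by
  classical
  let S : TubeAlgebra C →+ TubeAlgebra C :=
    DirectSum.toAddMonoid fun t : Irr C × Irr C × Irr C => starHom t.1 t.2.1 t.2.2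
  change counit (S x) = _
  induction x using TubeAlgebra.induction with
  | zero => simp
  | add x y hx hy => rw [map_add, map_add, hx, hy, map_add, star_add]
  | of i j k x => exact counit_star_of x

theorem compress_swapUnit (W : C) :
    compress (Irr.unit C) (Irr.unit C) W (swapUnit W) = 𝟙 W := by
  rw [compress_apply, Irr.unitHom_unit, dag_unitIso_inv, swapUnit]
  simp only [Category.assoc, ← MonoidalCategory.whiskerLeft_comp_assoc,
    ← comp_whiskerRight_assoc, Iso.inv_hom_id]
  simp

theorem counit_corner (f : FusionAlgebra C) : counit (corner f) = dimChar f := by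
  suffices h : counit ∘ₗ corner = dimChar (C := C) from LinearMap.congr_fun h f
  refine FusionAlgebra.linearMap_ext fun k => ?_
  rw [LinearMap.comp_apply, corner_basis, counit_of, compress_swapUnit, IsSimpleObj.coeff_id,
    dimChar_basis, mul_one]

/-- The two elements differ only in which of the two copies of `X_0` is contracted with the unit.
The choice is immaterial because the left and right unitors agree on the unit object. -/
theorem proj_unit : proj (Irr.unit C) = corner 1 := by
  change _ = corner (FusionAlgebra.basis _)
  rw [corner_basis, proj, swapUnit]
  let J : (Irr.unit C).rep ≅ 𝟙_ C := unitIso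
  have h1 : J.hom ▷ (Irr.unit C).rep ≫ (λ_ _).hom = (Irr.unit C).rep ◁ J.hom ≫ (ρ_ _).hom := by
    rw [← cancel_mono J.hom, Category.assoc, Category.assoc, ← leftUnitor_naturality,
      ← rightUnitor_naturality, ← whisker_exchange_assoc]
    congr 2
    monoidal
  have h2 : (ρ_ _).inv ≫ (Irr.unit C).rep ◁ J.inv = (λ_ _).inv ≫ J.inv ▷ (Irr.unit C).rep := by
    rw [← cancel_epi ((Irr.unit C).rep ◁ J.hom ≫ (ρ_ _).hom)]
    nth_rewrite 2 [← h1]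
    simp
  congr 1
  have h3 := congrArg₂ (· ≫ ·) h1 h2
  simpa only [Category.assoc] using h3

end TubeAlgebra

theorem dimChar_one : dimChar (1 : FusionAlgebra C) = 1 :=
  (dimChar_basis _).trans (by simp [statDim_unit])

/-- The trivial representation of the tube algebra. -/
def trivialTubeRep : TubeRep C ℂ where
  toLin := (LinearMap.toSpanSingleton ℂ (ℂ →L[ℂ] ℂ) 1) ∘ₗ TubeAlgebra.counit
  map_mul x y := by
    simp [TubeAlgebra.counit_mul, mul_smul, smul_comm (TubeAlgebra.counit x)]
  map_star x := by
    simp [TubeAlgebra.counit_star]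
  nondegenerate := by
    refine top_le_iff.1 (le_trans (fun c _ => Submodule.subset_span ?_)
      (Submodule.le_topologicalClosure _))
    refine ⟨TubeAlgebra.corner 1, c, ?_⟩
    simp [TubeAlgebra.counit_corner, dimChar_one]

variable (C) in
/-- The trivial representation of the fusion algebra. -/
def trivialRep : AdmissibleRep C where
  H := ℂ
  toLin := (LinearMap.toSpanSingleton ℂ (ℂ →L[ℂ] ℂ) 1) ∘ₗ dimChar
  map_one := by simp [dimChar_one]
  map_mul f g := by simp [dimChar_mul, mul_smul, smul_comm (dimChar f)]
  map_star f := by simp [dimChar_star]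
  admissible := by
    refine ⟨ℂ, inferInstance, inferInstance, inferInstance, trivialTubeRep,
      LinearIsometry.id, ?_, ?_⟩
    · rw [TubeAlgebra.proj_unit]
      simp [trivialTubeRep, TubeAlgebra.counit_corner, dimChar_one]
    · intro f ξ
      simp [trivialTubeRep, TubeAlgebra.counit_corner]

end
end RigidCStar
-- The universal C*-algebra and its spectrum
namespace RigidCStar
noncomputable section

variable {C : Type u} [Category.{v} C] [Preadditive C] [Linear ℂ C]
    [MonoidalCategory C] [MonoidalPreadditive C] [MonoidalLinear ℂ C]
    [RigidCStarTensorCategory C]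

/-- The universal admissible representation as a map into the product. -/
def productRep : FusionAlgebra C →ₗ[ℂ] AdmissibleProduct C where
  toFun f := ⟨fun π => π.toLin f, memℓp_infty (by
    obtain ⟨c, hc⟩ := AdmissibleRep.exists_norm_toLin_le f
    exact ⟨c, by rintro _ ⟨π, rfl⟩; exact hc π⟩)⟩
  map_add' f g := lp.ext (funext fun π => map_add π.toLin f g)
  map_smul' c f := lp.ext (funext fun π => map_smul π.toLin c f)

theorem productRep_mul (f g : FusionAlgebra C) :
    productRep (f * g) = productRep f * productRep g :=
  lp.ext (funext fun π => π.map_mul f g)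

theorem productRep_star (f : FusionAlgebra C) : productRep (star f) = star (productRep f) :=
  lp.ext (funext fun π => π.map_star f)

theorem productRep_one : productRep (1 : FusionAlgebra C) = 1 :=
  lp.ext (funext fun π => π.map_one)

variable (C) in
/-- The image of the fusion algebra under the universal admissible representation. -/
def productRepRange : StarSubalgebra ℂ (AdmissibleProduct C) where
  carrier := Set.range productRep
  mul_mem' := by
    rintro _ _ ⟨f, rfl⟩ ⟨g, rfl⟩
    exact ⟨f * g, productRep_mul f g⟩
  add_mem' := by
    rintro _ _ ⟨f, rfl⟩ ⟨g, rfl⟩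
    exact ⟨f + g, map_add _ f g⟩
  algebraMap_mem' c := ⟨c • 1, by
    rw [map_smul, productRep_one, Algebra.algebraMap_eq_smul_one]⟩
  star_mem' := by
    rintro _ ⟨f, rfl⟩
    exact ⟨star f, productRep_star f⟩

theorem productRep_mem (f : FusionAlgebra C) : productRep f ∈ universalSubalgebra C :=
  StarSubalgebra.le_topologicalClosure _ (StarAlgebra.subset_adjoin _ _ ⟨f, fun _ => rfl⟩)

variable (C) in
/-- The universal admissible representation. -/
def universalRep : FusionAlgebra C →ₗ[ℂ] UniversalCStar C where
  toFun f := (⟨productRep f, productRep_mem f⟩ : universalSubalgebra C)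
  map_add' f g := Subtype.ext (map_add productRep f g)
  map_smul' c f := Subtype.ext (map_smul productRep c f)

namespace UniversalCStar

theorem universalRep_apply (f : FusionAlgebra C) (π : AdmissibleRep C) :
    (universalRep C f).apply π = π.toLin f := rfl

theorem universalRep_mul (f g : FusionAlgebra C) :
    universalRep C (f * g) = universalRep C f * universalRep C g :=
  Subtype.ext (productRep_mul f g)

theorem ext {a b : UniversalCStar C} (h : ∀ π, a.apply π = b.apply π) : a = b :=
  Subtype.ext (lp.ext (funext h))

theorem norm_apply_le (a : UniversalCStar C) (π : AdmissibleRep C) : ‖a.apply π‖ ≤ ‖a‖ :=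
  lp.norm_apply_le_norm ENNReal.top_ne_zero (a.1 : AdmissibleProduct C) π

theorem norm_apply_apply_le (a : UniversalCStar C) (π : AdmissibleRep C) (ξ : π.H) :
    ‖a.apply π ξ‖ ≤ ‖a‖ * ‖ξ‖ :=
  (a.apply π).le_of_opNorm_le (a.norm_apply_le π) ξ

variable (C) in
-- The image of the fusion algebra is already a unital `*`-subalgebra, so the adjunction in the
-- definition adds nothing before the closure is taken.
theorem denseRange_universalRep : DenseRange (universalRep C) := by
  refine Metric.dense_iff.2 fun a r hr => ?_
  have h1 : (a.1 : AdmissibleProduct C) ∈ closure (Set.range (productRep (C := C))) := by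
    refine closure_mono ?_ a.2
    refine (StarAlgebra.adjoin_le (S := productRepRange C) ?_ :)
    rintro b ⟨f, hf⟩
    exact ⟨f, lp.ext (funext fun π => (hf π).symm)⟩
  obtain ⟨_, ⟨f, rfl⟩, hf⟩ := Metric.mem_closure_iff.1 h1 r hr
  refine ⟨universalRep C f, ?_, f, rfl⟩
  rw [Metric.mem_ball, dist_comm]
  exact hf

theorem mul_comm_of_commute (hC : ∀ x y : FusionAlgebra C, x * y = y * x)
    (a b : UniversalCStar C) : a * b = b * a := by
  refine (denseRange_universalRep C).induction_on₂
    (p := fun a b : UniversalCStar C => a * b = b * a) ?_ (fun f g => ?_) a b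
  · exact isClosed_eq (continuous_fst.mul continuous_snd) (continuous_snd.mul continuous_fst)
  · rw [← universalRep_mul, ← universalRep_mul, hC]

/-- Gelfand duality for the universal C*-algebra of a commutative fusion algebra. -/
theorem exists_compactHausdorff (hC : ∀ x y : FusionAlgebra C, x * y = y * x) :
    ∃ (Z : Type (max 1 u)) (_ : TopologicalSpace Z) (_ : CompactSpace Z) (_ : T2Space Z),
      Nonempty (UniversalCStar C ≃⋆ₐ[ℂ] C(Z, ℂ)) :=
  letI : CommCStarAlgebra (UniversalCStar C) :=
    { (inferInstance : CStarAlgebra (UniversalCStar C)) with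
      mul_comm := mul_comm_of_commute hC }
  ⟨WeakDual.characterSpace ℂ (UniversalCStar C), inferInstance, inferInstance, inferInstance,
    ⟨gelfandStarTransform (UniversalCStar C)⟩⟩

variable (C) in
/-- The character of the trivial representation. -/
def trivialChar : UniversalCStar C →ₐ[ℂ] ℂ where
  toFun a := (show ℂ →L[ℂ] ℂ from a.apply (trivialRep C)) 1
  map_one' := rfl
  map_zero' := rfl
  map_add' _ _ := rfl
  map_mul' a b := by
    change (show ℂ →L[ℂ] ℂ from a.apply (trivialRep C))
      ((show ℂ →L[ℂ] ℂ from b.apply (trivialRep C)) 1) = _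
    have h : ∀ (T : ℂ →L[ℂ] ℂ) (c : ℂ), T c = T 1 * c := fun T c => by
      rw [mul_comm, ← smul_eq_mul, ← map_smul, smul_eq_mul, mul_one]
    exact h _ _
  commutes' c := by
    change c * 1 = c
    exact mul_one c

theorem trivialChar_universalRep (f : FusionAlgebra C) :
    trivialChar C (universalRep C f) = dimChar f := by
  change dimChar f * 1 = dimChar f
  exact mul_one _

theorem norm_trivialChar_le (a : UniversalCStar C) : ‖trivialChar C a‖ ≤ ‖a‖ := by
  have h := a.norm_apply_apply_le (trivialRep C) (1 : ℂ)
  refine h.trans ?_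
  have : ‖(show (trivialRep C).H from (1 : ℂ))‖ = 1 := norm_one (α := ℂ)
  rw [this, mul_one]

theorem continuous_trivialChar : Continuous (trivialChar C) :=
  AddMonoidHomClass.continuous_of_bound (trivialChar C) 1 fun a =>
    (norm_trivialChar_le a).trans_eq (one_mul _).symm

/-- Continuous maps on `C*(C)` that agree on the fusion algebra are equal. -/
theorem eq_of_eqOn {M : Type*} [TopologicalSpace M] [T2Space M] {S T : UniversalCStar C → M}
    (hS : Continuous S) (hT : Continuous T)
    (h : ∀ f, S (universalRep C f) = T (universalRep C f)) : S = T :=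
  (denseRange_universalRep C).equalizer hS hT (funext h)

section Spectrum
variable {Z : Type w} [TopologicalSpace Z] [CompactSpace Z] [T2Space Z]
  (e : UniversalCStar C ≃⋆ₐ[ℂ] C(Z, ℂ))

theorem continuous_eval (z : Z) : Continuous fun a => e a z :=
  (continuous_eval_const z).comp (StarAlgEquiv.isometry e).continuous

/-- Every character of `C(Z)` is a point evaluation; this applies to the trivial character
transported along `e`. -/
theorem exists_eval_eq_trivialChar : ∃ z₀ : Z, ∀ a, e a z₀ = trivialChar C a := by
  let χ : WeakDual.characterSpace ℂ C(Z, ℂ) := WeakDual.CharacterSpace.equivAlgHom.symm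
    ((trivialChar C).comp (e.symm.toAlgEquiv : C(Z, ℂ) →ₐ[ℂ] UniversalCStar C))
  obtain ⟨z₀, hz₀⟩ := (WeakDual.CharacterSpace.continuousMapEval_bijective Z ℂ).surjective χ
  refine ⟨z₀, fun a => ?_⟩
  have h1 := congrArg (fun ψ : WeakDual.characterSpace ℂ C(Z, ℂ) => ψ (e a)) hz₀
  have h2 : χ (e a) = trivialChar C (e.symm (e a)) := rfl
  rw [e.symm_apply_apply] at h2
  exact h1.trans h2

theorem eval_eq_trivialChar_of_basis {z : Z}
    (hz : ∀ k : Irr C, e (universalRep C (FusionAlgebra.basis k)) z = statDim k.rep)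
    (a : UniversalCStar C) : e a z = trivialChar C a := by
  refine congrFun (eq_of_eqOn (continuous_eval e z) continuous_trivialChar fun f => ?_) a
  rw [trivialChar_universalRep]
  induction f using FusionAlgebra.induction with
  | zero => simp
  | add f g hf hg => simp only [map_add, ContinuousMap.add_apply, hf, hg]
  | smul_basis c k => simp only [map_smul, ContinuousMap.smul_apply, hz, dimChar_basis]

/-- The values on the basis determine an evaluation on the dense image of the fusion algebra, hence
everywhere, and evaluations separate the points of `Z`. -/
theorem eval_basis_iff {z₀ : Z} (hz₀ : ∀ a, e a z₀ = trivialChar C a) (z : Z) :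
    (∀ k : Irr C, e (universalRep C (FusionAlgebra.basis k)) z = statDim k.rep) ↔ z = z₀ := by
  constructor
  · intro hz
    refine (WeakDual.CharacterSpace.continuousMapEval_bijective Z ℂ).injective ?_
    refine WeakDual.CharacterSpace.ext fun g => ?_
    obtain ⟨a, rfl⟩ := e.surjective g
    exact (eval_eq_trivialChar_of_basis e hz a).trans (hz₀ a).symm
  · rintro rfl k
    rw [hz₀, trivialChar_universalRep, dimChar_basis]

end Spectrum
end UniversalCStar
end
end RigidCStar
-- Analytic tools: fixed vectors and bump functions
namespace RigidCStar
noncomputable section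

/-- The element of minimal norm in the closed convex hull of the orbit of a vector under a family of
contractions that is closed under products up to convex combinations is a fixed vector. -/
theorem exists_fixed_vector {H : Type*} [NormedAddCommGroup H] [InnerProductSpace ℂ H]
    [CompleteSpace H] {κ : Type*} [Nonempty κ] (T : κ → H →L[ℂ] H) (hT : ∀ k, ‖T k‖ ≤ 1) (ξ : H)
    (hmul : ∀ j k, T j (T k ξ) ∈ convexHull ℝ (Set.range fun k => T k ξ)) :
    ∃ v ∈ closure (convexHull ℝ (Set.range fun k => T k ξ)), ∀ k, T k v = v := by
  let _ : InnerProductSpace ℝ H := InnerProductSpace.rclikeToReal ℂ H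
  set K := closure (convexHull ℝ (Set.range fun k => T k ξ)) with hK
  have hconv : Convex ℝ K := (convex_convexHull ℝ _).closure
  have hne : K.Nonempty := by
    obtain ⟨k⟩ := ‹Nonempty κ›
    exact ⟨T k ξ, subset_closure (subset_convexHull ℝ _ ⟨k, rfl⟩)⟩
  have hinv : ∀ j, ∀ w ∈ K, T j w ∈ K := by
    intro j w hw
    have h1 : Set.MapsTo (T j) (convexHull ℝ (Set.range fun k => T k ξ))
        (convexHull ℝ (Set.range fun k => T k ξ)) := by
      have h2 : convexHull ℝ (Set.range fun k => T k ξ) ⊆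
          ((T j).restrictScalars ℝ : H →ₗ[ℝ] H) ⁻¹'
            (convexHull ℝ (Set.range fun k => T k ξ)) := by
        refine convexHull_min ?_ ((convex_convexHull ℝ _).linear_preimage _)
        rintro _ ⟨k, rfl⟩
        exact hmul j k
      exact h2
    exact h1.closure (T j).continuous hw
  obtain ⟨v, hv, hmin⟩ := exists_norm_eq_iInf_of_complete_convex hne
    isClosed_closure.isComplete hconv (0 : H)
  -- The variational inequality reads `⟨v, w - v⟩ ≥ 0` for `w` in the hull. With `w = T j v` and `‖T
  -- j v‖ ≤ ‖v‖` it gives `‖T j v - v‖² ≤ 0`.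
  rw [norm_eq_iInf_iff_real_inner_le_zero hconv hv] at hmin
  refine ⟨v, hv, fun j => ?_⟩
  have h1 := hmin _ (hinv j v hv)
  have h2 : ‖T j v‖ ≤ ‖v‖ := by simpa using (T j).le_of_opNorm_le (hT j) v
  rw [zero_sub, inner_neg_left, inner_sub_right, real_inner_self_eq_norm_sq] at h1
  have h3 : ‖T j v - v‖ ^ 2 ≤ 0 := by
    rw [norm_sub_sq_real, real_inner_comm]
    nlinarith [norm_nonneg (T j v), norm_nonneg v]
  exact sub_eq_zero.1 (norm_eq_zero.1 (pow_eq_zero_iff two_ne_zero |>.1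
    (le_antisymm h3 (sq_nonneg _))))

/-- A complex-valued form of Urysohn's lemma. -/
theorem exists_continuous_complex_zero_one {Z : Type*} [TopologicalSpace Z] [NormalSpace Z]
    {s t : Set Z} (hs : IsClosed s) (ht : IsClosed t) (hst : Disjoint s t) :
    ∃ f : C(Z, ℂ), (∀ z ∈ s, f z = 0) ∧ (∀ z ∈ t, f z = 1) ∧ ∀ z, ‖f z‖ ≤ 1 := by
  obtain ⟨f, h0, h1, h⟩ := exists_continuous_zero_one_of_isClosed hs ht hst
  refine ⟨⟨fun z => (f z : ℂ), by fun_prop⟩, fun z hz => ?_, fun z hz => ?_, fun z => ?_⟩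
  · simp [h0 hz]
  · simp [h1 hz]
  · simpa [abs_of_nonneg (h z).1] using (h z).2

/-- A bump function `g` at `z₁ ∈ U`, a function `r` supported in `U` with `r g = g`, and a function
`h` with `h z₀ = 1` and `h g = 0`. -/
theorem exists_bump {Z : Type*} [TopologicalSpace Z] [NormalSpace Z] [T1Space Z] {U : Set Z}
    (hU : IsOpen U) {z₀ z₁ : Z} (h1 : z₁ ∈ U) (h0 : z₁ ≠ z₀) :
    ∃ g r h : C(Z, ℂ), g ≠ 0 ∧ r * g = g ∧ h * g = 0 ∧ h z₀ = 1 ∧ (∀ z ∉ U, r z = 0) ∧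
      ∀ z, ‖r z‖ ≤ 1 := by
  -- The closure of `V` stays in `U` and avoids `z₀`: `g` is supported in `V`, while on that closure
  -- `r` is `1` and `h` is `0`.
  obtain ⟨V, hV, hzV, hVU⟩ := normal_exists_closure_subset (isClosed_singleton (x := z₁))
    (hU.inter (isOpen_compl_singleton (x := z₀)))
    (Set.singleton_subset_iff.2 ⟨h1, by simpa using h0⟩)
  obtain ⟨g, hg0, hg1, -⟩ := exists_continuous_complex_zero_one hV.isClosed_compl
    (isClosed_singleton (x := z₁)) (Set.disjoint_left.2 fun z hz hz' => hz (hzV hz'))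
  obtain ⟨r, hr0, hr1, hr⟩ := exists_continuous_complex_zero_one hU.isClosed_compl
    (isClosed_closure (s := V)) (Set.disjoint_left.2 fun z hz hz' => hz (hVU hz').1)
  obtain ⟨h, hh0, hh1, -⟩ := exists_continuous_complex_zero_one (isClosed_closure (s := V))
    (isClosed_singleton (x := z₀)) (Set.disjoint_left.2 fun z hz hz' => (hVU hz).2 hz')
  refine ⟨g, r, h, fun hg => ?_, ?_, ?_, hh1 z₀ rfl, fun z hz => hr0 z hz, hr⟩
  · have := hg1 z₁ rfl
    simp [hg] at this
  · ext z
    by_cases hz : z ∈ V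
    · simp [hr1 z (subset_closure hz)]
    · simp [hg0 z hz]
  · ext z
    by_cases hz : z ∈ V
    · simp [hh0 z (subset_closure hz)]
    · simp [hg0 z hz]

end
end RigidCStar
-- Property (T) and isolation of the trivial representation
namespace RigidCStar
noncomputable section

open Filter Topology

variable {C : Type u} [Category.{v} C] [Preadditive C] [Linear ℂ C]
    [MonoidalCategory C] [MonoidalPreadditive C] [MonoidalLinear ℂ C]
    [RigidCStarTensorCategory C]

theorem multiplierFunctional_basis (φ : Irr C → ℂ) (k : Irr C) :
    multiplierFunctional φ (FusionAlgebra.basis k) = statDim k.rep * φ k := by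
  unfold multiplierFunctional FusionAlgebra.basis
  erw [Finsupp.lsum_single]
  simp

theorem norm_inner_apply_le {H : Type*} [NormedAddCommGroup H] [InnerProductSpace ℂ H] {ξ : H}
    (hξ : ‖ξ‖ = 1) {T : H →L[ℂ] H} {r : ℝ} (hT : ‖T‖ ≤ r) : ‖inner ℂ ξ (T ξ)‖ ≤ r := by
  have h1 := norm_inner_le_norm (𝕜 := ℂ) ξ (T ξ)
  have h2 := T.le_of_opNorm_le hT ξ
  rw [hξ] at h1 h2
  linarith

theorem AdmissibleRep.norm_basis_sub_apply_le (π : AdmissibleRep C) (k : Irr C) (η : π.H) :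
    ‖π.toLin (FusionAlgebra.basis k) η - (statDim k.rep : ℂ) • η‖ ≤ 2 * statDim k.rep * ‖η‖ := by
  refine (norm_sub_le _ _).trans ?_
  have h1 := (π.toLin (FusionAlgebra.basis k)).le_of_opNorm_le (π.norm_basis_le k) η
  rw [norm_smul, Complex.norm_real, Real.norm_of_nonneg (statDim_pos k).le]
  linarith

/-- Vector states and the trivial character are contractive, so convergence on the dense image
extends to its closure. This matters because the spectral projection need not come from the fusion
algebra. -/
theorem tendsto_vectorState {π : ℕ → AdmissibleRep C} {ξ : ∀ n, (π n).H} (hξ : ∀ n, ‖ξ n‖ = 1)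
    (h : ∀ k, Tendsto (fun n => inner ℂ (ξ n) ((π n).toLin (FusionAlgebra.basis k) (ξ n))) atTop
      (𝓝 (statDim k.rep : ℂ))) (a : UniversalCStar C) :
    Tendsto (fun n => inner ℂ (ξ n) (a.apply (π n) (ξ n))) atTop
      (𝓝 (UniversalCStar.trivialChar C a)) := by
  have h1 : ∀ f, Tendsto (fun n => inner ℂ (ξ n) ((π n).toLin f (ξ n))) atTop
      (𝓝 (dimChar f)) := by
    intro f
    induction f using FusionAlgebra.induction with
    | zero => simp
    | add f g hf hg =>
      simp only [map_add, add_apply, inner_add_right]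
      exact hf.add hg
    | smul_basis c k =>
      simp only [map_smul, smul_apply, inner_smul_right, dimChar_basis]
      exact (h k).const_mul c
  rw [Metric.tendsto_atTop]
  intro ε hε
  obtain ⟨f, hf⟩ := (UniversalCStar.denseRange_universalRep C).exists_dist_lt a
    (show 0 < ε / 3 by positivity)
  rw [dist_eq_norm] at hf
  obtain ⟨N, hN⟩ := Metric.tendsto_atTop.1 (h1 f) (ε / 3) (by positivity)
  refine ⟨N, fun n hn => ?_⟩
  have h2 : ‖inner ℂ (ξ n) (a.apply (π n) (ξ n)) - inner ℂ (ξ n) ((π n).toLin f (ξ n))‖ ≤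
      ‖a - universalRep C f‖ := by
    rw [← inner_sub_right]
    exact norm_inner_apply_le (hξ n) ((a - universalRep C f).norm_apply_le (π n))
  have h3 : ‖UniversalCStar.trivialChar C a - dimChar f‖ ≤ ‖a - universalRep C f‖ := by
    rw [← UniversalCStar.trivialChar_universalRep, ← map_sub]
    exact UniversalCStar.norm_trivialChar_le _
  have h4 := hN n hn
  rw [dist_eq_norm] at h4 ⊢
  calc _ = ‖(inner ℂ (ξ n) (a.apply (π n) (ξ n)) - inner ℂ (ξ n) ((π n).toLin f (ξ n))) +
        (inner ℂ (ξ n) ((π n).toLin f (ξ n)) - dimChar f) -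
        (UniversalCStar.trivialChar C a - dimChar f)‖ := by congr 1; ring
    _ ≤ _ := (norm_sub_le _ _).trans (add_le_add_left (norm_add_le _ _) _)
    _ < ε := by linarith

theorem norm_sub_projection_sq {H : Type*} [NormedAddCommGroup H] [InnerProductSpace ℂ H]
    [CompleteSpace H] {P : H →L[ℂ] H} (hP : P * P = P) (hPs : star P = P) {ξ : H} (hξ : ‖ξ‖ = 1) :
    ‖ξ - P ξ‖ ^ 2 = 1 - (inner ℂ ξ (P ξ)).re := by
  have h1 : inner ℂ (P ξ) (P ξ) = inner ℂ ξ (P ξ) := by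
    conv_rhs => rw [← hP]
    rw [mul_apply_eq_comp]
    conv_rhs => rw [← hPs, ContinuousLinearMap.star_eq_adjoint,
      ContinuousLinearMap.adjoint_inner_right]
    simp only [← ContinuousLinearMap.star_eq_adjoint, hPs]
  have h2 := norm_sub_sq (𝕜 := ℂ) ξ (P ξ)
  have h3 : ‖P ξ‖ ^ 2 = (inner ℂ ξ (P ξ)).re := by
    rw [← h1]
    exact norm_sq_eq_re_inner (𝕜 := ℂ) (P ξ)
  rw [h2, hξ, h3]
  simp
  ring

section Spectrum
variable {Z : Type w} [TopologicalSpace Z] [CompactSpace Z] [T2Space Z]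
  (e : UniversalCStar C ≃⋆ₐ[ℂ] C(Z, ℂ))

/-- The spectral projection of an isolated trivial representation. -/
theorem exists_trivial_projection {z₀ : Z}
    (hz₀ : ∀ a, e a z₀ = UniversalCStar.trivialChar C a) (ho : IsOpen {z₀}) :
    ∃ P : UniversalCStar C, P * P = P ∧ star P = P ∧ UniversalCStar.trivialChar C P = 1 ∧
      ∀ k : Irr C, universalRep C (FusionAlgebra.basis k) * P = (statDim k.rep : ℂ) • P := by
  classical
  let g : C(Z, ℂ) := ⟨Set.indicator {z₀} 1,
    (IsClopen.continuous_indicator ⟨isClosed_singleton, ho⟩ continuous_one)⟩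
  have hg : ∀ z, g z = if z = z₀ then 1 else 0 := fun z => by
    simp [g, Pi.single_apply]
  refine ⟨e.symm g, EquivLike.injective e ?_, EquivLike.injective e ?_, ?_,
    fun k => EquivLike.injective e ?_⟩
  · rw [map_mul, e.apply_symm_apply]
    ext z
    simp [hg]
  · rw [map_star, e.apply_symm_apply]
    ext z
    rw [ContinuousMap.star_apply, hg]
    split_ifs <;> simp
  · rw [← hz₀, e.apply_symm_apply, hg, if_pos rfl]
  · rw [map_mul, map_smul, e.apply_symm_apply]
    ext z
    rw [ContinuousMap.mul_apply, ContinuousMap.smul_apply, hg]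
    split_ifs with h
    · rw [h, hz₀, UniversalCStar.trivialChar_universalRep, dimChar_basis, smul_eq_mul]
    · simp

/-- The projection attached to the isolated point controls all `k` simultaneously: closeness of `ξ
n` to its range is a single number, and it bounds every `|φ n k - 1|`. -/
theorem propertyT_of_isOpen {z₀ : Z} (hz₀ : ∀ a, e a z₀ = UniversalCStar.trivialChar C a)
    (ho : IsOpen {z₀}) : PropertyT C := by
  obtain ⟨P, hPP, hPs, hP1, hkP⟩ := exists_trivial_projection e hz₀ ho
  intro φ hφ hlim
  choose π ξ hξ hΦ using hφ
  have hbasis : ∀ n k, inner ℂ (ξ n) ((π n).toLin (FusionAlgebra.basis k) (ξ n)) =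
      statDim k.rep * φ n k := fun n k => by
    rw [← hΦ, multiplierFunctional_basis]
  have h1 := tendsto_vectorState hξ (fun k => by
    simp only [hbasis]
    simpa using (hlim k).const_mul (statDim k.rep : ℂ)) P
  rw [hP1] at h1
  have h2 : Tendsto (fun n => 2 * ‖ξ n - P.apply (π n) (ξ n)‖) atTop (𝓝 0) := by
    have h3 : ∀ n, ‖ξ n - P.apply (π n) (ξ n)‖ =
        √(1 - (inner ℂ (ξ n) (P.apply (π n) (ξ n))).re) := fun n => by
      rw [← norm_sub_projection_sq _ _ (hξ n), Real.sqrt_sq (norm_nonneg _)]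
      · exact congrArg (fun a : UniversalCStar C => a.apply (π n)) hPP
      · exact congrArg (fun a : UniversalCStar C => a.apply (π n)) hPs
    simp only [h3]
    have h4 := ((Complex.continuous_re.tendsto _).comp h1).const_sub 1
    have h5 := ((Real.continuous_sqrt.tendsto _).comp h4).const_mul 2
    simpa using h5
  rw [Metric.tendstoUniformly_iff]
  intro ε hε
  filter_upwards [h2.eventually_lt_const hε] with n hn k
  refine lt_of_le_of_lt ?_ hn
  have hd := statDim_pos k
  have h6 : (π n).toLin (FusionAlgebra.basis k) (P.apply (π n) (ξ n)) =
      (statDim k.rep : ℂ) • P.apply (π n) (ξ n) :=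
    congrArg (fun a : UniversalCStar C => a.apply (π n) (ξ n)) (hkP k)
  have h7 := (π n).norm_basis_sub_apply_le k (ξ n - P.apply (π n) (ξ n))
  -- Since `[X_k] - d(X_k)` kills `P ξ`, the bound for `ξ - P ξ` is a bound for `ξ`. Its factor
  -- `d(X_k)` later cancels, which is why the estimate is uniform in `k`.
  rw [map_sub, h6, smul_sub, sub_sub_sub_cancel_right] at h7
  have h8 := norm_inner_le_norm (𝕜 := ℂ) (ξ n)
    ((π n).toLin (FusionAlgebra.basis k) (ξ n) - (statDim k.rep : ℂ) • ξ n)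
  rw [inner_sub_right, hbasis, inner_smul_right, inner_self_eq_norm_sq_to_K, hξ, one_mul] at h8
  have h9 : (statDim k.rep : ℂ) * φ n k - statDim k.rep * ((1 : ℝ) : ℂ) ^ 2 =
      statDim k.rep * (φ n k - 1) := by
    push_cast
    ring
  have h10 : statDim k.rep * ‖φ n k - 1‖ ≤
      statDim k.rep * (2 * ‖ξ n - P.apply (π n) (ξ n)‖) := by
    calc _ = ‖(statDim k.rep : ℂ) * (φ n k - 1)‖ := by
          rw [norm_mul, Complex.norm_real, Real.norm_of_nonneg hd.le]
      _ ≤ _ := by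
          rw [← h9]
          refine h8.trans (h7.trans_eq ?_)
          ring
  rw [dist_comm, dist_eq_norm]
  exact le_of_mul_le_mul_left h10 hd

/-- A nearly invariant unit vector whose spectral measure does not charge the trivial
representation. -/
theorem exists_almost_invariant {z₀ : Z} (hz₀ : ∀ a, e a z₀ = UniversalCStar.trivialChar C a)
    (ho : ¬ IsOpen {z₀}) (s : Finset (Irr C)) {δ : ℝ} (hδ : 0 < δ) :
    ∃ (π : AdmissibleRep C) (ξ : π.H) (a : UniversalCStar C), ‖ξ‖ = 1 ∧
      (∀ k ∈ s, ‖π.toLin (FusionAlgebra.basis k) ξ - (statDim k.rep : ℂ) • ξ‖ ≤ δ) ∧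
      (∀ f, a.apply π (π.toLin f ξ) = 0) ∧ UniversalCStar.trivialChar C a = 1 := by
  let F : Irr C → C(Z, ℂ) := fun k =>
    e (universalRep C (FusionAlgebra.basis k)) - algebraMap ℂ _ (statDim k.rep : ℂ)
  have hF : ∀ k z, F k z = e (universalRep C (FusionAlgebra.basis k)) z - statDim k.rep :=
    fun k z => by simp [F]
  -- On this neighbourhood of `z₀` each `[X_k]` with `k ∈ s` is within `δ` of `d(X_k)`; as `z₀` is
  -- not isolated, `U` contains another point.
  let U : Set Z := ⋂ k ∈ s, {z | ‖F k z‖ < δ}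
  have hU : IsOpen U := isOpen_biInter_finset fun k _ =>
    isOpen_lt (by fun_prop) continuous_const
  have hz₀U : z₀ ∈ U := Set.mem_iInter₂.2 fun k _ => by
    simpa [hF, hz₀, UniversalCStar.trivialChar_universalRep, dimChar_basis] using hδ
  obtain ⟨z₁, hz₁, hne⟩ : ∃ z ∈ U, z ≠ z₀ := by
    by_contra! hall
    refine ho ?_
    have : {z₀} = U := Set.Subset.antisymm (Set.singleton_subset_iff.2 hz₀U) hall
    rwa [this]
  obtain ⟨g, r, h, hg, hrg, hhg, hh, hrU, hr⟩ := exists_bump hU hz₁ hne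
  have ha : e.symm g ≠ 0 := fun h0 => hg (by rw [← e.apply_symm_apply g, h0, map_zero])
  obtain ⟨π, hπ⟩ : ∃ π : AdmissibleRep C, (e.symm g).apply π ≠ 0 := by
    by_contra! hall
    exact ha (UniversalCStar.ext hall)
  obtain ⟨η, hη⟩ : ∃ η, (e.symm g).apply π η ≠ 0 := by
    by_contra! hall
    exact hπ (ContinuousLinearMap.ext hall)
  set ζ := (e.symm g).apply π η with hζ
  have hrζ : (e.symm r).apply π ζ = ζ := by
    have h1 : e.symm r * e.symm g = e.symm g := by rw [← map_mul, hrg]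
    exact congrArg (fun a : UniversalCStar C => a.apply π η) h1
  -- Commutativity of `C(Z)` brings `h` next to `g` past `f`, so `h` kills the whole orbit of `ζ`.
  have hhζ : ∀ f, (e.symm h).apply π (π.toLin f ζ) = 0 := fun f => by
    have h1 : e.symm h * universalRep C f * e.symm g = 0 := by
      apply EquivLike.injective e
      rw [map_mul, map_mul, e.apply_symm_apply, e.apply_symm_apply, map_zero,
        mul_right_comm, hhg, zero_mul]
    exact congrArg (fun a : UniversalCStar C => a.apply π η) h1
  have hζn : (‖ζ‖ : ℂ) ≠ 0 := by simpa using hη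
  refine ⟨π, (‖ζ‖ : ℂ)⁻¹ • ζ, e.symm h, ?_, fun k hk => ?_, fun f => ?_, ?_⟩
  · rw [norm_smul, norm_inv, Complex.norm_real, norm_norm,
      inv_mul_cancel₀ (by exact_mod_cast hζn)]
  · have h1 : ‖(e.symm (F k * r)).apply π ζ‖ ≤ δ * ‖ζ‖ := by
      refine ((e.symm (F k * r)).norm_apply_apply_le π ζ).trans
        (mul_le_mul_of_nonneg_right ?_ (norm_nonneg _))
      rw [StarAlgEquiv.norm_map e.symm, ContinuousMap.norm_le _ hδ.le]
      intro z
      rw [ContinuousMap.mul_apply, norm_mul]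
      by_cases hz : z ∈ U
      · have h2 : ‖F k z‖ < δ := Set.mem_iInter₂.1 hz k hk
        nlinarith [hr z, norm_nonneg (F k z), norm_nonneg (r z)]
      · rw [hrU z hz, norm_zero, mul_zero]
        exact hδ.le
    -- Because `r` fixes `ζ`, the operator `[X_k] - d(X_k)` acts on `ζ` as `F k * r`, whose sup norm
    -- is at most `δ` although that of `F k` need not be.
    have h2 : e.symm (F k * r) = (universalRep C (FusionAlgebra.basis k) -
        (statDim k.rep : ℂ) • 1) * e.symm r := by
      have h4 : F k = e (universalRep C (FusionAlgebra.basis k) - (statDim k.rep : ℂ) • 1) := by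
        rw [map_sub, map_smul, map_one, ← Algebra.algebraMap_eq_smul_one]
      rw [map_mul, h4, e.symm_apply_apply]
    have h3 : (e.symm (F k * r)).apply π ζ =
        π.toLin (FusionAlgebra.basis k) ζ - (statDim k.rep : ℂ) • ζ := by
      rw [h2]
      conv_rhs => rw [← hrζ]
      rfl
    rw [h3] at h1
    rw [map_smul, smul_comm (statDim k.rep : ℂ), ← smul_sub, norm_smul, norm_inv,
      Complex.norm_real, norm_norm]
    have h4 : 0 < ‖ζ‖ := norm_pos_iff.2 hη
    rw [inv_mul_le_iff₀ h4]
    linarith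
  · rw [map_smul, map_smul, hhζ, smul_zero]
  · rw [← hz₀, e.apply_symm_apply, hh]

end Spectrum

/-- The closed convex hull of the normalised orbit of a vector contains a vector on which the fusion
algebra acts by the trivial representation. -/
theorem AdmissibleRep.exists_invariant_vector (π : AdmissibleRep C) (ξ : π.H) :
    ∃ v ∈ closure (convexHull ℝ (Set.range fun k : Irr C =>
      (statDim k.rep : ℂ)⁻¹ • π.toLin (FusionAlgebra.basis k) ξ)),
      ∀ k : Irr C, π.toLin (FusionAlgebra.basis k) v = (statDim k.rep : ℂ) • v := by
  have : Nonempty (Irr C) := ⟨Irr.unit C⟩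
  have hd : ∀ k : Irr C, (statDim k.rep : ℂ) ≠ 0 := fun k => by exact_mod_cast (statDim_pos k).ne'
  obtain ⟨v, hv, hfix⟩ := exists_fixed_vector
    (fun k : Irr C => (statDim k.rep : ℂ)⁻¹ • π.toLin (FusionAlgebra.basis k)) (fun k => by
      rw [norm_smul, norm_inv, Complex.norm_real, Real.norm_of_nonneg (statDim_pos k).le,
        inv_mul_le_iff₀ (statDim_pos k), mul_one]
      exact π.norm_basis_le k) ξ (fun j k => by
      let d := decomposition (j.rep ⊗ k.rep)
      have h1 : π.toLin (FusionAlgebra.basis j) (π.toLin (FusionAlgebra.basis k) ξ) =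
          ∑ a, π.toLin (FusionAlgebra.basis (d.idx a)) ξ := by
        rw [← mul_apply_eq_comp, ← π.map_mul, FusionAlgebra.basis_mul_basis,
          FusionAlgebra.basisMul_eq_sum j k d, map_sum, sum_apply]
      -- After normalisation the fusion rules become convex combinations, with weights `d(X_a) /
      -- (d(X_j) d(X_k))` of total mass `1`.
      have h2 : ((statDim j.rep : ℂ)⁻¹ • π.toLin (FusionAlgebra.basis j))
          (((statDim k.rep : ℂ)⁻¹ • π.toLin (FusionAlgebra.basis k)) ξ) =
          ∑ a, (statDim (d.idx a).rep / (statDim j.rep * statDim k.rep)) •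
            ((statDim (d.idx a).rep : ℂ)⁻¹ • π.toLin (FusionAlgebra.basis (d.idx a)) ξ) := by
        rw [smul_apply, smul_apply, map_smul, h1, smul_smul, Finset.smul_sum]
        refine Finset.sum_congr rfl fun a _ => ?_
        rw [← Complex.coe_smul, smul_smul]
        congr 1
        have := hd (d.idx a)
        have := hd j
        have := hd k
        push_cast
        field_simp
      rw [h2]
      refine (convex_convexHull ℝ _).sum_mem (fun a _ => ?_) ?_ (fun a _ => ?_)
      · have := statDim_pos (d.idx a)
        have := statDim_pos j
        have := statDim_pos k
        positivity
      · have h3 : (∑ a, statDim (d.idx a).rep) = statDim j.rep * statDim k.rep := by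
          exact_mod_cast sum_statDim_decomposition j k d
        rw [← Finset.sum_div, h3]
        exact div_self (mul_pos (statDim_pos j) (statDim_pos k)).ne'
      · exact subset_convexHull ℝ _ ⟨d.idx a, rfl⟩)
  refine ⟨v, hv, fun k => ?_⟩
  have := hfix k
  rw [smul_apply] at this
  rw [← this, smul_inv_smul₀ (hd k), this]

theorem AdmissibleRep.apply_eq_smul_of_invariant {π : AdmissibleRep C} {v : π.H}
    (hv : ∀ k : Irr C, π.toLin (FusionAlgebra.basis k) v = (statDim k.rep : ℂ) • v)
    (a : UniversalCStar C) : a.apply π v = UniversalCStar.trivialChar C a • v := by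
  have h1 : Continuous fun a : UniversalCStar C => a.apply π v := by
    let L : UniversalCStar C →ₗ[ℂ] π.H :=
      { toFun := fun a => a.apply π v
        map_add' := fun _ _ => rfl
        map_smul' := fun _ _ => rfl }
    exact AddMonoidHomClass.continuous_of_bound L ‖v‖ fun a =>
      (a.norm_apply_apply_le π v).trans_eq (mul_comm _ _)
  refine congrFun (UniversalCStar.eq_of_eqOn h1
    (UniversalCStar.continuous_trivialChar.smul continuous_const) fun f => ?_) a
  change π.toLin f v = UniversalCStar.trivialChar C (universalRep C f) • v
  rw [UniversalCStar.trivialChar_universalRep]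
  induction f using FusionAlgebra.induction with
  | zero => simp
  | add f g hf hg => rw [map_add, map_add, add_apply, hf, hg, add_smul]
  | smul_basis c k =>
    rw [map_smul, map_smul, smul_apply, hv, dimChar_basis, smul_smul, smul_eq_mul]

/-- The cp-multiplier of a unit vector. -/
def vectorMultiplier (π : AdmissibleRep C) {ξ : π.H} (hξ : ‖ξ‖ = 1) :
    lp (fun _ : Irr C => ℂ) ⊤ :=
  ⟨fun k => (statDim k.rep : ℂ)⁻¹ * inner ℂ ξ (π.toLin (FusionAlgebra.basis k) ξ),
    memℓp_infty ⟨1, by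
      rintro _ ⟨k, rfl⟩
      have := norm_inner_apply_le hξ (π.norm_basis_le k)
      change ‖(statDim k.rep : ℂ)⁻¹ * inner ℂ ξ (π.toLin (FusionAlgebra.basis k) ξ)‖ ≤ 1
      rwa [norm_mul, norm_inv, Complex.norm_real, Real.norm_of_nonneg (statDim_pos k).le,
        inv_mul_le_iff₀ (statDim_pos k), mul_one]⟩⟩

theorem vectorMultiplier_apply (π : AdmissibleRep C) {ξ : π.H} (hξ : ‖ξ‖ = 1) (k : Irr C) :
    vectorMultiplier π hξ k =
      (statDim k.rep : ℂ)⁻¹ * inner ℂ ξ (π.toLin (FusionAlgebra.basis k) ξ) := rfl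

theorem isCPMultiplier_vectorMultiplier (π : AdmissibleRep C) {ξ : π.H} (hξ : ‖ξ‖ = 1) :
    IsCPMultiplier (vectorMultiplier π hξ) := by
  refine ⟨π, ξ, hξ, fun f => ?_⟩
  induction f using FusionAlgebra.induction with
  | zero => simp
  | add f g hf hg => rw [map_add, map_add, add_apply, inner_add_right, hf, hg]
  | smul_basis c k =>
    have hd : (statDim k.rep : ℂ) ≠ 0 := by exact_mod_cast (statDim_pos k).ne'
    rw [map_smul, map_smul, smul_apply, inner_smul_right, multiplierFunctional_basis,
      vectorMultiplier_apply, mul_inv_cancel_left₀ hd, smul_eq_mul]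

theorem norm_vectorMultiplier_sub_one_le (π : AdmissibleRep C) {ξ : π.H} (hξ : ‖ξ‖ = 1)
    (k : Irr C) : ‖vectorMultiplier π hξ k - 1‖ ≤ (statDim k.rep)⁻¹ *
      ‖π.toLin (FusionAlgebra.basis k) ξ - (statDim k.rep : ℂ) • ξ‖ := by
  have hd : (statDim k.rep : ℂ) ≠ 0 := by exact_mod_cast (statDim_pos k).ne'
  have h : vectorMultiplier π hξ k - 1 = (statDim k.rep : ℂ)⁻¹ *
      inner ℂ ξ (π.toLin (FusionAlgebra.basis k) ξ - (statDim k.rep : ℂ) • ξ) := by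
    rw [vectorMultiplier_apply, inner_sub_right, inner_smul_right, inner_self_eq_norm_sq_to_K, hξ,
      mul_sub, inv_mul_cancel_left₀ hd]
    simp
  rw [h, norm_mul, norm_inv, Complex.norm_real, Real.norm_of_nonneg (statDim_pos k).le]
  refine mul_le_mul_of_nonneg_left ?_ (inv_nonneg.2 (statDim_pos k).le)
  refine (norm_inner_le_norm _ _).trans_eq ?_
  rw [hξ, one_mul]

/-- A vector whose multiplier is uniformly close to `1` is not orthogonal to the trivial
representation. -/
theorem trivialChar_ne_one_of_apply_eq_zero (π : AdmissibleRep C) {ξ : π.H} (hξ : ‖ξ‖ = 1)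
    (hclose : ∀ k, ‖vectorMultiplier π hξ k - 1‖ ≤ 1 / 2) {a : UniversalCStar C}
    (ha : ∀ f, a.apply π (π.toLin f ξ) = 0) : UniversalCStar.trivialChar C a ≠ 1 := by
  intro h1
  obtain ⟨v, hv, hinv⟩ := π.exists_invariant_vector ξ
  -- The half-space is closed and convex and contains the normalised orbit, hence also `v`; this is
  -- what keeps `v` away from zero.
  have h2 : closure (convexHull ℝ (Set.range fun k : Irr C =>
      (statDim k.rep : ℂ)⁻¹ • π.toLin (FusionAlgebra.basis k) ξ)) ⊆
      {w | 1 / 2 ≤ (inner ℂ ξ w).re} := by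
    refine closure_minimal (convexHull_min ?_ ?_) ?_
    · rintro _ ⟨k, rfl⟩
      have h3 := hclose k
      rw [vectorMultiplier_apply] at h3
      have h4 := (Complex.abs_re_le_norm _).trans h3
      rw [Complex.sub_re, Complex.one_re, abs_le] at h4
      change 1 / 2 ≤ (inner ℂ ξ _).re
      rw [inner_smul_right]
      linarith [h4.1]
    · refine convex_halfSpace_ge (f := fun w => (inner ℂ ξ w).re) ⟨fun x y => ?_, fun c x => ?_⟩ _
      · rw [inner_add_right, Complex.add_re]
      · rw [← Complex.coe_smul, inner_smul_right, Complex.re_ofReal_mul, smul_eq_mul]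
    · exact isClosed_le continuous_const (by fun_prop)
  have h3 : closure (convexHull ℝ (Set.range fun k : Irr C =>
      (statDim k.rep : ℂ)⁻¹ • π.toLin (FusionAlgebra.basis k) ξ)) ⊆
      {w | a.apply π w = 0} := by
    refine closure_minimal (convexHull_min ?_ ?_) ?_
    · rintro _ ⟨k, rfl⟩
      change a.apply π _ = 0
      rw [map_smul, ha, smul_zero]
    · exact (LinearMap.ker ((a.apply π).restrictScalars ℝ : π.H →ₗ[ℝ] π.H)).convex
    · exact isClosed_eq (a.apply π).continuous continuous_const
  have h4 : a.apply π v = 0 := h3 hv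
  -- On the invariant vector `v` the element `a` acts by its trivial character `1`, yet it kills the
  -- orbit and therefore `v`. So `v = 0`, contradicting the half-space bound.
  rw [AdmissibleRep.apply_eq_smul_of_invariant hinv, h1, one_smul] at h4
  have h5 : 1 / 2 ≤ (inner ℂ ξ v).re := h2 hv
  rw [h4] at h5
  norm_num at h5

theorem isOpen_of_propertyT {Z : Type w} [TopologicalSpace Z] [CompactSpace Z] [T2Space Z]
    (e : UniversalCStar C ≃⋆ₐ[ℂ] C(Z, ℂ)) {z₀ : Z}
    (hz₀ : ∀ a, e a z₀ = UniversalCStar.trivialChar C a) (hT : PropertyT C) : IsOpen {z₀} := by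
  classical
  by_contra ho
  have : Nonempty (Irr C) := ⟨Irr.unit C⟩
  have : Countable (Irr C) := RigidCStarTensorCategory.countable_irr
  obtain ⟨x, hx⟩ := exists_surjective_nat (Irr C)
  -- The finite sets exhaust `Irr C` along the enumeration while the tolerance `1 / (n + 1)` tends
  -- to zero, so every fixed `k` is controlled from some index on.
  choose π ξ a hξ hs ha h1 using fun n : ℕ => exists_almost_invariant e hz₀ ho
    ((Finset.range (n + 1)).image x) (Nat.one_div_pos_of_nat (α := ℝ) (n := n))
  have hlim : ∀ k, Tendsto (fun n => vectorMultiplier (π n) (hξ n) k) atTop (𝓝 1) := by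
    intro k
    obtain ⟨i, rfl⟩ := hx k
    rw [tendsto_iff_norm_sub_tendsto_zero]
    refine squeeze_zero' (Eventually.of_forall fun n => norm_nonneg _)
      (g := fun n : ℕ => (statDim (x i).rep)⁻¹ * (1 / ((n : ℝ) + 1))) ?_ ?_
    · filter_upwards [eventually_ge_atTop i] with n hn
      refine (norm_vectorMultiplier_sub_one_le _ _ _).trans
        (mul_le_mul_of_nonneg_left (hs n _ ?_) (inv_nonneg.2 (statDim_pos _).le))
      exact Finset.mem_image_of_mem x (Finset.mem_range.2 (by omega))
    · simpa using tendsto_one_div_add_atTop_nhds_zero_nat.const_mul (statDim (x i).rep)⁻¹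
  have hu := hT (fun n => vectorMultiplier (π n) (hξ n))
    (fun n => isCPMultiplier_vectorMultiplier (π n) (hξ n)) hlim
  obtain ⟨n, hn⟩ := (Metric.tendstoUniformly_iff.1 hu (1 / 2) (by norm_num)).exists
  refine trivialChar_ne_one_of_apply_eq_zero (π n) (hξ n) (fun k => ?_) (ha n) (h1 n)
  have := (hn k).le
  rwa [dist_comm, dist_eq_norm] at this

end
end RigidCStar

open RigidCStar
theorem corollary2p8 {C : Type u} [Category.{v} C] [Preadditive C] [Linear ℂ C]
    [MonoidalCategory C] [MonoidalPreadditive C] [MonoidalLinear ℂ C]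
    [RigidCStarTensorCategory C] (hC : ∀ x y : FusionAlgebra C, x * y = y * x) :
    ∃ ι : FusionAlgebra C →ₗ[ℂ] UniversalCStar C,
      (∀ f (π : AdmissibleRep C), (ι f).apply π = π.toLin f) ∧
      (∃ (Z : Type (max 1 u)) (_ : TopologicalSpace Z) (_ : CompactSpace Z) (_ : T2Space Z),
        Nonempty (UniversalCStar C ≃⋆ₐ[ℂ] C(Z, ℂ))) ∧
      ∀ (Z : Type w) [TopologicalSpace Z] [CompactSpace Z] [T2Space Z]
        (e : UniversalCStar C ≃⋆ₐ[ℂ] C(Z, ℂ)),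
        ∃ z₀ : Z, (∀ z, (∀ k : Irr C, e (ι (FusionAlgebra.basis k)) z = statDim k.rep) ↔ z = z₀) ∧
          (PropertyT C ↔ IsOpen {z₀}) := by
  refine ⟨universalRep C, UniversalCStar.universalRep_apply,
    UniversalCStar.exists_compactHausdorff hC, fun Z _ _ _ e => ?_⟩
  obtain ⟨z₀, hz₀⟩ := UniversalCStar.exists_eval_eq_trivialChar e
  exact ⟨z₀, UniversalCStar.eval_basis_iff e hz₀, isOpen_of_propertyT e hz₀,
    propertyT_of_isOpen e hz₀⟩
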